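/- Let $G=(V,E)$ be a finite directed (multi)graph with $n$ nodes, $m\ge 1$ edges, edge weights $c:E\to\mathbb R_{\ge 0}$, a source $s$ and a target $t$, such that for every node $v$ there are an $s$-$v$ path and a $v$-$t$ path; let $k\ge 1$. For $X\subseteq V$, a *shortest path tree* (SP tree) of $G-X$ is a set $T$ of edges with at most one edge leaving each node, none leaving $t$, such that from every node $v$ from which $t$ is reachable in $G-X$ the edges of $T$ lead to $t$ along a shortest $v$-$t$ path of $G-X$, and no edge of $T$ leaves any other node; write $v\in T$ if $T$ contains a $v$-$t$ path. A *sidetrack sequence* is a sequence $(e_1,\dots,e_r)$ of edges in which each $e_i$ carries an SP tree $T_{e_i}$. It represents the path that starts in $s$, follows a fixed SP tree $T_0$ of $G$ to the tail of $e_1$, traverses $e_1$, follows $T_{e_1}$ to the tail of $e_2$, and so on, until after $e_r$ it follows $T_{e_r}$ to $t$ (for $r=0$ it follows $T_0$ from $s$ to $t$). The *basic algorithm* for the $k$ shortest simple $s$-$t$ paths computes $T_0$ and starts with a priority queue $Q$ that holds the empty sequence; the key of a sequence is the length of its path. While fewer than $k$ simple paths have been output and $Q$ is not empty, it extracts a sequence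 $(e_1,\dots,e_r)$ of minimum key. Let $p$ be its path and $T=T_{e_r}$ ($T=T_0$ if $r=0$). * If $p$ is simple, $p$ is output. For every edge $e=(u,v)\notin T$ such that $u\ne t$ lies on the part of $p$ behind $e_r$ (on $p$, if $r=0$) and $v\in T$, the sequence $(e_1,\dots,e_r,e)$ with $T_e=T$ is pushed to $Q$. * If $p$ is not simple, an SP tree $T'$ of $G-X$ is computed, where $X$ is the set of nodes of $p$ up to and including the tail of $e_r$. If the head of $e_r$ is in $T'$, the sequence $(e_1,\dots,e_r)$ with $T_{e_r}$ replaced by $T'$ is pushed to $Q$; otherwise the sequence is discarded. Then the running time of the basic algorithm is $\mathcal O(km(m+n\log n))$. That is, on a random access machine with uniform cost (natural numbers are added, subtracted, compared and used as addresses; real numbers are only copied, added, subtracted and compared) there are a program and a constant $C$ such that, for every such input, the program performs a complete run of the basic algorithm, writing the protocol of the run ($T_0$; in each iteration the extracted path, and the extensions pushed or the new SP tree) to its output, and halts after at most $C\cdot km(m+n\log n)$ steps. -/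

import Mathlib

open scoped NNReal

namespace KSSP

/-! ## Networks, paths, shortest path trees -/

/-- A finite directed graph with node set `Fin n` and edge set `Fin m` (parallel edges and loops
are allowed), nonnegative real edge weights, a source `s` and a target `t`. -/
structure Network where
  n : ℕ
  m : ℕ
  tail : Fin m → Fin n
  head : Fin m → Fin n
  weight : Fin m → ℝ≥0
  s : Fin n
  t : Fin n

namespace Network

variable (N : Network)

/-- `N.IsPath v w p`: the edge sequence `p` is a path from `v` to `w`
(the empty sequence is the trivial path from `v` to `v`). -/
def IsPath : Fin N.n → Fin N.n → List (Fin N.m) → Prop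
  | v, w, [] => v = w
  | v, w, e :: p => N.tail e = v ∧ IsPath (N.head e) w p

/-- The nodes on the path `p` that starts in `v`, in the order of their visits. -/
def nodes (v : Fin N.n) (p : List (Fin N.m)) : List (Fin N.n) := v :: p.map N.head

/-- The path `p` that starts in `v` visits no node twice. -/
def IsSimple (v : Fin N.n) (p : List (Fin N.m)) : Prop := (N.nodes v p).Nodup

/-- The length of a path: the sum of its edge weights. -/
def length (p : List (Fin N.m)) : ℝ≥0 := (p.map N.weight).sum

/-- The standing assumption: every node lies between `s` and `t`. -/
def IsConnected : Prop :=
  ∀ v, (∃ p, N.IsPath N.s v p) ∧ (∃ p, N.IsPath v N.t p)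

/-- `N.IsPathAvoiding X v p`: `p` is a path from `v` to `t` in the subgraph induced by the nodes
outside `X`. -/
def IsPathAvoiding (X : Set (Fin N.n)) (v : Fin N.n) (p : List (Fin N.m)) : Prop :=
  N.IsPath v N.t p ∧ ∀ u ∈ N.nodes v p, u ∉ X

/-- A set of edges with at most one edge leaving each node: `T v` is the edge leaving `v`, if
there is one. The edge `e` belongs to `T` if and only if `T (tail e) = some e`. -/
abbrev Tree : Type := Fin N.n → Option (Fin N.m)

variable {N} in
/-- `p` is a path from `v` to `t` all of whose edges belong to `T`. -/
def IsTreePath (T : N.Tree) (v : Fin N.n) (p : List (Fin N.m)) : Prop :=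
  N.IsPath v N.t p ∧ ∀ e ∈ p, T (N.tail e) = some e

variable {N} in
/-- `T` contains a path from `v` to `t`. -/
def InTree (T : N.Tree) (v : Fin N.n) : Prop := ∃ p, IsTreePath T v p

variable {N} in
/-- `T` is a shortest path tree, directed towards `t`, of the subgraph induced by the nodes outside
`X`: from every node from which `t` can be reached in this subgraph, the edges of `T` lead to `t`
along a shortest path of the subgraph, and all other nodes have no edge. -/
def IsSPTree (X : Set (Fin N.n)) (T : N.Tree) : Prop :=
  T N.t = none ∧
  ∀ v, ((∃ p, N.IsPathAvoiding X v p) →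
      ∃ p, IsTreePath T v p ∧ N.IsPathAvoiding X v p ∧
        ∀ p', N.IsPathAvoiding X v p' → N.length p ≤ N.length p') ∧
    ((¬ ∃ p, N.IsPathAvoiding X v p) → T v = none)

/-! ## Sidetrack sequences -/

/-- A sidetrack sequence in which every sidetrack carries its own tree. The sequence is stored
with its LAST sidetrack at the head of the list, so that `(e, T) :: q` extends `q` by `e`. -/
abbrev Seq : Type := List (Fin N.m × N.Tree)

variable {N} in
/-- Follow the edges of `T` from `v` until `u` is reached (at most `fuel` edges). -/
def follow (T : N.Tree) (u : Fin N.n) : ℕ → Fin N.n → List (Fin N.m)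
  | 0, _ => []
  | fuel + 1, v =>
    if v = u then []
    else match T v with
      | none => []
      | some e => e :: follow T u fuel (N.head e)

variable {N} (T₀ : N.Tree)

/-- The path represented by a sequence, but stopped, after the last sidetrack, in `u`. It starts
in `s` and follows `T₀` up to the tail of the first sidetrack; after each sidetrack it follows the
tree of this sidetrack up to the tail of the next one. -/
def trunk : N.Seq → Fin N.n → List (Fin N.m)
  | [], u => follow T₀ u N.n N.s
  | (e, T) :: q, u => trunk q (N.tail e) ++ e :: follow T u N.n (N.head e)

/-- The path represented by a sequence. -/
def path (q : N.Seq) : List (Fin N.m) := trunk T₀ q N.t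

/-- The tree used after the last sidetrack. -/
def lastTree : N.Seq → N.Tree
  | [] => T₀
  | (_, T) :: _ => T

/-- The suffix path: the part of the represented path behind the last sidetrack, which is the
deviation edge. For the empty sequence it is the whole path. -/
def suffixStart : N.Seq → Fin N.n
  | [] => N.s
  | (e, _) :: _ => N.head e

/-- See `suffixStart`. -/
def suffix (q : N.Seq) : List (Fin N.m) :=
  follow (lastTree T₀ q) N.t N.n (suffixStart q)

/-- The sidetracks by which a simple path, represented by `q`, is extended: edges outside of the
last tree whose tail is a node of the suffix path, other than `t`, and from whose head the last
tree leads to `t`. -/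
def IsExtension (q : N.Seq) (e : Fin N.m) : Prop :=
  N.tail e ∈ N.nodes (suffixStart q) (suffix T₀ q) ∧ N.tail e ≠ N.t ∧
  lastTree T₀ q (N.tail e) ≠ some e ∧ InTree (lastTree T₀ q) (N.head e)

/-- The nodes of the prefix path of `(e, T) :: q`; this path starts in `s`, runs along the path of
`q`, and ends in the deviation node, the tail of `e`. -/
def prefixNodes (q : N.Seq) (e : Fin N.m) : Set (Fin N.n) :=
  {u | u ∈ N.nodes N.s (trunk T₀ q (N.tail e))}

/-! ## The basic algorithm -/

variable (N) in
/-- The state of the algorithm: the priority queue and the number of simple paths found. -/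
structure State where
  queue : Multiset N.Seq
  found : ℕ

variable (N) in
/-- What happens in one iteration. `simple q es`: the extracted sequence `q` represents a simple
path; this path is output, and the extensions of `q` by the edges in `es` are pushed.
`repaired q T`, `discarded q T`: the path of `q` is not simple; the new tree `T` is computed, and
`q` is pushed again with this tree, or is discarded. -/
inductive Event where
  | simple (q : N.Seq) (es : List (Fin N.m))
  | repaired (q : N.Seq) (T : N.Tree)
  | discarded (q : N.Seq) (T : N.Tree)

/-- One iteration of the algorithm that looks for `k` paths: while fewer than `k` simple paths have
been found, extract a sequence whose path has minimum length. -/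
inductive Step (k : ℕ) : N.State → N.Event → N.State → Prop
  | simple (q : N.Seq) (R : Multiset N.Seq) (j : ℕ) (es : List (Fin N.m)) :
      j < k →
      (∀ q' ∈ R, N.length (path T₀ q) ≤ N.length (path T₀ q')) →
      N.IsSimple N.s (path T₀ q) →
      es.Nodup → (∀ e, e ∈ es ↔ IsExtension T₀ q e) →
      Step k ⟨q ::ₘ R, j⟩ (.simple q es)
        ⟨R + (es.map fun e => (e, lastTree T₀ q) :: q : Multiset N.Seq), j + 1⟩
  | repaired (q : N.Seq) (e : Fin N.m) (T' T : N.Tree) (R : Multiset N.Seq) (j : ℕ) :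
      j < k →
      (∀ q' ∈ R, N.length (path T₀ ((e, T') :: q)) ≤ N.length (path T₀ q')) →
      ¬ N.IsSimple N.s (path T₀ ((e, T') :: q)) →
      IsSPTree (prefixNodes T₀ q e) T → InTree T (N.head e) →
      Step k ⟨((e, T') :: q) ::ₘ R, j⟩ (.repaired ((e, T') :: q) T) ⟨((e, T) :: q) ::ₘ R, j⟩
  | discarded (q : N.Seq) (e : Fin N.m) (T' T : N.Tree) (R : Multiset N.Seq) (j : ℕ) :
      j < k →
      (∀ q' ∈ R, N.length (path T₀ ((e, T') :: q)) ≤ N.length (path T₀ q')) →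
      ¬ N.IsSimple N.s (path T₀ ((e, T') :: q)) →
      IsSPTree (prefixNodes T₀ q e) T → ¬ InTree T (N.head e) →
      Step k ⟨((e, T') :: q) ::ₘ R, j⟩ (.discarded ((e, T') :: q) T) ⟨R, j⟩

/-- A finite sequence of iterations. -/
inductive Steps (k : ℕ) : N.State → List N.Event → N.State → Prop
  | nil (a : N.State) : Steps k a [] a
  | cons {a b d : N.State} {ev : N.Event} {evs : List N.Event} :
      Step T₀ k a ev b → Steps k b evs d → Steps k a (ev :: evs) d

/-- `IsRun T₀ k evs`: the algorithm, with the initial shortest path tree `T₀`, can perform the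
iterations `evs` and then stops, as it has found `k` simple paths or as the queue is empty. -/
def IsRun (k : ℕ) (evs : List N.Event) : Prop :=
  IsSPTree ∅ T₀ ∧
  ∃ b : N.State, Steps T₀ k ⟨{[]}, 0⟩ evs b ∧ (b.found = k ∨ b.queue = 0)

/-! ## The protocol of a run, as a list of numbers -/

/-- A tree: for each node the number of its edge plus one, or `0` if it has none. -/
def encodeTree (T : N.Tree) : List ℕ :=
  (List.finRange N.n).map fun v => match T v with
    | none => 0
    | some e => (e : ℕ) + 1

/-- A list of edges, preceded by its length. -/
def encodeEdges (p : List (Fin N.m)) : List ℕ := p.length :: p.map fun e => (e : ℕ)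

/-- One iteration: its kind, the path extracted from the queue (which is also the path that is
output if it is simple), and the extensions pushed or the new shortest path tree. -/
def encodeEvent : N.Event → List ℕ
  | .simple q es => 1 :: (encodeEdges (path T₀ q) ++ encodeEdges es)
  | .repaired q T => 2 :: (encodeEdges (path T₀ q) ++ encodeTree T)
  | .discarded q T => 3 :: (encodeEdges (path T₀ q) ++ encodeTree T)

/-- The protocol of a run: the initial tree, then the iterations in their order. -/
def encodeRun (evs : List N.Event) : List ℕ :=
  encodeTree T₀ ++ evs.flatMap (encodeEvent T₀)

end Network

/-! ## Random access machines with uniform cost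

Memory cells hold natural numbers or real numbers. Natural numbers can be added, subtracted,
compared and used as addresses; real numbers can only be copied, added, subtracted and compared.
There is no multiplication, no division, and no conversion between the two kinds. A program is a
fixed finite text, so it names finitely many registers and finitely many arrays. -/

/-- The contents of the memory: number registers, real registers, arrays of numbers, arrays of
reals, and the output written so far. -/
structure Store where
  nreg : ℕ → ℕ
  rreg : ℕ → ℝ
  narr : ℕ → ℕ → ℕ
  rarr : ℕ → ℕ → ℝ
  out : List ℕ

/-- Expressions for natural numbers; `get a i` is the cell with address `i` of the array `a`. -/
inductive NExpr where
  | lit (c : ℕ)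
  | reg (x : ℕ)
  | get (a : ℕ) (i : NExpr)
  | add (e f : NExpr)
  | sub (e f : NExpr)

/-- Expressions for real numbers. -/
inductive RExpr where
  | zero
  | reg (x : ℕ)
  | get (a : ℕ) (i : NExpr)
  | add (e f : RExpr)
  | sub (e f : RExpr)

/-- Tests. -/
inductive Test where
  | nlt (e f : NExpr)
  | neq (e f : NExpr)
  | rlt (e f : RExpr)
  | not (b : Test)
  | and (b d : Test)

namespace NExpr

/-- The value of an expression; the subtraction is truncated at `0`. -/
def eval (σ : Store) : NExpr → ℕ
  | lit c => c
  | reg x => σ.nreg x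
  | get a i => σ.narr a (i.eval σ)
  | add e f => e.eval σ + f.eval σ
  | sub e f => e.eval σ - f.eval σ

/-- The time for an evaluation: one step for each constant, register, array access, operation. -/
def cost : NExpr → ℕ
  | lit _ => 1
  | reg _ => 1
  | get _ i => i.cost + 1
  | add e f => e.cost + f.cost + 1
  | sub e f => e.cost + f.cost + 1

end NExpr

namespace RExpr

/-- The value of an expression. -/
noncomputable def eval (σ : Store) : RExpr → ℝ
  | zero => 0
  | reg x => σ.rreg x
  | get a i => σ.rarr a (i.eval σ)
  | add e f => e.eval σ + f.eval σ
  | sub e f => e.eval σ - f.eval σ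

/-- The time for an evaluation. -/
def cost : RExpr → ℕ
  | zero => 1
  | reg _ => 1
  | get _ i => i.cost + 1
  | add e f => e.cost + f.cost + 1
  | sub e f => e.cost + f.cost + 1

end RExpr

namespace Test

/-- The test succeeds: `nlt`, `rlt` test for "less than", `neq` tests for equality of numbers. -/
def Holds (σ : Store) : Test → Prop
  | nlt e f => e.eval σ < f.eval σ
  | neq e f => e.eval σ = f.eval σ
  | rlt e f => e.eval σ < f.eval σ
  | not b => ¬ b.Holds σ
  | and b d => b.Holds σ ∧ d.Holds σ

/-- The time for a test. -/
def cost : Test → ℕ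
  | nlt e f => e.cost + f.cost + 1
  | neq e f => e.cost + f.cost + 1
  | rlt e f => e.cost + f.cost + 1
  | not b => b.cost + 1
  | and b d => b.cost + d.cost + 1

end Test

/-- Programs: assignments to registers and array cells, output of a number, and control flow. -/
inductive Prog where
  | skip
  | nset (x : ℕ) (e : NExpr)
  | rset (x : ℕ) (e : RExpr)
  | nput (a : ℕ) (i e : NExpr)
  | rput (a : ℕ) (i : NExpr) (e : RExpr)
  | emit (e : NExpr)
  | seq (P Q : Prog)
  | ite (b : Test) (P Q : Prog)
  | loop (b : Test) (P : Prog)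

open Function in
/-- `Exec P σ τ σ'`: started with the memory `σ`, the program `P` halts after exactly `τ` steps
with the memory `σ'`. -/
inductive Exec : Prog → Store → ℕ → Store → Prop
  | skip (σ : Store) : Exec .skip σ 1 σ
  | nset (x : ℕ) (e : NExpr) (σ : Store) :
      Exec (.nset x e) σ (e.cost + 1) { σ with nreg := update σ.nreg x (e.eval σ) }
  | rset (x : ℕ) (e : RExpr) (σ : Store) :
      Exec (.rset x e) σ (e.cost + 1) { σ with rreg := update σ.rreg x (e.eval σ) }
  | nput (a : ℕ) (i e : NExpr) (σ : Store) :
      Exec (.nput a i e) σ (i.cost + e.cost + 1)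
        { σ with narr := update σ.narr a (update (σ.narr a) (i.eval σ) (e.eval σ)) }
  | rput (a : ℕ) (i : NExpr) (e : RExpr) (σ : Store) :
      Exec (.rput a i e) σ (i.cost + e.cost + 1)
        { σ with rarr := update σ.rarr a (update (σ.rarr a) (i.eval σ) (e.eval σ)) }
  | emit (e : NExpr) (σ : Store) :
      Exec (.emit e) σ (e.cost + 1) { σ with out := σ.out ++ [e.eval σ] }
  | seq {P Q : Prog} {σ₁ σ₂ σ₃ : Store} {τ₁ τ₂ : ℕ} :
      Exec P σ₁ τ₁ σ₂ → Exec Q σ₂ τ₂ σ₃ → Exec (.seq P Q) σ₁ (τ₁ + τ₂) σ₃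
  | iteTrue {b : Test} {P Q : Prog} {σ σ' : Store} {τ : ℕ} :
      b.Holds σ → Exec P σ τ σ' → Exec (.ite b P Q) σ (b.cost + τ + 1) σ'
  | iteFalse {b : Test} {P Q : Prog} {σ σ' : Store} {τ : ℕ} :
      ¬ b.Holds σ → Exec Q σ τ σ' → Exec (.ite b P Q) σ (b.cost + τ + 1) σ'
  | loopDone {b : Test} {P : Prog} {σ : Store} :
      ¬ b.Holds σ → Exec (.loop b P) σ (b.cost + 1) σ
  | loopStep {b : Test} {P : Prog} {σ₁ σ₂ σ₃ : Store} {τ₁ τ₂ : ℕ} :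
      b.Holds σ₁ → Exec P σ₁ τ₁ σ₂ → Exec (.loop b P) σ₂ τ₂ σ₃ →
      Exec (.loop b P) σ₁ (b.cost + τ₁ + τ₂ + 1) σ₃

/-- The initial memory for the network `N` and the number `k`: registers `0, …, 4` hold
`n, m, k, s, t`, the number arrays `0` and `1` hold the tails and the heads of the edges, the real
array `0` holds the edge weights; everything else is zero, and nothing has been output. -/
noncomputable def inputStore (N : Network) (k : ℕ) : Store where
  nreg x := match x with
    | 0 => N.n
    | 1 => N.m
    | 2 => k
    | 3 => N.s
    | 4 => N.t
    | _ => 0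
  rreg _ := 0
  narr a i := if h : i < N.m then
      match a with
      | 0 => N.tail ⟨i, h⟩
      | 1 => N.head ⟨i, h⟩
      | _ => 0
    else 0
  rarr a i := if h : i < N.m then
      match a with
      | 0 => N.weight ⟨i, h⟩
      | _ => 0
    else 0
  out := []

end KSSP

/-!
The program `basicAlgorithm` keeps the running time without Fibonacci heaps, for two reasons.

The tree `T'` that is needed when a sequence turns out to represent a path that is not simple depends
only on the tail of its last sidetrack and on the sequence that has been extended. All extensions at
the same node of a suffix path share this tree. Hence it can be computed in advance: when a
simple path is output, Dijkstra's algorithm runs once for each node of the suffix path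
(`wp_expandNode`), and each new record of the queue stores the address of the tree that it may need
later. There are at most `k` simple paths with at most `n` nodes each, so there are at most `kn` of
these runs. With a tournament tree as priority queue each of them takes `O((n + m) log n)` steps
(`wp_dijkstra`). As every node lies between `s` and `t`, `n ≤ m + 1`, and the sum of these
times is `O(km(m + n log n))`. Looking a tree up instead of computing it is invisible in the
protocol.

All other work takes `O(m)` steps per pushed sequence and per extracted sequence, apart from
`O(m²)` steps per simple path. A sequence whose tree has been replaced represents a simple path
(`Network.Good.repaired`), so each sequence is replaced or discarded at most once, and a
simple path has at most `m` extensions. The main loop is therefore paid for by a potential, in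
which each missing path counts `simpleCost` and each record whose tree has not been replaced counts
`repairCost` (`wp_mainLoop`). The queue of the algorithm is a tournament tree too. Its nodes are the
records, linked such that the extensions of a record form a chain below it (first child and next
sibling), so that a new record is a new leaf (`Tour.AllOK.insert`). Its depth is `O(m)`: the
extensions above a record have distinct edges, whose tails lie on the prefix path (`wp_push`). An
update of the queue walks from a record to the root, in `O(m)` steps, and the least record is
found at the root (`Tour.AllOK.root`).

Programs are verified with weakest preconditions `WP` that also bound the number of steps. A frame
rule, computed from the text of the programs (`Fr`), tells what a program does not change.

The memory is used as follows. Number registers: `0, …, 4` the input, `5, 6, 7` the repair of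
tournament trees, `8` the first free address for trees, `9, …, 13` Dijkstra's algorithm, `14, …, 19`
arguments of the routines on paths (address, length, index, edge, node, tree), `20` the first free
address for paths, `21` the number of simple paths found, `22` the last record, `23` the
extracted record, `24, …, 36` auxiliary values for the treatment of this record. Number arrays: `0, …, 3`
the graph, `4, …, 8` the tournament tree of Dijkstra's algorithm, `9, …, 13` that of the queue, `14`
the settled nodes, `15` the forbidden nodes, `16` all trees, `17` all paths, `18, …, 23` the
records, `24` the extensions of the extracted record, `25` the marks of the test for simple paths.
The real arrays `0`, `1`, `2` hold the weights and the keys of the two tournament trees.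
-/

namespace KSSP

/-! ### Weakest preconditions with running times -/

/-- `WP P σ Q`: started with the memory `σ`, the program `P` halts, and its running time and its
final memory satisfy `Q`. -/
def WP (P : Prog) (σ : Store) (Q : ℕ → Store → Prop) : Prop := ∃ τ σ', Exec P σ τ σ' ∧ Q τ σ'

infixr:60 " ;; " => Prog.seq

namespace Prog

/-- `P.wN x`: the program `P` contains an assignment to the number register `x`. -/
def wN : Prog → ℕ → Bool
  | nset x _, y => decide (x = y)
  | seq P Q, y => P.wN y || Q.wN y
  | ite _ P Q, y => P.wN y || Q.wN y
  | loop _ P, y => P.wN y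
  | _, _ => false

/-- `P.wR x`: the program `P` contains an assignment to the real register `x`. -/
def wR : Prog → ℕ → Bool
  | rset x _, y => decide (x = y)
  | seq P Q, y => P.wR y || Q.wR y
  | ite _ P Q, y => P.wR y || Q.wR y
  | loop _ P, y => P.wR y
  | _, _ => false

/-- `P.wNA a`: the program `P` contains an assignment to a cell of the number array `a`. -/
def wNA : Prog → ℕ → Bool
  | nput x _ _, y => decide (x = y)
  | seq P Q, y => P.wNA y || Q.wNA y
  | ite _ P Q, y => P.wNA y || Q.wNA y
  | loop _ P, y => P.wNA y
  | _, _ => false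

/-- `P.wRA a`: the program `P` contains an assignment to a cell of the real array `a`. -/
def wRA : Prog → ℕ → Bool
  | rput x _ _, y => decide (x = y)
  | seq P Q, y => P.wRA y || Q.wRA y
  | ite _ P Q, y => P.wRA y || Q.wRA y
  | loop _ P, y => P.wRA y
  | _, _ => false

/-- `P.wO`: the program `P` contains an output instruction. -/
def wO : Prog → Bool
  | emit _ => true
  | seq P Q => P.wO || Q.wO
  | ite _ P Q => P.wO || Q.wO
  | loop _ P => P.wO
  | _ => false

end Prog

/-- The memories `σ` and `σ'` agree on everything that the text of `P` does not assign to. -/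
structure Fr (P : Prog) (σ σ' : Store) : Prop where
  nreg : ∀ x, P.wN x = false → σ'.nreg x = σ.nreg x
  rreg : ∀ x, P.wR x = false → σ'.rreg x = σ.rreg x
  narr : ∀ x, P.wNA x = false → σ'.narr x = σ.narr x
  rarr : ∀ x, P.wRA x = false → σ'.rarr x = σ.rarr x
  out : P.wO = false → σ'.out = σ.out

theorem Fr.refl (P : Prog) (σ : Store) : Fr P σ σ :=
  ⟨fun _ _ => rfl, fun _ _ => rfl, fun _ _ => rfl, fun _ _ => rfl, fun _ => rfl⟩

theorem Fr.trans {P : Prog} {σ σ' σ'' : Store} (h : Fr P σ σ') (h' : Fr P σ' σ'') :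
    Fr P σ σ'' :=
  ⟨fun x hx => (h'.nreg x hx).trans (h.nreg x hx), fun x hx => (h'.rreg x hx).trans (h.rreg x hx),
    fun x hx => (h'.narr x hx).trans (h.narr x hx), fun x hx => (h'.rarr x hx).trans (h.rarr x hx),
    fun hx => (h'.out hx).trans (h.out hx)⟩

theorem Exec.frame {P : Prog} {σ σ' : Store} {τ : ℕ} (h : Exec P σ τ σ') : Fr P σ σ' := by
  induction h with
  | skip σ => exact Fr.refl _ _
  | loopDone _ => exact Fr.refl _ _
  | nset x e σ =>
    refine ⟨fun y hy => ?_, fun _ _ => rfl, fun _ _ => rfl, fun _ _ => rfl, fun _ => rfl⟩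
    simp only [Prog.wN, decide_eq_false_iff_not] at hy
    exact Function.update_of_ne (Ne.symm hy) _ _
  | rset x e σ =>
    refine ⟨fun _ _ => rfl, fun y hy => ?_, fun _ _ => rfl, fun _ _ => rfl, fun _ => rfl⟩
    simp only [Prog.wR, decide_eq_false_iff_not] at hy
    exact Function.update_of_ne (Ne.symm hy) _ _
  | nput x i e σ =>
    refine ⟨fun _ _ => rfl, fun _ _ => rfl, fun y hy => ?_, fun _ _ => rfl, fun _ => rfl⟩
    simp only [Prog.wNA, decide_eq_false_iff_not] at hy
    exact Function.update_of_ne (Ne.symm hy) _ _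
  | rput x i e σ =>
    refine ⟨fun _ _ => rfl, fun _ _ => rfl, fun _ _ => rfl, fun y hy => ?_, fun _ => rfl⟩
    simp only [Prog.wRA, decide_eq_false_iff_not] at hy
    exact Function.update_of_ne (Ne.symm hy) _ _
  | emit e σ =>
    exact ⟨fun _ _ => rfl, fun _ _ => rfl, fun _ _ => rfl, fun _ _ => rfl,
      fun h => by simp [Prog.wO] at h⟩
  | seq _ _ ih₁ ih₂ =>
    constructor <;> intros <;> simp_all [Prog.wN, Prog.wR, Prog.wNA, Prog.wRA, Prog.wO,
      ih₁.nreg, ih₂.nreg, ih₁.rreg, ih₂.rreg, ih₁.narr, ih₂.narr, ih₁.rarr, ih₂.rarr,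
      ih₁.out, ih₂.out]
  | iteTrue _ _ ih =>
    constructor <;> intros <;> simp_all [Prog.wN, Prog.wR, Prog.wNA, Prog.wRA, Prog.wO,
      ih.nreg, ih.rreg, ih.narr, ih.rarr, ih.out]
  | iteFalse _ _ ih =>
    constructor <;> intros <;> simp_all [Prog.wN, Prog.wR, Prog.wNA, Prog.wRA, Prog.wO,
      ih.nreg, ih.rreg, ih.narr, ih.rarr, ih.out]
  | loopStep _ _ _ ih₁ ih₂ =>
    exact Fr.trans ⟨ih₁.nreg, ih₁.rreg, ih₁.narr, ih₁.rarr, ih₁.out⟩ ih₂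

/-- The rule of consequence. The new postcondition may use that the memory changes only where the
text of the program assigns to it. -/
theorem WP.mono {P : Prog} {σ : Store} {Q R : ℕ → Store → Prop} (h : WP P σ Q)
    (hQ : ∀ τ σ', Fr P σ σ' → Q τ σ' → R τ σ') : WP P σ R := by
  obtain ⟨τ, σ', hE, hq⟩ := h
  exact ⟨τ, σ', hE, hQ τ σ' hE.frame hq⟩

/-- Replace the initial memory by a variable, so that the terms for later memories stay small. -/
theorem wp_gen {P : Prog} {σ : Store} {Q : ℕ → Store → Prop} (h : ∀ σ₁, σ₁ = σ → WP P σ₁ Q) :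
    WP P σ Q := h σ rfl

theorem wp_skip {σ : Store} {Q : ℕ → Store → Prop} (h : Q 1 σ) : WP .skip σ Q :=
  ⟨_, _, Exec.skip σ, h⟩

theorem wp_nset {x : ℕ} {e : NExpr} {σ : Store} {Q : ℕ → Store → Prop}
    (h : Q (e.cost + 1) { σ with nreg := Function.update σ.nreg x (e.eval σ) }) :
    WP (.nset x e) σ Q := ⟨_, _, Exec.nset x e σ, h⟩

theorem wp_rset {x : ℕ} {e : RExpr} {σ : Store} {Q : ℕ → Store → Prop}
    (h : Q (e.cost + 1) { σ with rreg := Function.update σ.rreg x (e.eval σ) }) :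
    WP (.rset x e) σ Q := ⟨_, _, Exec.rset x e σ, h⟩

theorem wp_nput {a : ℕ} {i e : NExpr} {σ : Store} {Q : ℕ → Store → Prop}
    (h : Q (i.cost + e.cost + 1) { σ with
      narr := Function.update σ.narr a (Function.update (σ.narr a) (i.eval σ) (e.eval σ)) }) :
    WP (.nput a i e) σ Q := ⟨_, _, Exec.nput a i e σ, h⟩

theorem wp_rput {a : ℕ} {i : NExpr} {e : RExpr} {σ : Store} {Q : ℕ → Store → Prop}
    (h : Q (i.cost + e.cost + 1) { σ with
      rarr := Function.update σ.rarr a (Function.update (σ.rarr a) (i.eval σ) (e.eval σ)) }) :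
    WP (.rput a i e) σ Q := ⟨_, _, Exec.rput a i e σ, h⟩

theorem wp_emit {e : NExpr} {σ : Store} {Q : ℕ → Store → Prop}
    (h : Q (e.cost + 1) { σ with out := σ.out ++ [e.eval σ] }) :
    WP (.emit e) σ Q := ⟨_, _, Exec.emit e σ, h⟩

theorem wp_seq {P P' : Prog} {σ : Store} {Q : ℕ → Store → Prop}
    (h : WP P σ fun τ σ' => WP P' σ' fun τ' => Q (τ + τ')) : WP (P ;; P') σ Q := by
  obtain ⟨τ, σ', hE, τ', σ'', hE', hQ⟩ := h
  exact ⟨_, _, Exec.seq hE hE', hQ⟩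

theorem wp_ite {b : Test} {P P' : Prog} {σ : Store} {Q : ℕ → Store → Prop}
    (h₁ : b.Holds σ → WP P σ fun τ => Q (b.cost + τ + 1))
    (h₂ : ¬ b.Holds σ → WP P' σ fun τ => Q (b.cost + τ + 1)) : WP (.ite b P P') σ Q := by
  by_cases hb : b.Holds σ
  · obtain ⟨τ, σ', hE, hQ⟩ := h₁ hb
    exact ⟨_, _, Exec.iteTrue hb hE, hQ⟩
  · obtain ⟨τ, σ', hE, hQ⟩ := h₂ hb
    exact ⟨_, _, Exec.iteFalse hb hE, hQ⟩

/-- The rule for loops. The invariant `I p` carries the time `p` that is still available: each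
iteration has to be paid for by a decrease of `p`, and the rest is available after the loop. -/
theorem wp_loop_rest {b : Test} {P : Prog} {σ : Store} (I Q : ℕ → Store → Prop) (p : ℕ)
    (h₀ : I p σ)
    (hs : ∀ p σ', Fr P σ σ' → I p σ' → b.Holds σ' →
      WP P σ' fun τ σ'' => ∃ p', b.cost + 1 + τ + p' ≤ p ∧ I p' σ'')
    (he : ∀ p σ', Fr P σ σ' → I p σ' → ¬ b.Holds σ' → ∃ p', b.cost + 1 + p' ≤ p ∧ Q p' σ') :
    WP (.loop b P) σ fun τ σ' => ∃ p', τ + p' ≤ p ∧ Q p' σ' := by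
  suffices H : ∀ p σ', Fr P σ σ' → I p σ' →
      WP (.loop b P) σ' fun τ σ'' => ∃ p', τ + p' ≤ p ∧ Q p' σ'' from H p σ (Fr.refl _ _) h₀
  intro p
  induction p using Nat.strong_induction_on with
  | _ p ih =>
    intro σ' hF hI
    by_cases hb : b.Holds σ'
    · obtain ⟨τ, σ'', hE, p', hp, hI'⟩ := hs p σ' hF hI hb
      obtain ⟨τ', σ₃, hE', p'', hτ', hQ⟩ := ih p' (by omega) σ'' (hF.trans hE.frame) hI'
      exact ⟨_, _, Exec.loopStep hb hE hE', p'', by omega, hQ⟩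
    · obtain ⟨p', hp, hQ⟩ := he p σ' hF hI hb
      exact ⟨_, _, Exec.loopDone hb, p', hp, hQ⟩

theorem wp_loop {b : Test} {P : Prog} {σ : Store} (I : ℕ → Store → Prop) {Q : Store → Prop} (p : ℕ)
    (h₀ : I p σ)
    (hs : ∀ p σ', Fr P σ σ' → I p σ' → b.Holds σ' →
      WP P σ' fun τ σ'' => ∃ p', b.cost + 1 + τ + p' ≤ p ∧ I p' σ'')
    (he : ∀ p σ', Fr P σ σ' → I p σ' → ¬ b.Holds σ' → b.cost + 1 ≤ p ∧ Q σ') :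
    WP (.loop b P) σ fun τ σ' => τ ≤ p ∧ Q σ' :=
  (wp_loop_rest I (fun _ => Q) p h₀ hs fun p σ' h₁ h₂ h₃ => ⟨0, he p σ' h₁ h₂ h₃⟩).mono
    fun _ _ _ ⟨_, h₁, h₂⟩ => ⟨by omega, h₂⟩

/-- The rule for loops in which the number register `i` runs from its current value up to a bound;
each iteration takes at most `c` steps. -/
theorem wp_for {i : ℕ} {B : NExpr} {P : Prog} {σ : Store} (I : ℕ → Store → Prop)
    {Q : Store → Prop} (b c : ℕ) (h₀ : I (σ.nreg i) σ) (hb : σ.nreg i ≤ b)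
    (hB : ∀ j σ', Fr (P ;; .nset i (.add (.reg i) (.lit 1))) σ σ' → I j σ' → B.eval σ' = b)
    (hs : ∀ j σ', Fr (P ;; .nset i (.add (.reg i) (.lit 1))) σ σ' → I j σ' → σ'.nreg i = j →
      j < b → WP P σ' fun τ σ'' => τ ≤ c ∧ σ''.nreg i = j ∧
        I (j + 1) { σ'' with nreg := Function.update σ''.nreg i (j + 1) })
    (he : ∀ σ', Fr (P ;; .nset i (.add (.reg i) (.lit 1))) σ σ' → I b σ' → σ'.nreg i = b → Q σ') :
    WP (.loop (.nlt (.reg i) B) (P ;; .nset i (.add (.reg i) (.lit 1)))) σ fun τ σ' =>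
      τ ≤ (b - σ.nreg i) * (c + B.cost + 7) + B.cost + 3 ∧ Q σ' := by
  refine wp_loop (fun p σ' => I (σ'.nreg i) σ' ∧ σ'.nreg i ≤ b ∧
    p = (b - σ'.nreg i) * (c + B.cost + 7) + B.cost + 3) _ ⟨h₀, hb, rfl⟩ ?_ ?_
  · rintro p σ' hF ⟨hI, hle, rfl⟩ hlt
    simp only [Test.Holds, NExpr.eval, hB _ σ' hF hI] at hlt
    apply wp_seq
    refine (hs _ σ' hF hI rfl hlt).mono fun τ σ'' _ ⟨hτ, hi, hI'⟩ => wp_nset ?_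
    simp only [NExpr.eval, NExpr.cost, Test.cost, hi, Function.update_self]
    refine ⟨_, ?_, hI', hlt, rfl⟩
    obtain ⟨d, hd⟩ : ∃ d, b - σ'.nreg i = d + 1 := ⟨b - σ'.nreg i - 1, by omega⟩
    rw [show b - (σ'.nreg i + 1) = d by omega, hd, Nat.succ_mul]
    omega
  · rintro p σ' hF ⟨hI, hle, rfl⟩ hlt
    simp only [Test.Holds, NExpr.eval, hB _ σ' hF hI] at hlt
    have : σ'.nreg i = b := by omega
    simp only [Test.cost, NExpr.cost]
    exact ⟨by omega, he σ' hF (this ▸ hI) this⟩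

end KSSP

namespace KSSP

/-! ### Tournament trees -/

/-- A tournament tree. The nodes are numbers `1, …, n`, the root is `1`, and `0` stands for a
missing node. Each node `x` has a parent, two children, and, if `act x ≠ 0`, an entry with
the key `key x`; `best x` is meant to be the node with the least key in the subtree of `x`. -/
structure Tour where
  par : ℕ → ℕ
  l : ℕ → ℕ
  r : ℕ → ℕ
  act : ℕ → ℕ
  best : ℕ → ℕ
  key : ℕ → ℝ

/-- The tournament tree in the number arrays `b, …, b + 4` and the real array `κ`. -/
def Store.tour (σ : Store) (b κ : ℕ) : Tour :=
  ⟨σ.narr b, σ.narr (b + 1), σ.narr (b + 2), σ.narr (b + 3), σ.narr (b + 4), σ.rarr κ⟩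

namespace Tour

/-- The pointers form a tree with root `1` on the nodes `1, …, n`. -/
structure Forest (T : Tour) (n : ℕ) : Prop where
  par0 : T.par 0 = 0
  par1 : T.par 1 = 0
  par_lt : ∀ y, 2 ≤ y → y ≤ n →
    1 ≤ T.par y ∧ T.par y < y ∧ (T.l (T.par y) = y ∨ T.r (T.par y) = y)
  l_ok : ∀ x, 1 ≤ x → x ≤ n → T.l x = 0 ∨ (T.l x ≤ n ∧ T.par (T.l x) = x)
  r_ok : ∀ x, 1 ≤ x → x ≤ n → T.r x = 0 ∨ (T.r x ≤ n ∧ T.par (T.r x) = x)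
  best0 : T.best 0 = 0

/-- `x` is `y` or an ancestor of `y`. -/
def Anc (T : Tour) (x y : ℕ) : Prop := ∃ i, T.par^[i] y = x

/-- The entry `best x` is correct, relative to the entries of the children of `x`. -/
structure NodeOK (T : Tour) (n x : ℕ) : Prop where
  mem : T.best x ≠ 0 → T.act (T.best x) ≠ 0 ∧ T.best x ≤ n ∧ T.Anc x (T.best x)
  own : T.act x ≠ 0 → T.best x ≠ 0 ∧ T.key (T.best x) ≤ T.key x
  left : T.best (T.l x) ≠ 0 → T.best x ≠ 0 ∧ T.key (T.best x) ≤ T.key (T.best (T.l x))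
  right : T.best (T.r x) ≠ 0 → T.best x ≠ 0 ∧ T.key (T.best x) ≤ T.key (T.best (T.r x))

/-- All entries `best x` are correct. -/
def AllOK (T : Tour) (n : ℕ) : Prop := ∀ x, 1 ≤ x → x ≤ n → T.NodeOK n x

/-- All entries `best x` are correct, except perhaps at `c` and its ancestors. -/
def OKOff (T : Tour) (n c : ℕ) : Prop := ∀ x, 1 ≤ x → x ≤ n → ¬ T.Anc x c → T.NodeOK n x

theorem Anc.refl (T : Tour) (x : ℕ) : T.Anc x x := ⟨0, rfl⟩

theorem Anc.of_par {T : Tour} {x y : ℕ} (h : T.Anc x (T.par y)) : T.Anc x y := by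
  obtain ⟨i, hi⟩ := h
  exact ⟨i + 1, by rwa [Function.iterate_succ_apply]⟩

theorem Anc.eq_or {T : Tour} {x y : ℕ} (h : T.Anc x y) : x = y ∨ T.Anc x (T.par y) := by
  obtain ⟨i, hi⟩ := h
  cases i with
  | zero => exact Or.inl hi.symm
  | succ i => exact Or.inr ⟨i, by rwa [Function.iterate_succ_apply] at hi⟩

theorem Anc.par_left {T : Tour} {x y : ℕ} (h : T.Anc x y) : T.Anc (T.par x) y := by
  obtain ⟨i, hi⟩ := h
  exact ⟨i + 1, by rw [Function.iterate_succ_apply', hi]⟩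

theorem Forest.par_le {T : Tour} {n : ℕ} (h : T.Forest n) {y : ℕ} (hy : y ≤ n) :
    T.par y ≤ y := by
  rcases Nat.lt_or_ge y 2 with h2 | h2
  · interval_cases y <;> simp [h.par0, h.par1]
  · exact (h.par_lt y h2 hy).2.1.le

theorem Forest.anc_le {T : Tour} {n : ℕ} (h : T.Forest n) {x y : ℕ} (hy : y ≤ n)
    (ha : T.Anc x y) : x ≤ y := by
  obtain ⟨i, hi⟩ := ha
  induction i generalizing y with
  | zero => exact hi.ge
  | succ i ih =>
    rw [Function.iterate_succ_apply] at hi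
    have := h.par_le hy
    exact (ih (by omega) hi).trans this

theorem Forest.not_anc_zero {T : Tour} {n : ℕ} (h : T.Forest n) {x : ℕ} (hx : 1 ≤ x) :
    ¬ T.Anc x 0 := by
  intro ha
  have := h.anc_le (Nat.zero_le n) ha
  omega

theorem Forest.lt_of_par {T : Tour} {n : ℕ} (h : T.Forest n) {c x : ℕ} (hx : 1 ≤ x) (hc : c ≤ n)
    (hp : T.par c = x) : x < c := by
  rcases Nat.lt_or_ge c 2 with h2 | h2
  · interval_cases c
    · have := h.par0; omega
    · have := h.par1; omega
  · have := h.par_lt c h2 hc; omega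

/-- The least entry of a correct tournament tree is at the root. -/
theorem AllOK.root {T : Tour} {n : ℕ} (hF : T.Forest n) (h : T.AllOK n) {x : ℕ} (hx : 1 ≤ x)
    (hn : x ≤ n) (ha : T.act x ≠ 0) : T.best 1 ≠ 0 ∧ T.key (T.best 1) ≤ T.key x := by
  have key : ∀ x, 1 ≤ x → x ≤ n → T.best x ≠ 0 →
      T.best 1 ≠ 0 ∧ T.key (T.best 1) ≤ T.key (T.best x) := by
    intro x
    induction x using Nat.strong_induction_on with
    | _ x ih =>
      intro hx hn hb
      rcases Nat.lt_or_ge x 2 with h2 | h2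
      · obtain rfl : x = 1 := by omega
        exact ⟨hb, le_rfl⟩
      · obtain ⟨h₁, h₂, h₃⟩ := hF.par_lt x h2 hn
        have hp := h (T.par x) h₁ (by omega)
        have : T.best (T.par x) ≠ 0 ∧ T.key (T.best (T.par x)) ≤ T.key (T.best x) := by
          rcases h₃ with h₃ | h₃
          · have := hp.left; rw [h₃] at this; exact this hb
          · have := hp.right; rw [h₃] at this; exact this hb
        obtain ⟨h₄, h₅⟩ := ih _ h₂ h₁ (by omega) this.1
        exact ⟨h₄, h₅.trans this.2⟩
  obtain ⟨h₁, h₂⟩ := (h x hx hn).own ha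
  obtain ⟨h₃, h₄⟩ := key x hx hn h₁
  exact ⟨h₃, h₄.trans h₂⟩

/-- If the entry of a single node `y` changes, then only the ancestors of `y` are affected. -/
theorem AllOK.change {T T' : Tour} {n y : ℕ} (hF : T.Forest n) (h : T.AllOK n)
    (hp : T'.par = T.par) (hl : T'.l = T.l) (hr : T'.r = T.r) (hb : T'.best = T.best)
    (ha : ∀ x, x ≠ y → T'.act x = T.act x) (hk : ∀ x, x ≠ y → T'.key x = T.key x) :
    T'.Forest n ∧ T'.OKOff n y := by
  refine ⟨⟨?_, ?_, ?_, ?_, ?_, ?_⟩, ?_⟩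
  · rw [hp]; exact hF.par0
  · rw [hp]; exact hF.par1
  · rw [hp, hl, hr]; exact hF.par_lt
  · rw [hp, hl]; exact hF.l_ok
  · rw [hp, hr]; exact hF.r_ok
  · rw [hb]; exact hF.best0
  · intro x hx hn hxy
    have hxy' : ¬ T.Anc x y := by simpa only [Anc, hp] using hxy
    have hne : ∀ z, T.Anc x z → z ≠ y := fun z hz hzy => hxy' (hzy ▸ hz)
    have hox := h x hx hn
    have hbx : T.best x ≠ 0 → T'.key (T.best x) = T.key (T.best x) := fun hb0 =>
      hk _ (hne _ (hox.mem hb0).2.2)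
    have child : ∀ c, (c = 0 ∨ (c ≤ n ∧ T.par c = x)) → T.best c ≠ 0 →
        T'.key (T.best c) = T.key (T.best c) := by
      rintro c (rfl | ⟨hc, hcx⟩) hb0
      · exact absurd hF.best0 hb0
      · refine hk _ (hne _ ?_)
        have := hF.lt_of_par hx hc hcx
        have := ((h c (by omega) hc).mem hb0).2.2.par_left
        rwa [hcx] at this
    refine ⟨?_, ?_, ?_, ?_⟩
    · rw [hb]
      intro hb0
      obtain ⟨h₁, h₂, h₃⟩ := hox.mem hb0
      rw [ha _ (hne _ h₃), Anc, hp]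
      exact ⟨h₁, h₂, h₃⟩
    · have hxy'' : x ≠ y := hne x (Anc.refl _ _)
      rw [hb, ha x hxy'', hk x hxy'']
      intro h₀
      have := hox.own h₀
      rw [hbx this.1]; exact this
    · rw [hb, hl]
      intro h₀
      have := hox.left h₀
      rw [hbx this.1, child _ (hF.l_ok x hx hn) h₀]; exact this
    · rw [hb, hr]
      intro h₀
      have := hox.right h₀
      rw [hbx this.1, child _ (hF.r_ok x hx hn) h₀]; exact this

open Classical in
/-- The node with the smaller key; `0` is ignored. -/
noncomputable def pick (key : ℕ → ℝ) (x y : ℕ) : ℕ :=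
  if y = 0 then x else if x ≠ 0 ∧ ¬ key y < key x then x else y

theorem pick_eq (key : ℕ → ℝ) (x y : ℕ) : pick key x y = x ∨ pick key x y = y := by
  unfold pick; split_ifs <;> simp

theorem pick_left (key : ℕ → ℝ) {x : ℕ} (y : ℕ) (hx : x ≠ 0) :
    pick key x y ≠ 0 ∧ key (pick key x y) ≤ key x := by
  unfold pick; split_ifs with h₁ h₂
  · exact ⟨hx, le_rfl⟩
  · exact ⟨hx, le_rfl⟩
  · simp only [hx, ne_eq, not_false_eq_true, true_and, not_not] at h₂
    exact ⟨h₁, h₂.le⟩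

theorem pick_right (key : ℕ → ℝ) (x : ℕ) {y : ℕ} (hy : y ≠ 0) :
    pick key x y ≠ 0 ∧ key (pick key x y) ≤ key y := by
  unfold pick
  rw [if_neg hy]
  split_ifs with h₂
  · exact ⟨h₂.1, not_lt.1 h₂.2⟩
  · exact ⟨hy, le_rfl⟩

/-- The recomputed value of `best x`. -/
noncomputable def newBest (T : Tour) (x : ℕ) : ℕ :=
  pick T.key (pick T.key (if T.act x = 0 then 0 else x) (T.best (T.l x))) (T.best (T.r x))

/-- If `best c` is recomputed, then only the proper ancestors of `c` remain to be treated. -/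
theorem OKOff.up {T T' : Tour} {n c : ℕ} (hF : T.Forest n) (hc : 1 ≤ c) (hcn : c ≤ n)
    (h : T.OKOff n c) (hT' : T' = { T with best := Function.update T.best c (T.newBest c) }) :
    T'.Forest n ∧ T'.OKOff n (T'.par c) := by
  subst hT'
  refine ⟨⟨hF.par0, hF.par1, hF.par_lt, hF.l_ok, hF.r_ok, ?_⟩, ?_⟩
  · simp only
    rw [Function.update_of_ne (by omega), hF.best0]
  · intro x hx hn hxc
    have hxc' : ¬ T.Anc x (T.par c) := hxc
    have hchild : ∀ d, (d = 0 ∨ (d ≤ n ∧ T.par d = x)) →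
        Function.update T.best c (T.newBest c) d = T.best d := by
      rintro d (rfl | ⟨hd, hdx⟩)
      · rw [Function.update_of_ne (by omega)]
      · rw [Function.update_of_ne]
        rintro rfl
        exact hxc' (hdx ▸ Anc.refl _ _)
    by_cases hxc₂ : x = c
    · subst hxc₂
      have hdok : ∀ d, (d = 0 ∨ (d ≤ n ∧ T.par d = x)) → T.best d ≠ 0 →
          T.act (T.best d) ≠ 0 ∧ T.best d ≤ n ∧ T.Anc x (T.best d) := by
        rintro d (rfl | ⟨hd, hdx⟩) hb0
        · exact absurd hF.best0 hb0
        · have h₁ := hF.lt_of_par hx hd hdx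
          have h₂ := (h d (by omega) hd fun hh => by
            have := hF.anc_le hn hh; omega).mem hb0
          have h₃ := h₂.2.2.par_left
          rw [hdx] at h₃
          exact ⟨h₂.1, h₂.2.1, h₃⟩
      have hl := hF.l_ok x hx hn
      have hr := hF.r_ok x hx hn
      refine ⟨?_, ?_, ?_, ?_⟩
      · simp only [Function.update_self]
        intro h₀
        change T.act (T.newBest x) ≠ 0 ∧ T.newBest x ≤ n ∧ T.Anc x (T.newBest x)
        rcases pick_eq T.key (pick T.key (if T.act x = 0 then 0 else x) (T.best (T.l x)))
          (T.best (T.r x)) with h₁ | h₁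
        · rcases pick_eq T.key (if T.act x = 0 then 0 else x) (T.best (T.l x)) with h₂ | h₂
          · have h₃ := h₁.trans h₂
            change T.newBest x = _ at h₃
            split_ifs at h₃ with h₄
            · exact absurd h₃ h₀
            · rw [h₃]; exact ⟨h₄, hn, Anc.refl _ _⟩
          · have h₃ : T.newBest x = _ := h₁.trans h₂
            rw [h₃] at h₀ ⊢
            exact hdok _ hl h₀
        · change T.newBest x = _ at h₁
          rw [h₁] at h₀ ⊢
          exact hdok _ hr h₀
      · simp only [Function.update_self]
        intro h₀
        have h₁ : (if T.act x = 0 then 0 else x) = x := if_neg h₀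
        unfold newBest
        rw [h₁]
        have h₂ := pick_left T.key (T.best (T.l x)) (x := x) (by omega)
        have h₃ := pick_left T.key (T.best (T.r x)) h₂.1
        exact ⟨h₃.1, h₃.2.trans h₂.2⟩
      · simp only [Function.update_self, hchild _ hl]
        intro h₀
        have h₂ := pick_right T.key (if T.act x = 0 then 0 else x) h₀
        have h₃ := pick_left T.key (T.best (T.r x)) h₂.1
        exact ⟨h₃.1, h₃.2.trans h₂.2⟩
      · simp only [Function.update_self, hchild _ hr]
        intro h₀
        exact pick_right T.key _ h₀
    · have hox := h x hx hn fun hh => by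
        rcases hh.eq_or with h₁ | h₁
        · exact hxc₂ h₁
        · exact hxc' h₁
      refine ⟨?_, ?_, ?_, ?_⟩
      · simp only [Function.update_of_ne hxc₂]; exact hox.mem
      · simpa only [Function.update_of_ne hxc₂] using hox.own
      · simpa only [Function.update_of_ne hxc₂, hchild _ (hF.l_ok x hx hn)] using hox.left
      · simpa only [Function.update_of_ne hxc₂, hchild _ (hF.r_ok x hx hn)] using hox.right

theorem Forest.iterate_congr {T T' : Tour} {n : ℕ} (hF : T.Forest n)
    (hp : ∀ y ≤ n, T'.par y = T.par y) (i : ℕ) {y : ℕ} (hy : y ≤ n) :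
    T'.par^[i] y = T.par^[i] y ∧ T.par^[i] y ≤ n := by
  induction i with
  | zero => exact ⟨rfl, hy⟩
  | succ i ih =>
    rw [Function.iterate_succ_apply', Function.iterate_succ_apply', ih.1, hp _ ih.2]
    exact ⟨rfl, (hF.par_le ih.2).trans ih.2⟩

/-- A new leaf `n + 1` is attached to the node `z`. -/
theorem AllOK.insert {T T' : Tour} {n z : ℕ} (hF : T.Forest n) (h : T.AllOK n) (hz : 1 ≤ z)
    (hzn : z ≤ n) (hp : ∀ y ≤ n, T'.par y = T.par y) (hpz : T'.par (n + 1) = z)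
    (ha : ∀ y ≤ n, T'.act y = T.act y) (hb : ∀ y ≤ n, T'.best y = T.best y)
    (hk : ∀ y ≤ n, T'.key y = T.key y) (hl : T'.l (n + 1) = 0) (hr : T'.r (n + 1) = 0)
    (hlr : ∀ y ≤ n, y ≠ z → T'.l y = T.l y ∧ T'.r y = T.r y)
    (hlrz : (T.l z = 0 ∧ T'.l z = n + 1 ∧ T'.r z = T.r z) ∨
      (T.r z = 0 ∧ T'.l z = T.l z ∧ T'.r z = n + 1)) :
    T'.Forest (n + 1) ∧ T'.OKOff (n + 1) (n + 1) := by
  refine ⟨⟨?_, ?_, ?_, ?_, ?_, ?_⟩, ?_⟩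
  · rw [hp 0 (by omega), hF.par0]
  · rw [hp 1 (by omega), hF.par1]
  · intro y hy hyn
    rcases Nat.lt_or_ge n y with h₁ | h₁
    · obtain rfl : y = n + 1 := by omega
      rw [hpz]
      refine ⟨hz, by omega, ?_⟩
      rcases hlrz with h₂ | h₂
      · exact Or.inl h₂.2.1
      · exact Or.inr h₂.2.2
    · rw [hp y h₁]
      obtain ⟨h₂, h₃, h₄⟩ := hF.par_lt y hy h₁
      refine ⟨h₂, h₃, ?_⟩
      by_cases hpz' : T.par y = z
      · rw [hpz'] at h₄ ⊢
        rcases hlrz with h₅ | h₅ <;> rcases h₄ with h₆ | h₆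
        · omega
        · right; omega
        · left; omega
        · omega
      · rw [(hlr _ (by omega) hpz').1, (hlr _ (by omega) hpz').2]
        exact h₄
  · intro x hx hxn
    rcases Nat.lt_or_ge n x with h₁ | h₁
    · obtain rfl : x = n + 1 := by omega
      exact Or.inl hl
    · by_cases hxz : x = z
      · subst hxz
        rcases hlrz with h₅ | h₅
        · right; rw [h₅.2.1]; exact ⟨le_rfl, hpz⟩
        · rw [h₅.2.1]
          rcases hF.l_ok x hx h₁ with h₆ | h₆
          · exact Or.inl h₆
          · right; rw [hp _ h₆.1]; exact ⟨by omega, h₆.2⟩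
      · rw [(hlr x h₁ hxz).1]
        rcases hF.l_ok x hx h₁ with h₆ | h₆
        · exact Or.inl h₆
        · right; rw [hp _ h₆.1]; exact ⟨by omega, h₆.2⟩
  · intro x hx hxn
    rcases Nat.lt_or_ge n x with h₁ | h₁
    · obtain rfl : x = n + 1 := by omega
      exact Or.inl hr
    · by_cases hxz : x = z
      · subst hxz
        rcases hlrz with h₅ | h₅
        · rw [h₅.2.2]
          rcases hF.r_ok x hx h₁ with h₆ | h₆
          · exact Or.inl h₆
          · right; rw [hp _ h₆.1]; exact ⟨by omega, h₆.2⟩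
        · right; rw [h₅.2.2]; exact ⟨le_rfl, hpz⟩
      · rw [(hlr x h₁ hxz).2]
        rcases hF.r_ok x hx h₁ with h₆ | h₆
        · exact Or.inl h₆
        · right; rw [hp _ h₆.1]; exact ⟨by omega, h₆.2⟩
  · rw [hb 0 (by omega), hF.best0]
  · intro x hx hxn hxc
    have hxn' : x ≤ n := by
      by_contra h₁
      obtain rfl : x = n + 1 := by omega
      exact hxc (Anc.refl _ _)
    have hxz : x ≠ z := by
      rintro rfl
      exact hxc (Anc.of_par (hpz.symm ▸ Anc.refl _ _))
    have hox := h x hx hxn'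
    have hbn : T.best x ≤ n := by
      by_cases hb0 : T.best x = 0
      · omega
      · exact (hox.mem hb0).2.1
    have hcn : ∀ d, (d = 0 ∨ (d ≤ n ∧ T.par d = x)) → d ≤ n ∧ T.best d ≤ n := by
      rintro d (rfl | ⟨hd, hdx⟩)
      · rw [hF.best0]; omega
      · refine ⟨hd, ?_⟩
        by_cases hb0 : T.best d = 0
        · omega
        · have := hF.lt_of_par hx hd hdx
          exact ((h d (by omega) hd).mem hb0).2.1
    obtain ⟨hl₁, hl₂⟩ := hcn _ (hF.l_ok x hx hxn')
    obtain ⟨hr₁, hr₂⟩ := hcn _ (hF.r_ok x hx hxn')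
    refine ⟨?_, ?_, ?_, ?_⟩
    · rw [hb x hxn', ha _ hbn]
      intro h₀
      obtain ⟨h₁, h₂, i, hi⟩ := hox.mem h₀
      exact ⟨h₁, by omega, i, by rw [(hF.iterate_congr hp i hbn).1, hi]⟩
    · rw [hb x hxn', ha x hxn', hk x hxn', hk _ hbn]
      exact hox.own
    · rw [(hlr x hxn' hxz).1, hb x hxn', hb _ hl₁, hk _ hbn, hk _ hl₂]
      exact hox.left
    · rw [(hlr x hxn' hxz).2, hb x hxn', hb _ hr₁, hk _ hbn, hk _ hr₂]
      exact hox.right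

end Tour

/-- Replace the number register `6` by `best c` if this is better, where `c` is the child of the
node in the number register `5` according to the number array `a`. -/
def pickChild (b κ a : ℕ) : Prog :=
  .nset 7 (.get (b + 4) (.get a (.reg 5))) ;;
  .ite (.neq (.reg 7) (.lit 0)) .skip
    (.ite (.and (.not (.neq (.reg 6) (.lit 0)))
      (.not (.rlt (.get κ (.reg 7)) (.get κ (.reg 6))))) .skip (.nset 6 (.reg 7)))

/-- Recompute the entries `best x` of the node in the number register `5` and of its ancestors. -/
def sift (b κ : ℕ) : Prog :=
  .loop (.not (.neq (.reg 5) (.lit 0)))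
    (.ite (.neq (.get (b + 3) (.reg 5)) (.lit 0)) (.nset 6 (.lit 0)) (.nset 6 (.reg 5)) ;;
     pickChild b κ (b + 1) ;; pickChild b κ (b + 2) ;;
     .nput (b + 4) (.reg 5) (.reg 6) ;; .nset 5 (.get b (.reg 5)))

theorem wp_pickChild (b κ a : ℕ) (σ : Store) :
    WP (pickChild b κ a) σ fun τ σ' => τ ≤ 22 ∧ ∃ z, σ' = { σ with
      nreg :=
        Function.update (Function.update σ.nreg 7 z) 6 (Tour.pick (σ.rarr κ) (σ.nreg 6)
          (σ.narr (b + 4) (σ.narr a (σ.nreg 5)))) } := by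
  apply wp_seq; apply wp_nset; apply wp_ite
  · intro h
    simp only [Test.Holds, NExpr.eval, Function.update_self] at h
    apply wp_skip
    refine ⟨by simp [NExpr.cost, Test.cost], σ.narr (b + 4) (σ.narr a (σ.nreg 5)), ?_⟩
    simp only [NExpr.eval, h, Tour.pick]
    congr 1
    ext x
    simp [Function.update_apply]
    intro h6; subst h6; simp
  · intro h
    simp only [Test.Holds, NExpr.eval, Function.update_self] at h
    apply wp_ite
    · intro h'
      simp only [Test.Holds, NExpr.eval, RExpr.eval, Function.update_self, Function.update_apply]
        at h'
      apply wp_skip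
      refine ⟨by simp [NExpr.cost, Test.cost, RExpr.cost],
        σ.narr (b + 4) (σ.narr a (σ.nreg 5)), ?_⟩
      simp only [NExpr.eval, Tour.pick, h, if_false]
      rw [if_pos (by simpa using h')]
      congr 1
      ext x
      simp [Function.update_apply]
      intro h6; subst h6; simp
    · intro h'
      simp only [Test.Holds, NExpr.eval, RExpr.eval, Function.update_self, Function.update_apply]
        at h'
      apply wp_nset
      refine ⟨by simp [NExpr.cost, Test.cost, RExpr.cost],
        σ.narr (b + 4) (σ.narr a (σ.nreg 5)), ?_⟩
      simp only [NExpr.eval, Tour.pick, h, if_false]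
      rw [if_neg (by simpa using h')]
      simp

/-- `sift` repairs a tournament tree in time proportional to the depth `d` of the node. -/
theorem wp_sift (b κ : ℕ) (σ : Store) (n d : ℕ) (hF : (σ.tour b κ).Forest n)
    (hO : (σ.tour b κ).OKOff n (σ.nreg 5)) (hn : σ.nreg 5 ≤ n)
    (hd : (σ.tour b κ).par^[d] (σ.nreg 5) = 0) :
    WP (sift b κ) σ fun τ σ' => τ ≤ d * 100 + 5 ∧ (σ'.tour b κ).Forest n ∧
      (σ'.tour b κ).AllOK n ∧
      σ'.tour b κ = { σ.tour b κ with best := (σ'.tour b κ).best } := by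
  refine wp_loop (fun p σ' => (σ'.tour b κ).Forest n ∧ (σ'.tour b κ).OKOff n (σ'.nreg 5) ∧
    σ'.nreg 5 ≤ n ∧ (∃ d, (σ'.tour b κ).par^[d] (σ'.nreg 5) = 0 ∧ p = d * 100 + 5) ∧
    σ'.tour b κ = { σ.tour b κ with best := (σ'.tour b κ).best }) _
    ⟨hF, hO, hn, ⟨d, hd, rfl⟩, rfl⟩ ?_ ?_
  · rintro p σ' - ⟨hF, hO, hn, ⟨d, hd, rfl⟩, he⟩ hb
    simp only [Test.Holds, NExpr.eval] at hb
    have key : ∀ σ'' : Store, ∀ T, σ''.tour b κ = T → ∀ c, σ'.nreg 5 = c →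
        T = { σ'.tour b κ with
          best := Function.update (σ'.tour b κ).best c ((σ'.tour b κ).newBest c) } →
        σ''.nreg 5 = (σ'.tour b κ).par c → ∀ τ, τ ≤ 90 → ∃ p', τ + p' ≤ d * 100 + 5 ∧
        (σ''.tour b κ).Forest n ∧ (σ''.tour b κ).OKOff n (σ''.nreg 5) ∧
        σ''.nreg 5 ≤ n ∧ (∃ d, (σ''.tour b κ).par^[d] (σ''.nreg 5) = 0 ∧ p' = d * 100 + 5) ∧
        σ''.tour b κ = { σ.tour b κ with best := (σ''.tour b κ).best } := by
      rintro σ'' T hT c rfl hT' h5 τ hτ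
      obtain ⟨h₁, h₂⟩ := Tour.OKOff.up hF (by omega) hn hO hT'
      obtain ⟨d, rfl⟩ : ∃ d', d = d' + 1 := by
        cases d with
        | zero => exact absurd hd hb
        | succ d => exact ⟨d, rfl⟩
      rw [Function.iterate_succ_apply] at hd
      rw [hT, h5]
      refine ⟨d * 100 + 5, by omega, h₁, ?_, (hF.par_le hn).trans hn, ⟨d, ?_, rfl⟩, ?_⟩
      · rw [hT'] at h₂ ⊢; exact h₂
      · rw [hT']; exact hd
      · rw [hT', he]
    apply wp_seq
    have h1 : WP (.ite (.neq (.get (b + 3) (.reg 5)) (.lit 0)) (.nset 6 (.lit 0))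
        (.nset 6 (.reg 5))) σ' fun τ σ'' => τ ≤ 10 ∧ σ'' = { σ' with
          nreg := Function.update σ'.nreg 6
            (if σ'.narr (b + 3) (σ'.nreg 5) = 0 then 0 else σ'.nreg 5) } := by
      apply wp_ite <;> intro h <;> apply wp_nset <;> simp only [Test.Holds, NExpr.eval] at h <;>
        simp [h, NExpr.eval, Test.cost, NExpr.cost]
    refine h1.mono ?_
    rintro τ₁ _ - ⟨hτ₁, rfl⟩
    apply wp_seq
    refine (wp_pickChild _ _ _ _).mono ?_
    rintro τ₂ _ - ⟨hτ₂, z₂, rfl⟩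
    apply wp_seq
    refine (wp_pickChild _ _ _ _).mono ?_
    rintro τ₃ _ - ⟨hτ₃, z₃, rfl⟩
    apply wp_seq; apply wp_nput; apply wp_nset
    refine key _ _ rfl _ rfl ?_ ?_ _ ?_
    · simp [Store.tour, NExpr.eval, Tour.newBest]
      rfl
    · simp [Store.tour, NExpr.eval]
    · simp only [Test.cost, NExpr.cost]; omega
  · rintro p σ' - ⟨hF, hO, hn, ⟨d, hd, rfl⟩, he⟩ hb
    simp only [Test.Holds, NExpr.eval, not_not] at hb
    refine ⟨by simp only [Test.cost, NExpr.cost]; omega, hF, fun x hx hxn => ?_, he⟩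
    exact hO x hx hxn (hb ▸ hF.not_anc_zero hx)

end KSSP

namespace KSSP
namespace Network

/-! ### Paths and trees -/

section Paths

variable {N : Network}

theorem isPath_append {v w : Fin N.n} {p q : List (Fin N.m)} :
    N.IsPath v w (p ++ q) ↔ ∃ u, N.IsPath v u p ∧ N.IsPath u w q := by
  induction p generalizing v with
  | nil => simp [IsPath]
  | cons e p ih => simp [IsPath, ih, and_assoc]

theorem nodes_cons (v : Fin N.n) (e : Fin N.m) (p : List (Fin N.m)) :
    N.nodes v (e :: p) = v :: N.nodes (N.head e) p := rfl

theorem length_cons (e : Fin N.m) (p : List (Fin N.m)) :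
    N.length (e :: p) = N.weight e + N.length p := by simp [length]

theorem length_append (p q : List (Fin N.m)) :
    N.length (p ++ q) = N.length p + N.length q := by simp [length]

theorem target_mem_nodes {v w : Fin N.n} {p : List (Fin N.m)} (h : N.IsPath v w p) :
    w ∈ N.nodes v p := by
  induction p generalizing v with
  | nil => cases h; simp [nodes]
  | cons e p ih => exact List.mem_cons_of_mem _ (ih h.2)

theorem nodes_append {v w : Fin N.n} {p q : List (Fin N.m)} (h : N.IsPath v w p) :
    N.nodes v (p ++ q) = p.map N.tail ++ N.nodes w q := by
  induction p generalizing v with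
  | nil => cases h; rfl
  | cons e p ih =>
    rw [List.cons_append, nodes_cons, ih h.2, ← h.1]; rfl

theorem nodes_eq {v w : Fin N.n} {p : List (Fin N.m)} (h : N.IsPath v w p) :
    N.nodes v p = p.map N.tail ++ [w] := by
  have := nodes_append (q := []) h
  rwa [List.append_nil] at this

theorem isPathAvoiding_cons {X : Set (Fin N.n)} {v : Fin N.n} {e : Fin N.m}
    {p : List (Fin N.m)} : N.IsPathAvoiding X v (e :: p) ↔
      N.tail e = v ∧ v ∉ X ∧ N.IsPathAvoiding X (N.head e) p := by
  simp only [IsPathAvoiding, IsPath, nodes_cons, List.mem_cons, forall_eq_or_imp]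
  tauto

theorem isTreePath_cons {T : N.Tree} {v : Fin N.n} {e : Fin N.m} {p : List (Fin N.m)} :
    IsTreePath T v (e :: p) ↔ N.tail e = v ∧ T v = some e ∧ IsTreePath T (N.head e) p := by
  simp only [IsTreePath, IsPath, List.mem_cons, forall_eq_or_imp]
  constructor
  · rintro ⟨⟨rfl, h₁⟩, h₂, h₃⟩; exact ⟨rfl, h₂, h₁, h₃⟩
  · rintro ⟨rfl, h₂, h₁, h₃⟩; exact ⟨⟨rfl, h₁⟩, h₂, h₃⟩

theorem isTreePath_nil {T : N.Tree} {v : Fin N.n} : IsTreePath T v [] ↔ v = N.t := by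
  simp [IsTreePath, IsPath]

theorem IsTreePath.unique {T : N.Tree} (ht : T N.t = none) {v : Fin N.n} {p q : List (Fin N.m)}
    (hp : IsTreePath T v p) (hq : IsTreePath T v q) : p = q := by
  induction p generalizing v q with
  | nil =>
    rw [isTreePath_nil] at hp
    subst hp
    cases q with
    | nil => rfl
    | cons f q => rw [isTreePath_cons] at hq; simp [ht] at hq
  | cons e p ih =>
    rw [isTreePath_cons] at hp
    cases q with
    | nil => rw [isTreePath_nil] at hq; subst hq; simp [ht] at hp
    | cons f q =>
      rw [isTreePath_cons] at hq
      obtain rfl : e = f := by simpa [hp.2.1] using hq.2.1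
      rw [ih hp.2.2 hq.2.2]

theorem IsTreePath.exists_of_mem {T : N.Tree} {v u : Fin N.n} {p : List (Fin N.m)}
    (hp : IsTreePath T v p) (hu : u ∈ N.nodes v p) :
    ∃ q, IsTreePath T u q ∧ q.length ≤ p.length := by
  induction p generalizing v with
  | nil =>
    simp only [nodes, List.map_nil, List.mem_singleton] at hu
    subst hu
    exact ⟨_, hp, le_rfl⟩
  | cons e p ih =>
    rw [nodes_cons, List.mem_cons] at hu
    rcases hu with rfl | hu
    · exact ⟨_, hp, le_rfl⟩
    · obtain ⟨q, h₁, h₂⟩ := ih (isTreePath_cons.1 hp).2.2 hu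
      exact ⟨q, h₁, by simp; omega⟩

theorem IsTreePath.nodup {T : N.Tree} (ht : T N.t = none) {v : Fin N.n} {p : List (Fin N.m)}
    (hp : IsTreePath T v p) : (N.nodes v p).Nodup := by
  induction p generalizing v with
  | nil => simp [nodes]
  | cons e p ih =>
    have hp' := (isTreePath_cons.1 hp).2.2
    rw [nodes_cons, List.nodup_cons]
    refine ⟨fun hv => ?_, ih hp'⟩
    obtain ⟨q, h₁, h₂⟩ := hp'.exists_of_mem hv
    rw [← hp.unique ht h₁] at h₂
    simp at h₂

theorem length_lt_of_nodup {v : Fin N.n} {p : List (Fin N.m)} (h : (N.nodes v p).Nodup) :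
    p.length < N.n := by
  have := h.length_le_card
  simp [nodes] at this
  omega

theorem IsTreePath.length_lt {T : N.Tree} (ht : T N.t = none) {v : Fin N.n} {p : List (Fin N.m)}
    (hp : IsTreePath T v p) : p.length < N.n := length_lt_of_nodup (hp.nodup ht)

/-- If `T` leads from `v` to `t` along `p ++ p'`, and `p` ends in `u`, then `follow` stops, on its
way from `v` to `u`, at the end of `p`. -/
theorem follow_eq {T : N.Tree} (ht : T N.t = none) {v u : Fin N.n} {p p' : List (Fin N.m)}
    (hp : IsTreePath T v (p ++ p')) (hu : N.IsPath v u p) (fuel : ℕ) (hf : p.length < fuel) :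
    follow T u fuel v = p := by
  induction p generalizing v fuel with
  | nil =>
    cases hu
    cases fuel with
    | zero => rfl
    | succ k => simp [follow]
  | cons e p ih =>
    have hd := hp.nodup ht
    have hp' := hp
    rw [List.cons_append, isTreePath_cons] at hp'
    cases fuel with
    | zero => simp at hf
    | succ k =>
      have hne : v ≠ u := by
        rintro rfl
        rw [List.cons_append, nodes_cons, List.nodup_cons] at hd
        apply hd.1
        have := target_mem_nodes hu.2
        simp only [nodes, List.mem_cons, List.map_append, List.mem_append] at this ⊢
        tauto
      rw [follow, if_neg hne, hp'.2.1]
      simp only [List.length_cons] at hf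
      simp only [ih hp'.2.2 hu.2 k (by omega)]

theorem IsTreePath.follow_eq {T : N.Tree} (ht : T N.t = none) {v : Fin N.n} {p : List (Fin N.m)}
    (hp : IsTreePath T v p) : follow T N.t N.n v = p :=
  Network.follow_eq ht (p' := []) (by simpa using hp) hp.1 _ (hp.length_lt ht)

theorem IsSPTree.inTree_iff {X : Set (Fin N.n)} {T : N.Tree} (h : IsSPTree X T) (hX : N.t ∉ X)
    (v : Fin N.n) : InTree T v ↔ v = N.t ∨ T v ≠ none := by
  constructor
  · rintro ⟨p, hp⟩
    cases p with
    | nil => exact Or.inl (isTreePath_nil.1 hp)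
    | cons e p => right; simp [(isTreePath_cons.1 hp).2.1]
  · intro hv
    have : ∃ p, N.IsPathAvoiding X v p := by
      by_contra hne
      rcases hv with rfl | hv
      · exact hne ⟨[], rfl, by simpa [nodes] using hX⟩
      · exact hv ((h.2 v).2 hne)
    obtain ⟨p, hp, -⟩ := (h.2 v).1 this
    exact ⟨p, hp⟩

theorem IsSPTree.avoiding {X : Set (Fin N.n)} {T : N.Tree} (h : IsSPTree X T) (hX : N.t ∉ X)
    {v : Fin N.n} {p : List (Fin N.m)} (hp : IsTreePath T v p) : N.IsPathAvoiding X v p := by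
  have : ∃ p, N.IsPathAvoiding X v p := by
    by_contra hne
    have h₁ := (h.2 v).2 hne
    rcases (h.inTree_iff hX v).1 ⟨p, hp⟩ with rfl | hv
    · exact hne ⟨[], rfl, by simpa [nodes] using hX⟩
    · exact hv h₁
  obtain ⟨p', h₁, h₂, -⟩ := (h.2 v).1 this
  rwa [hp.unique h.1 h₁]

end Paths

theorem IsConnected.n_le {N : Network} (h : N.IsConnected) : N.n ≤ N.m + 1 := by
  have hs : Function.Surjective (fun o : Option (Fin N.m) => o.elim N.s N.head) := by
    intro v
    obtain ⟨p, hp⟩ := (h v).1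
    rcases List.eq_nil_or_concat p with rfl | ⟨p, e, rfl⟩
    · cases hp; exact ⟨none, rfl⟩
    · rw [List.concat_eq_append, isPath_append] at hp
      obtain ⟨u, -, -, hp⟩ := hp
      exact ⟨some e, hp⟩
  simpa using Fintype.card_le_of_surjective _ hs

/-! ### Dijkstra's algorithm -/

/-- The invariant of Dijkstra's algorithm for the paths to `t` that avoid `X`. The nodes in `S`
are settled, those in `O` are open, `d` holds the tentative distances, and `R` contains the edges
into settled nodes that are still to be relaxed. -/
structure DInv (N : Network) (X S O : Set (Fin N.n)) (d : Fin N.n → ℝ) (T : N.Tree)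
    (R : Set (Fin N.m)) : Prop where
  disj : ∀ v ∈ O, v ∉ S
  settled_notMem : ∀ v ∈ S, v ∉ X
  open_notMem : ∀ v ∈ O, v ∉ X
  root : T N.t = none
  root_mem : N.t ∈ S ∨ (N.t ∈ O ∧ d N.t = 0)
  tree : ∀ v ∈ S, ∃ p, IsTreePath T v p ∧ (∀ u ∈ N.nodes v p, u ∈ S) ∧ (N.length p : ℝ) = d v
  opt : ∀ v ∈ S, ∀ p, N.IsPathAvoiding X v p → d v ≤ N.length p
  edge : ∀ v ∈ O, v ≠ N.t →
    ∃ e, T v = some e ∧ N.tail e = v ∧ N.head e ∈ S ∧ d v = N.weight e + d (N.head e)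
  none : ∀ v, v ∉ S → v ∉ O → T v = none
  relaxed : ∀ e, N.head e ∈ S → e ∉ R → N.tail e ∉ X →
    N.tail e ∈ S ∨ (N.tail e ∈ O ∧ d (N.tail e) ≤ N.weight e + d (N.head e))

namespace DInv

variable {N : Network} {X S O : Set (Fin N.n)} {d : Fin N.n → ℝ} {T : N.Tree}
  {R : Set (Fin N.m)}

theorem init (hX : N.t ∉ X) (hd : d N.t = 0) : DInv N X ∅ {N.t} d (fun _ => Option.none) ∅ := by
  refine ⟨?_, ?_, ?_, rfl, ?_, ?_, ?_, ?_, ?_, ?_⟩ <;> simp_all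

theorem nonneg (h : DInv N X S O d T R) {v : Fin N.n} (hv : v ∈ S) : 0 ≤ d v := by
  obtain ⟨p, -, -, hp⟩ := h.tree v hv
  rw [← hp]; positivity

/-- An open node with the least tentative distance can be settled. -/
theorem settle (h : DInv N X S O d T ∅) {u : Fin N.n} (hu : u ∈ O) (hmin : ∀ v ∈ O, d u ≤ d v) :
    DInv N X (insert u S) (O \ {u}) d T {e | N.head e = u} := by
  -- Any path from an unsettled node has to enter the settled region through an open node.
  have key : ∀ p v, v ∉ S → N.IsPathAvoiding X v p → d u ≤ N.length p := by
    intro p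
    induction p with
    | nil =>
      rintro v hv ⟨rfl, -⟩
      rcases h.root_mem with h₁ | ⟨h₁, h₂⟩
      · exact absurd h₁ hv
      · have := hmin _ h₁
        rw [h₂] at this
        simpa [length] using this
    | cons e p ih =>
      intro v hv hp
      rw [isPathAvoiding_cons] at hp
      obtain ⟨rfl, hX, hp⟩ := hp
      rw [length_cons, NNReal.coe_add]
      by_cases he : N.head e ∈ S
      · rcases h.relaxed e he (by simp) hX with h₁ | ⟨h₁, h₂⟩
        · exact absurd h₁ hv
        · have := hmin _ h₁
          have := h.opt _ he p hp
          linarith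
      · have := ih _ he hp
        have : (0 : ℝ) ≤ N.weight e := NNReal.coe_nonneg _
        linarith
  refine ⟨?_, ?_, ?_, h.root, ?_, ?_, ?_, ?_, ?_, ?_⟩
  · rintro v ⟨hv, hvu⟩ (h₁ | h₁)
    · exact hvu h₁
    · exact h.disj v hv h₁
  · rintro v (rfl | hv)
    · exact h.open_notMem _ hu
    · exact h.settled_notMem v hv
  · rintro v ⟨hv, -⟩
    exact h.open_notMem v hv
  · by_cases ht : N.t = u
    · exact Or.inl (Or.inl ht)
    · rcases h.root_mem with h₁ | h₁
      · exact Or.inl (Or.inr h₁)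
      · exact Or.inr ⟨⟨h₁.1, ht⟩, h₁.2⟩
  · rintro v (rfl | hv)
    · by_cases ht : v = N.t
      · subst ht
        refine ⟨[], isTreePath_nil.2 rfl, by simp [nodes], ?_⟩
        rcases h.root_mem with h₁ | h₁
        · exact absurd h₁ (h.disj _ hu)
        · simp [length, h₁.2]
      · obtain ⟨e, h₁, h₂, h₃, h₄⟩ := h.edge v hu ht
        obtain ⟨p, h₅, h₆, h₇⟩ := h.tree _ h₃
        refine ⟨e :: p, isTreePath_cons.2 ⟨h₂, h₁, h₅⟩, ?_, ?_⟩
        · rw [nodes_cons]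
          simp only [List.mem_cons, forall_eq_or_imp, Set.mem_insert_iff, true_or, true_and]
          exact fun a ha => Or.inr (h₆ a ha)
        · rw [length_cons, NNReal.coe_add, h₇, h₄]
    · obtain ⟨p, h₅, h₆, h₇⟩ := h.tree _ hv
      exact ⟨p, h₅, fun a ha => Or.inr (h₆ a ha), h₇⟩
  · rintro v (rfl | hv) p hp
    · exact key p v (h.disj v hu) hp
    · exact h.opt v hv p hp
  · rintro v ⟨hv, -⟩ ht
    obtain ⟨e, h₁, h₂, h₃, h₄⟩ := h.edge v hv ht
    exact ⟨e, h₁, h₂, Or.inr h₃, h₄⟩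
  · intro v h₁ h₂
    simp only [Set.mem_insert_iff, not_or] at h₁
    exact h.none v h₁.2 fun h₃ => h₂ ⟨h₃, h₁.1⟩
  · intro e he hR hX
    simp only [Set.mem_ofPred_eq] at hR
    have he' : N.head e ∈ S := by simpa [hR] using he
    by_cases hu' : N.tail e = u
    · exact Or.inl (Or.inl hu')
    · rcases h.relaxed e he' (by simp) hX with h₁ | h₁
      · exact Or.inl (Or.inr h₁)
      · exact Or.inr ⟨⟨h₁.1, hu'⟩, h₁.2⟩

/-- An edge that yields no better tentative distance. -/
theorem relax_skip (h : DInv N X S O d T R) {e : Fin N.m}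
    (he : N.tail e ∈ X ∨ N.tail e ∈ S ∨
      (N.tail e ∈ O ∧ d (N.tail e) ≤ N.weight e + d (N.head e))) :
    DInv N X S O d T (R \ {e}) := by
  refine { h with relaxed := fun f hf hR hX => ?_ }
  by_cases hfe : f = e
  · subst hfe; tauto
  · exact h.relaxed f hf (fun h₁ => hR ⟨h₁, hfe⟩) hX

/-- An edge that yields a better tentative distance. -/
theorem relax_update (h : DInv N X S O d T R) {e : Fin N.m} (hh : N.head e ∈ S)
    (hX : N.tail e ∉ X) (hS : N.tail e ∉ S)
    (he : N.tail e ∈ O → N.weight e + d (N.head e) < d (N.tail e)) :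
    DInv N X S (insert (N.tail e) O)
      (Function.update d (N.tail e) (N.weight e + d (N.head e)))
      (Function.update T (N.tail e) (some e)) (R \ {e}) := by
  have hw : (0 : ℝ) ≤ N.weight e := NNReal.coe_nonneg _
  have ht : N.tail e ≠ N.t := by
    intro ht
    rcases h.root_mem with h₁ | ⟨h₁, h₂⟩
    · exact hS (ht ▸ h₁)
    · have := he (ht ▸ h₁)
      have := h.nonneg hh
      rw [ht] at *
      linarith
  have hd : ∀ v ∈ S, Function.update d (N.tail e) (N.weight e + d (N.head e)) v = d v := by
    intro v hv
    exact Function.update_of_ne (fun h₁ => hS (by rwa [← h₁])) _ _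
  refine ⟨?_, h.settled_notMem, ?_, ?_, ?_, ?_, ?_, ?_, ?_, ?_⟩
  · rintro v (rfl | hv)
    · exact hS
    · exact h.disj v hv
  · rintro v (rfl | hv)
    · exact hX
    · exact h.open_notMem v hv
  · rw [Function.update_of_ne ht.symm]; exact h.root
  · rw [Function.update_of_ne ht.symm]
    exact h.root_mem.imp_right fun h₁ => ⟨Or.inr h₁.1, h₁.2⟩
  · intro v hv
    obtain ⟨p, h₁, h₂, h₃⟩ := h.tree v hv
    refine ⟨p, ⟨h₁.1, fun f hf => ?_⟩, h₂, by rw [hd v hv, h₃]⟩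
    rw [Function.update_of_ne]
    · exact h₁.2 f hf
    · intro h₄
      apply hS
      rw [← h₄]
      apply h₂
      rw [nodes_eq h₁.1]
      exact List.mem_append_left _ (List.mem_map_of_mem hf)
  · intro v hv
    rw [hd v hv]; exact h.opt v hv
  · intro v hv hvt
    by_cases hve : v = N.tail e
    · subst hve
      exact ⟨e, by simp, rfl, hh, by rw [Function.update_self, hd _ hh]⟩
    · obtain ⟨f, h₁, h₂, h₃, h₄⟩ := h.edge v (hv.resolve_left hve) hvt
      exact ⟨f, by rw [Function.update_of_ne hve, h₁], h₂, h₃,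
        by rw [Function.update_of_ne hve, hd _ h₃, h₄]⟩
  · intro v hv hvO
    simp only [Set.mem_insert_iff, not_or] at hvO
    rw [Function.update_of_ne hvO.1]
    exact h.none v hv hvO.2
  · intro f hf hR hfX
    by_cases hft : N.tail f = N.tail e
    · refine Or.inr ⟨Or.inl hft, ?_⟩
      rw [hft, Function.update_self, hd _ hf]
      by_cases hfe : f = e
      · subst hfe; exact le_rfl
      · rcases h.relaxed f hf (fun h₁ => hR ⟨h₁, hfe⟩) hfX with h₁ | ⟨h₁, h₂⟩
        · exact absurd (hft ▸ h₁) hS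
        · rw [hft] at h₁ h₂
          exact (he h₁).le.trans h₂
    · have hfe : f ≠ e := fun h₁ => hft (h₁ ▸ rfl)
      rw [Function.update_of_ne hft, hd _ hf]
      exact (h.relaxed f hf (fun h₁ => hR ⟨h₁, hfe⟩) hfX).imp_right fun h₁ => ⟨Or.inr h₁.1, h₁.2⟩

/-- When no node is open any more, the tree is a shortest path tree. -/
theorem isSPTree (h : DInv N X S O d T ∅) (hO : ∀ v, v ∉ O) : IsSPTree X T := by
  have ht : N.t ∈ S := h.root_mem.resolve_right fun h₁ => hO _ h₁.1
  have key : ∀ p v, N.IsPathAvoiding X v p → v ∈ S := by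
    intro p
    induction p with
    | nil => rintro v ⟨rfl, -⟩; exact ht
    | cons e p ih =>
      intro v hp
      rw [isPathAvoiding_cons] at hp
      obtain ⟨rfl, hX, hp⟩ := hp
      exact (h.relaxed e (ih _ hp) (by simp) hX).resolve_right fun h₁ => hO _ h₁.1
  refine ⟨h.root, fun v => ⟨?_, ?_⟩⟩
  · rintro ⟨p, hp⟩
    have hv := key p v hp
    obtain ⟨q, h₁, h₂, h₃⟩ := h.tree v hv
    refine ⟨q, h₁, ⟨h₁.1, fun u hu => h.settled_notMem u (h₂ u hu)⟩, fun p' hp' => ?_⟩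
    have := h.opt v hv p' hp'
    rw [← h₃] at this
    exact_mod_cast this
  · intro hne
    refine h.none v (fun hv => hne ?_) (hO v)
    obtain ⟨q, h₁, h₂, -⟩ := h.tree v hv
    exact ⟨q, h₁.1, fun u hu => h.settled_notMem u (h₂ u hu)⟩

end DInv
end Network
end KSSP

namespace KSSP

open Network

/-! ### Dijkstra's algorithm on the machine -/

/-- The code of an optional number: `0` for nothing, and `x + 1` for `x`. -/
def enc {m : ℕ} : Option (Fin m) → ℕ
  | none => 0
  | some e => (e : ℕ) + 1

/-- Starting from the code `f` of an edge, the pointers in `next` run through the list. -/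
def Linked {m : ℕ} (next : ℕ → ℕ) : ℕ → List (Fin m) → Prop
  | f, [] => f = 0
  | f, e :: l => f = e + 1 ∧ Linked next (next e) l

/-- The static data: the input, for each node a linked list of the edges that enter it (first
elements in the array `2`, successors in the array `3`), and, in the arrays `4, 5, 6`,
the pointers of a tournament tree of logarithmic depth, in which `v + 1` stands for the node
`v` of the network. -/
structure Ready (N : Network) (k : ℕ) (σ : Store) : Prop where
  n : σ.nreg 0 = N.n
  m : σ.nreg 1 = N.m
  k : σ.nreg 2 = k
  s : σ.nreg 3 = N.s
  t : σ.nreg 4 = N.t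
  tail : ∀ e : Fin N.m, σ.narr 0 e = N.tail e
  head : ∀ e : Fin N.m, σ.narr 1 e = N.head e
  weight : ∀ e : Fin N.m, σ.rarr 0 e = N.weight e
  adj : ∀ v : Fin N.n, ∃ l : List (Fin N.m), l.Nodup ∧ (∀ e, e ∈ l ↔ N.head e = v) ∧
    Linked (σ.narr 3) (σ.narr 2 v) l
  forest : ∀ T : Tour, T.par = σ.narr 4 → T.l = σ.narr 5 → T.r = σ.narr 6 → T.best 0 = 0 →
    T.Forest N.n
  depth : ∀ x ≤ N.n, (σ.narr 4)^[Nat.log 2 N.n + 1] x = 0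

theorem Ready.congr {N : Network} {k : ℕ} {σ σ' : Store} (h : Ready N k σ)
    (h₁ : ∀ x < 5, σ'.nreg x = σ.nreg x) (h₂ : ∀ a < 7, σ'.narr a = σ.narr a)
    (h₃ : σ'.rarr 0 = σ.rarr 0) : Ready N k σ' := by
  constructor
  · rw [h₁ 0 (by norm_num), h.n]
  · rw [h₁ 1 (by norm_num), h.m]
  · rw [h₁ 2 (by norm_num), h.k]
  · rw [h₁ 3 (by norm_num), h.s]
  · rw [h₁ 4 (by norm_num), h.t]
  · rw [h₂ 0 (by norm_num)]; exact h.tail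
  · rw [h₂ 1 (by norm_num)]; exact h.head
  · rw [h₃]; exact h.weight
  · rw [h₂ 2 (by norm_num), h₂ 3 (by norm_num)]; exact h.adj
  · rw [h₂ 4 (by norm_num), h₂ 5 (by norm_num), h₂ 6 (by norm_num)]; exact h.forest
  · rw [h₂ 4 (by norm_num)]; exact h.depth

theorem Ready.of_fr {N : Network} {k : ℕ} {P : Prog} {σ σ' : Store} (h : Ready N k σ)
    (hF : Fr P σ σ') (h₁ : ∀ x < 5, P.wN x = false) (h₂ : ∀ a < 7, P.wNA a = false)
    (h₃ : P.wRA 0 = false) : Ready N k σ' :=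
  h.congr (fun x hx => hF.nreg x (h₁ x hx)) (fun a ha => hF.narr a (h₂ a ha)) (hF.rarr 0 h₃)

/-- The entry of a single node of a correct tournament tree has changed; `sift` repairs the
tree. -/
theorem wp_sift_change (b κ : ℕ) {σ σ₁ : Store} {n d y a : ℕ} {q : ℝ}
    (hF : (σ.tour b κ).Forest n) (hA : (σ.tour b κ).AllOK n)
    (h : σ₁.tour b κ = { σ.tour b κ with
      act := Function.update (σ.tour b κ).act y a, key := Function.update (σ.tour b κ).key y q })
    (h5 : σ₁.nreg 5 = y) (hy : y ≤ n) (hd : (σ.narr b)^[d] y = 0) :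
    WP (sift b κ) σ₁ fun τ σ' => τ ≤ d * 100 + 5 ∧ (σ'.tour b κ).Forest n ∧
      (σ'.tour b κ).AllOK n ∧
      σ'.tour b κ = { σ₁.tour b κ with best := (σ'.tour b κ).best } := by
  obtain ⟨h₁, h₂⟩ := Tour.AllOK.change (T' := σ₁.tour b κ) (y := y) hF hA (by rw [h]) (by rw [h])
    (by rw [h]) (by rw [h]) (fun x hx => by rw [h]; simp [hx]) (fun x hx => by rw [h]; simp [hx])
  refine wp_sift b κ σ₁ n d h₁ (by rw [h5]; exact h₂) (by omega) ?_
  rw [h, h5]; exact hd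

/-- Reset the data structures of Dijkstra's algorithm, and open the target. The array `15` marks
the forbidden nodes, the array `14` the forbidden and settled ones, and the tree is built
in the array `16`, from the address in the register `8`. -/
def dijInit : Prog :=
  .nput 8 (.lit 0) (.lit 0) ;; .nset 9 (.lit 0) ;;
  .loop (.nlt (.reg 9) (.reg 0))
    ((.nput 7 (.add (.reg 9) (.lit 1)) (.lit 0) ;; .nput 8 (.add (.reg 9) (.lit 1)) (.lit 0) ;;
      .nput 16 (.add (.reg 8) (.reg 9)) (.lit 0) ;; .nput 14 (.reg 9) (.get 15 (.reg 9))) ;;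
     .nset 9 (.add (.reg 9) (.lit 1))) ;;
  .nput 7 (.add (.reg 4) (.lit 1)) (.lit 1) ;; .rput 1 (.add (.reg 4) (.lit 1)) .zero ;;
  .nset 5 (.add (.reg 4) (.lit 1)) ;; sift 4 1

/-- Relax the edge whose code is in the register `11`, and go on to the next one. The head of
the edge is the node in the register `10`. -/
def dijRelax : Prog :=
  .nset 13 (.sub (.reg 11) (.lit 1)) ;; .nset 12 (.get 0 (.reg 13)) ;;
  .ite (.neq (.get 14 (.reg 12)) (.lit 0))
    (.ite (.and (.not (.neq (.get 7 (.add (.reg 12) (.lit 1))) (.lit 0)))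
        (.not (.rlt (.add (.get 0 (.reg 13)) (.get 1 (.add (.reg 10) (.lit 1))))
          (.get 1 (.add (.reg 12) (.lit 1))))))
      .skip
      (.rput 1 (.add (.reg 12) (.lit 1))
        (.add (.get 0 (.reg 13)) (.get 1 (.add (.reg 10) (.lit 1)))) ;;
       .nput 7 (.add (.reg 12) (.lit 1)) (.lit 1) ;;
       .nput 16 (.add (.reg 8) (.reg 12)) (.reg 11) ;;
       .nset 5 (.add (.reg 12) (.lit 1)) ;; sift 4 1))
    .skip ;;
  .nset 11 (.get 3 (.reg 13))

/-- Settle the best open node and relax the edges that enter it. -/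
def dijSettle : Prog :=
  .nset 10 (.sub (.get 8 (.lit 1)) (.lit 1)) ;; .nput 7 (.add (.reg 10) (.lit 1)) (.lit 0) ;;
  .nput 14 (.reg 10) (.lit 1) ;; .nset 5 (.add (.reg 10) (.lit 1)) ;; sift 4 1 ;;
  .nset 11 (.get 2 (.reg 10)) ;; .loop (.not (.neq (.reg 11) (.lit 0))) dijRelax

/-- Dijkstra's algorithm. -/
def dijkstra : Prog := dijInit ;; .loop (.not (.neq (.get 8 (.lit 1)) (.lit 0))) dijSettle

/-- The array `f` contains the tree `T`, from the address `b`. -/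
def TreeAt {N : Network} (f : ℕ → ℕ) (b : ℕ) (T : N.Tree) : Prop :=
  ∀ v : Fin N.n, f (b + v) = enc (T v)

/-- The memory represents a state of Dijkstra's algorithm. The function `M` gives the contents of
the array `16` below the new tree, which do not change. -/
structure DState (N : Network) (X S O : Set (Fin N.n)) (T : N.Tree) (R : Set (Fin N.m)) (b : ℕ)
    (M : ℕ → ℕ) (σ : Store) : Prop where
  base : σ.nreg 8 = b
  forest : (σ.tour 4 1).Forest N.n
  ok : (σ.tour 4 1).AllOK N.n
  done : ∀ v : Fin N.n, σ.narr 14 v ≠ 0 ↔ v ∈ S ∨ v ∈ X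
  act : ∀ v : Fin N.n, σ.narr 7 (v + 1) ≠ 0 ↔ v ∈ O
  tree : TreeAt (σ.narr 16) b T
  inv : DInv N X S O (fun v => σ.rarr 1 (v + 1)) T R
  low : ∀ i < b, σ.narr 16 i = M i

variable {N : Network} {k : ℕ} {X S O : Set (Fin N.n)} {T : N.Tree} {R : Set (Fin N.m)} {b : ℕ}
  {M : ℕ → ℕ} {σ : Store}

theorem wp_dijRelax (hr : Ready N k σ) (h : DState N X S O T R b M σ) (e : Fin N.m)
    (h10 : σ.nreg 10 = N.head e) (hS : N.head e ∈ S) (h11 : σ.nreg 11 = e + 1) :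
    WP dijRelax σ fun τ σ' => τ ≤ Nat.log 2 N.n * 100 + 200 ∧
      (∃ O' T', DState N X S O' T' (R \ {e}) b M σ') ∧ σ'.nreg 11 = σ.narr 3 e := by
  apply wp_seq; apply wp_nset; apply wp_seq; apply wp_nset; apply wp_seq
  simp only [NExpr.eval, NExpr.cost, h11, Nat.add_sub_cancel, Function.update_self, hr.tail]
  set σ₁ : Store := { σ with
    nreg := Function.update (Function.update σ.nreg 13 e) 12 (N.tail e) } with hσ₁
  have hst : DState N X S O T R b M σ₁ := ⟨h.base, h.forest, h.ok, h.done, h.act, h.tree, h.inv, h.low⟩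
  have hskip : (N.tail e ∈ X ∨ N.tail e ∈ S ∨ (N.tail e ∈ O ∧
      σ.rarr 1 (N.tail e + 1) ≤ N.weight e + σ.rarr 1 (N.head e + 1))) →
      DState N X S O T (R \ {e}) b M { σ₁ with
        nreg := Function.update σ₁.nreg 11 (σ.narr 3 e) } := fun hh =>
    ⟨h.base, h.forest, h.ok, h.done, h.act, h.tree, h.inv.relax_skip hh, h.low⟩
  apply wp_ite
  · intro hd
    simp only [Test.Holds, NExpr.eval, hσ₁, Function.update_self] at hd
    have hd' := (not_congr (h.done (N.tail e))).1 (not_not.2 hd)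
    rw [not_or] at hd'
    apply wp_ite
    · intro hc
      apply wp_skip; apply wp_nset
      refine ⟨by simp only [NExpr.cost, Test.cost, RExpr.cost]; omega, ⟨O, T, ?_⟩, by simp [NExpr.eval, hσ₁]⟩
      have h13 : σ₁.nreg 13 = e := rfl
      simp only [NExpr.eval, h13]
      apply hskip
      simp only [Test.Holds, NExpr.eval, RExpr.eval, not_lt] at hc
      refine Or.inr (Or.inr ⟨(h.act _).1 hc.1, ?_⟩)
      have h12 : σ₁.nreg 12 = N.tail e := rfl
      have := hc.2
      rw [h12, h13, show σ₁.nreg 10 = N.head e from h10] at this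
      rw [← hr.weight]; exact this
    · intro hc
      apply wp_seq; apply wp_rput; apply wp_seq; apply wp_nput; apply wp_seq; apply wp_nput
      apply wp_seq; apply wp_nset
      apply wp_gen
      intro σ₂ hσ₂
      simp only [NExpr.eval, RExpr.eval, hσ₁, hr.weight, Function.update_self, ne_eq, h10, h11,
        Nat.reduceEqDiff, not_false_eq_true, Function.update_of_ne,
        h.base] at hσ₂
      have hy : (N.tail e : ℕ) + 1 ≤ N.n := (N.tail e).2
      refine (wp_sift_change 4 1 (y := N.tail e + 1) (a := 1)
        (q := N.weight e + σ.rarr 1 (N.head e + 1)) h.forest h.ok ?_ ?_ hy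
        (hr.depth _ hy)).mono ?_
      · simp [Store.tour, hσ₂]
      · simp [hσ₂]
      · rintro τ σ' hF ⟨hτ, hf, ho, ht⟩
        simp only [Test.Holds, NExpr.eval, RExpr.eval, not_lt] at hc
        apply wp_nset
        refine ⟨?_, ⟨insert (N.tail e) O, Function.update T (N.tail e) (some e), ?_⟩, ?_⟩
        rotate_left
        · have hact : σ'.narr 7 = Function.update (σ.narr 7) (N.tail e + 1) 1 := by
            have := congrArg Tour.act ht
            simpa [Store.tour, hσ₂] using this
          have hkey : σ'.rarr 1 = Function.update (σ.rarr 1) (N.tail e + 1)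
              (N.weight e + σ.rarr 1 (N.head e + 1)) := by
            have := congrArg Tour.key ht
            simpa [Store.tour, hσ₂] using this
          have h16 : σ'.narr 16 = Function.update (σ.narr 16) (b + N.tail e) (e + 1) := by
            rw [hF.narr 16 rfl]
            simp [hσ₂]
          have h14 : σ'.narr 14 = σ.narr 14 := by
            rw [hF.narr 14 rfl]
            simp [hσ₂]
          have hupd : (fun v : Fin N.n => σ'.rarr 1 (v + 1)) =
              Function.update (fun v : Fin N.n => σ.rarr 1 (v + 1)) (N.tail e)
                (N.weight e + σ.rarr 1 (N.head e + 1)) := by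
            ext v
            rw [hkey]
            simp [Function.update_apply, Fin.ext_iff]
          refine ⟨?_, hf, ho, fun v => by simpa only [h14] using h.done v, ?_, ?_, ?_, ?_⟩
          · simp only
            rw [Function.update_of_ne (by decide), hF.nreg 8 rfl]
            simpa [hσ₂] using h.base
          · intro v
            simp only [hact, Function.update_apply, Set.mem_insert_iff, Fin.ext_iff]
            have := h.act v
            by_cases hv : (v : ℕ) = N.tail e
            · simp [hv]
            · simpa [hv] using this
          · intro v
            simp only [h16, Function.update_apply, Fin.ext_iff]
            have := h.tree v
            by_cases hv : (v : ℕ) = N.tail e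
            · simp [hv, enc]
            · simpa [hv] using this
          · simp only [hupd]
            refine h.inv.relax_update hS hd'.2 hd'.1 fun hO => ?_
            have h₁ := (h.act _).2 hO
            by_contra h₂
            apply hc
            refine ⟨h₁, ?_⟩
            have h12 : σ₁.nreg 12 = N.tail e := rfl
            have h13 : σ₁.nreg 13 = e := rfl
            rw [h12, h13, show σ₁.nreg 10 = N.head e from h10]
            rw [← hr.weight] at h₂
            exact not_lt.1 h₂
          · intro i hi
            simp only [h16]
            rw [Function.update_of_ne (by omega), h.low i hi]
        · simp only [NExpr.eval, Function.update_self]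
          rw [hF.narr 3 rfl, hF.nreg 13 rfl]
          simp [hσ₂]
        · simp only [NExpr.cost, Test.cost, RExpr.cost]; omega
  · intro hd
    simp only [Test.Holds, NExpr.eval, hσ₁, Function.update_self] at hd
    apply wp_skip; apply wp_nset
    refine ⟨by simp only [NExpr.cost, Test.cost]; omega, ⟨O, T, ?_⟩, by simp [NExpr.eval, hσ₁]⟩
    have h13 : σ₁.nreg 13 = e := rfl
    simp only [NExpr.eval, h13]
    exact hskip (((h.done _).1 hd).symm.imp_right Or.inl)

end KSSP

namespace KSSP

open Network

variable {N : Network} {k : ℕ} {X S O : Set (Fin N.n)} {T : N.Tree} {R : Set (Fin N.m)} {b : ℕ}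
  {M : ℕ → ℕ} {σ : Store}

theorem wp_dijInit (hr : Ready N k σ) (hX : ∀ v : Fin N.n, σ.narr 15 v ≠ 0 ↔ v ∈ X)
    (ht : N.t ∉ X) :
    WP dijInit σ fun τ σ' => τ ≤ N.n * 50 + Nat.log 2 N.n * 100 + 200 ∧
      DState N X ∅ {N.t} (fun _ => none) ∅ (σ.nreg 8) (σ.narr 16) σ' := by
  apply wp_seq; apply wp_nput; apply wp_seq; apply wp_nset; apply wp_seq
  apply wp_gen
  intro σ₁ hσ₁
  simp only [NExpr.eval] at hσ₁
  refine (wp_for (fun j σ' => σ'.narr 8 0 = 0 ∧ (∀ i < j, σ'.narr 7 (i + 1) = 0 ∧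
      σ'.narr 8 (i + 1) = 0 ∧ σ'.narr 16 (σ.nreg 8 + i) = 0 ∧ σ'.narr 14 i = σ.narr 15 i) ∧
      ∀ i < σ.nreg 8, σ'.narr 16 i = σ.narr 16 i) (Q := fun σ' => σ'.narr 8 0 = 0 ∧
      (∀ i < N.n, σ'.narr 7 (i + 1) = 0 ∧
      σ'.narr 8 (i + 1) = 0 ∧ σ'.narr 16 (σ.nreg 8 + i) = 0 ∧ σ'.narr 14 i = σ.narr 15 i) ∧
      ∀ i < σ.nreg 8, σ'.narr 16 i = σ.narr 16 i) N.n 40 ?_ ?_ ?_ ?_ ?_).mono ?_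
  · simp [hσ₁]
  · simp [hσ₁]
  · intro j σ' hF _
    simp only [NExpr.eval]
    rw [hF.nreg 0 rfl]
    simp [hσ₁, hr.n]
  · rintro j σ' hF ⟨h₁, h₂, h₃⟩ hj hjb
    have h8 : σ'.nreg 8 = σ.nreg 8 := by rw [hF.nreg 8 rfl]; simp [hσ₁]
    have h15 : σ'.narr 15 = σ.narr 15 := by rw [hF.narr 15 rfl]; simp [hσ₁]
    apply wp_seq; apply wp_nput; apply wp_seq; apply wp_nput; apply wp_seq; apply wp_nput
    apply wp_nput
    apply And.intro
    · simp [NExpr.cost]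
    refine ⟨hj, ?_⟩
    simp only [NExpr.eval, hj, h8, ne_eq, Nat.reduceEqDiff, not_false_eq_true,
      Function.update_of_ne, Function.update_self, h15]
    refine ⟨h₁, fun i hi => ?_, fun i hi => ?_⟩
    · rcases Nat.lt_succ_iff_lt_or_eq.1 hi with hi | rfl
      · obtain ⟨h₄, h₅, h₆, h₇⟩ := h₂ i hi
        rw [Function.update_of_ne (by omega), Function.update_of_ne (by omega),
          Function.update_of_ne (by omega), Function.update_of_ne (by omega)]
        exact ⟨h₄, h₅, h₆, h₇⟩
      · simp
    · rw [Function.update_of_ne (by omega), h₃ i hi]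
  · intro σ' _ h _; exact h
  · rintro τ σ' hF ⟨hτ, h₁, h₂, h₃⟩
    have h4 : σ'.nreg 4 = N.t := by rw [hF.nreg 4 rfl]; simp [hσ₁, hr.t]
    have h8 : σ'.nreg 8 = σ.nreg 8 := by rw [hF.nreg 8 rfl]; simp [hσ₁]
    have hp : σ'.narr 4 = σ.narr 4 := by rw [hF.narr 4 rfl]; simp [hσ₁]
    have hl : σ'.narr 5 = σ.narr 5 := by rw [hF.narr 5 rfl]; simp [hσ₁]
    have hrr : σ'.narr 6 = σ.narr 6 := by rw [hF.narr 6 rfl]; simp [hσ₁]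
    have hforest : (σ'.tour 4 1).Forest N.n := hr.forest _ hp hl hrr h₁
    have hb0 : ∀ x ≤ N.n, σ'.narr 8 x = 0 := by
      intro x hx
      cases x with
      | zero => exact h₁
      | succ x => exact (h₂ x (by omega)).2.1
    have hok : (σ'.tour 4 1).AllOK N.n := by
      intro x hx hxn
      obtain ⟨y, rfl⟩ : ∃ y, x = y + 1 := ⟨x - 1, by omega⟩
      have hll : (σ'.tour 4 1).l (y + 1) ≤ N.n := by
        rcases hforest.l_ok _ hx hxn with h | h <;> omega
      have hlr : (σ'.tour 4 1).r (y + 1) ≤ N.n := by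
        rcases hforest.r_ok _ hx hxn with h | h <;> omega
      exact ⟨fun h => absurd (hb0 _ hxn) h, fun h => absurd (h₂ y (by omega)).1 h,
        fun h => absurd (hb0 _ hll) h, fun h => absurd (hb0 _ hlr) h⟩
    apply wp_seq; apply wp_nput; apply wp_seq; apply wp_rput; apply wp_seq; apply wp_nset
    apply wp_gen
    intro σ₂ hσ₂
    simp only [NExpr.eval, RExpr.eval, h4] at hσ₂
    have hy : (N.t : ℕ) + 1 ≤ N.n := N.t.2
    refine (wp_sift_change 4 1 (y := N.t + 1) (a := 1) (q := 0) hforest hok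
      ?_ ?_ hy ((show σ'.narr 4 = _ from hp) ▸ hr.depth _ hy)).mono ?_
    · simp [Store.tour, hσ₂]
    · simp [hσ₂]
    · rintro τ' σ₃ hF₃ ⟨hτ', hf, ho, htr⟩
      have hact : σ₃.narr 7 = Function.update (σ'.narr 7) (N.t + 1) 1 := by
        have := congrArg Tour.act htr
        simpa [Store.tour, hσ₂] using this
      have hkey : σ₃.rarr 1 = Function.update (σ'.rarr 1) (N.t + 1) 0 := by
        have := congrArg Tour.key htr
        simpa [Store.tour, hσ₂] using this
      have h16 : σ₃.narr 16 = σ'.narr 16 := by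
        rw [hF₃.narr 16 rfl]; simp [hσ₂]
      have h14 : σ₃.narr 14 = σ'.narr 14 := by
        rw [hF₃.narr 14 rfl]; simp [hσ₂]
      refine ⟨?_, ?_, hf, ho, fun v => ?_, fun v => ?_, fun v => ?_, DInv.init ht ?_, ?_⟩
      · simp only [NExpr.cost, RExpr.cost, hσ₁, Function.update_self] at hτ ⊢
        omega
      · rw [hF₃.nreg 8 rfl]; simp [hσ₂, h8]
      · rw [h14, (h₂ v v.2).2.2.2, hX]; simp
      · simp only [hact, Function.update_apply, Set.mem_singleton_iff, Fin.ext_iff]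
        by_cases hv : (v : ℕ) = N.t
        · simp [hv]
        · simpa [hv] using (h₂ v v.2).1
      · rw [h16, (h₂ v v.2).2.2.1]; rfl
      · simp [hkey]
      · intro i hi; rw [h16, h₃ i hi]

open Classical in
/-- A bound for the time that Dijkstra's algorithm still needs when the nodes in `S` are
settled. -/
noncomputable def dijPot (N : Network) (S : Set (Fin N.n)) : ℕ :=
  (Finset.univ.filter fun v => v ∉ S).card * (Nat.log 2 N.n * 100 + 200) +
    (Finset.univ.filter fun e => N.head e ∉ S).card * (Nat.log 2 N.n * 100 + 210)

open Classical in
theorem dijPot_insert {u : Fin N.n} (hu : u ∉ S) {l : List (Fin N.m)} (hl : l.Nodup)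
    (h : ∀ e, e ∈ l ↔ N.head e = u) :
    dijPot N (insert u S) + (Nat.log 2 N.n * 100 + 200) +
      l.length * (Nat.log 2 N.n * 100 + 210) = dijPot N S := by
  obtain ⟨S', hS'⟩ : ∃ S', S' = insert u S := ⟨_, rfl⟩
  rw [← hS']
  have h₁ : (Finset.univ.filter fun v => v ∉ S).card =
      (Finset.univ.filter fun v => v ∉ S').card + 1 := by
    rw [← Finset.card_erase_add_one (a := u) (by simpa using hu)]
    congr 2
    ext v
    simp only [Finset.mem_erase, Finset.mem_filter, Finset.mem_univ, true_and, hS', Set.mem_insert_iff]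
    tauto
  have h₂ : (Finset.univ.filter fun e => N.head e ∉ S).card =
      (Finset.univ.filter fun e => N.head e ∉ S').card + l.length := by
    rw [← List.toFinset_card_of_nodup hl, ← Finset.card_union_of_disjoint]
    · congr 1
      ext e
      simp only [Finset.mem_filter, Finset.mem_univ, true_and, hS', Set.mem_insert_iff,
        Finset.mem_union, List.mem_toFinset, h]
      by_cases he : N.head e = u
      · simp [he, hu]
      · simp [he]
    · rw [Finset.disjoint_left]
      intro e he
      simp only [Finset.mem_filter, Finset.mem_univ, true_and, hS', Set.mem_insert_iff] at he
      rw [List.mem_toFinset, h]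
      tauto
  unfold dijPot
  rw [h₁, h₂, Nat.add_mul, Nat.add_mul]
  omega

theorem wp_dijScan (u : Fin N.n) (l : List (Fin N.m)) (hr : Ready N k σ)
    (h : DState N X S O T {e | e ∈ l} b M σ) (h10 : σ.nreg 10 = u) (hu : u ∈ S) (hl : l.Nodup)
    (hlu : ∀ e ∈ l, N.head e = u) (h11 : Linked (σ.narr 3) (σ.nreg 11) l) :
    WP (.loop (.not (.neq (.reg 11) (.lit 0))) dijRelax) σ fun τ σ' =>
      τ ≤ l.length * (Nat.log 2 N.n * 100 + 210) + 5 ∧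
      ∃ O' T', DState N X S O' T' ∅ b M σ' := by
  refine wp_loop (fun p σ' => ∃ O' T' l', DState N X S O' T' {e | e ∈ l'} b M σ' ∧ l'.Nodup ∧
    (∀ e ∈ l', N.head e = u) ∧ Linked (σ.narr 3) (σ'.nreg 11) l' ∧
    p = l'.length * (Nat.log 2 N.n * 100 + 210) + 5) _ ⟨O, T, l, h, hl, hlu, h11, rfl⟩ ?_ ?_
  · rintro p σ' hF ⟨O', T', l', hD, hl', hlu', h11', rfl⟩ hb
    have hr' : Ready N k σ' := hr.of_fr hF (by decide) (by decide) (by decide)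
    simp only [Test.Holds, NExpr.eval] at hb
    cases l' with
    | nil => exact absurd h11' hb
    | cons e l' =>
      obtain ⟨h₁, h₂⟩ := h11'
      have heu : N.head e = u := hlu' e (by simp)
      refine (wp_dijRelax hr' hD e (by rw [hF.nreg 10 rfl, h10, heu]) (heu ▸ hu) h₁).mono ?_
      rintro τ σ'' - ⟨hτ, ⟨O'', T'', hD'⟩, h11'⟩
      refine ⟨l'.length * (Nat.log 2 N.n * 100 + 210) + 5, ?_, O'', T'', l', ?_,
        hl'.of_cons, fun f hf => hlu' f (by simp [hf]), ?_, rfl⟩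
      · simp only [Test.cost, NExpr.cost, List.length_cons, Nat.add_mul]; omega
      · convert hD' using 1
        ext f
        have := (List.nodup_cons.1 hl').1
        simp only [Set.mem_ofPred_eq, List.mem_cons, Set.mem_sdiff, Set.mem_singleton_iff]
        constructor
        · intro hf
          exact ⟨Or.inr hf, fun h => this (h ▸ hf)⟩
        · tauto
      · rw [h11', hF.narr 3 rfl]; exact h₂
  · rintro p σ' hF ⟨O', T', l', hD, hl', hlu', h11', rfl⟩ hb
    simp only [Test.Holds, NExpr.eval, not_not] at hb
    cases l' with
    | cons e l' => have := h11'.1; omega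
    | nil =>
      refine ⟨by simp [Test.cost, NExpr.cost], O', T', ?_⟩
      simpa using hD

theorem wp_dijSettle (hr : Ready N k σ) (h : DState N X S O T ∅ b M σ) (hb : σ.narr 8 1 ≠ 0) :
    WP dijSettle σ fun τ σ' => ∃ S' O' T', DState N X S' O' T' ∅ b M σ' ∧
      τ + 20 + dijPot N S' ≤ dijPot N S := by
  have h1n : 1 ≤ N.n := N.t.pos
  obtain ⟨ha, hn, -⟩ := (h.ok 1 le_rfl h1n).mem hb
  change σ.narr 7 (σ.narr 8 1) ≠ 0 at ha
  change σ.narr 8 1 ≤ N.n at hn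
  obtain ⟨u, hu⟩ : ∃ u : Fin N.n, σ.narr 8 1 = u + 1 :=
    ⟨⟨σ.narr 8 1 - 1, by omega⟩, by simp only; omega⟩
  rw [hu] at ha
  have huO := (h.act u).1 ha
  have huS := h.inv.disj u huO
  have hmin : ∀ v ∈ O, σ.rarr 1 (u + 1) ≤ σ.rarr 1 (v + 1) := by
    intro v hv
    have := (h.ok.root h.forest (x := v + 1) (by omega) v.2 ((h.act v).2 hv)).2
    change σ.rarr 1 (σ.narr 8 1) ≤ σ.rarr 1 (v + 1) at this
    rwa [hu] at this
  apply wp_seq; apply wp_nset; apply wp_seq; apply wp_nput; apply wp_seq; apply wp_nput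
  apply wp_seq; apply wp_nset; apply wp_seq
  apply wp_gen
  intro σ₂ hσ₂
  simp only [NExpr.eval, hu, ne_eq, Nat.reduceEqDiff, not_false_eq_true, Nat.add_sub_cancel,
    Function.update_of_ne, Function.update_self] at hσ₂
  refine (wp_sift_change 4 1 (y := u + 1) (a := 0) (q := σ.rarr 1 (u + 1)) h.forest h.ok
      ?_ ?_ u.2 (hr.depth _ u.2)).mono ?_
  · simp [Store.tour, hσ₂]
  · simp [hσ₂]
  rintro τ σ₃ hF₃ ⟨hτ, hf, ho, htr⟩
  have hact : σ₃.narr 7 = Function.update (σ.narr 7) (u + 1) 0 := by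
    have := congrArg Tour.act htr
    simpa [Store.tour, hσ₂] using this
  have hkey : σ₃.rarr 1 = σ.rarr 1 := by
    have := congrArg Tour.key htr
    simpa [Store.tour, hσ₂] using this
  have h16 : σ₃.narr 16 = σ.narr 16 := by
    rw [hF₃.narr 16 rfl]; simp [hσ₂]
  have h14 : σ₃.narr 14 = Function.update (σ.narr 14) u 1 := by
    rw [hF₃.narr 14 rfl]; simp [hσ₂]
  have h10 : σ₃.nreg 10 = u := by
    rw [hF₃.nreg 10 rfl]; simp [hσ₂]
  have hr₂ : Ready N k σ₂ := by
    refine hr.congr ?_ ?_ ?_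
    · intro x hx; interval_cases x <;> simp [hσ₂]
    · intro x hx; interval_cases x <;> simp [hσ₂]
    · simp [hσ₂]
  have hr₃ : Ready N k σ₃ := hr₂.of_fr hF₃ (by decide) (by decide) (by decide)
  obtain ⟨l, hl, hlu, hll⟩ := hr₃.adj u
  apply wp_seq; apply wp_nset
  apply wp_gen
  intro σ₄ hσ₄
  simp only [NExpr.eval, h10] at hσ₄
  have hr₄ : Ready N k σ₄ := by
    refine hr₃.congr ?_ ?_ ?_
    · intro x hx; interval_cases x <;> simp [hσ₄]
    · intro x hx; interval_cases x <;> simp [hσ₄]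
    · simp [hσ₄]
  have hD : DState N X (insert u S) (O \ {u}) T {e | e ∈ l} b M σ₄ := by
    refine ⟨?_, ?_, ?_, fun v => ?_, fun v => ?_, ?_, ?_, ?_⟩
    · rw [hσ₄]; simp only; rw [Function.update_of_ne (by decide), hF₃.nreg 8 rfl]
      simpa [hσ₂] using h.base
    · rw [hσ₄]; exact hf
    · rw [hσ₄]; exact ho
    · simp only [hσ₄, h14, Function.update_apply, Set.mem_insert_iff, Fin.ext_iff]
      have := h.done v
      by_cases hv : (v : ℕ) = u
      · simp [hv]
      · simpa [hv] using this
    · simp only [hσ₄, hact, Function.update_apply, Set.mem_sdiff, Set.mem_singleton_iff, Fin.ext_iff]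
      have := h.act v
      by_cases hv : (v : ℕ) = u
      · simp [hv]
      · simpa [hv] using this
    · rw [hσ₄]; simp only [h16]; exact h.tree
    · rw [hσ₄]; simp only [hkey]
      have hR : {e | e ∈ l} = {e | N.head e = u} := by ext e; exact hlu e
      rw [hR]
      exact h.inv.settle huO hmin
    · rw [hσ₄]; simp only [h16]; exact h.low
  have h10' : σ₄.nreg 10 = u := by simpa [hσ₄] using h10
  have h11' : Linked (σ₄.narr 3) (σ₄.nreg 11) l := by simpa [hσ₄] using hll
  refine (wp_dijScan u l hr₄ hD h10' (Set.mem_insert _ _) hl (fun e he => (hlu e).1 he) h11').mono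
    ?_
  rintro τ' σ' - ⟨hτ', O', T', hD'⟩
  refine ⟨_, O', T', hD', ?_⟩
  have := dijPot_insert (N := N) huS hl hlu
  simp only [NExpr.cost]
  omega

/-- A bound for the running time of Dijkstra's algorithm. -/
def dijTime (n m : ℕ) : ℕ := (n + m + 1) * (Nat.log 2 n * 100 + 300)

/-- Dijkstra's algorithm computes a shortest path tree in time `O((n + m) log n)`. -/
theorem wp_dijkstra (hr : Ready N k σ) (hX : ∀ v : Fin N.n, σ.narr 15 v ≠ 0 ↔ v ∈ X)
    (ht : N.t ∉ X) :
    WP dijkstra σ fun τ σ' => τ ≤ dijTime N.n N.m ∧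
      (∃ T, IsSPTree X T ∧ TreeAt (σ'.narr 16) (σ.nreg 8) T) ∧
      ∀ i < σ.nreg 8, σ'.narr 16 i = σ.narr 16 i := by
  apply wp_seq
  refine (wp_dijInit hr hX ht).mono ?_
  rintro τ₁ σ₁ hF₁ ⟨hτ₁, hD₁⟩
  have hr₁ : Ready N k σ₁ := hr.of_fr hF₁ (by decide) (by decide) (by decide)
  refine (wp_loop (fun p σ' => ∃ S O T, DState N X S O T ∅ (σ.nreg 8) (σ.narr 16) σ' ∧
    p = dijPot N S + 10) (Q := fun σ' => (∃ T, IsSPTree X T ∧ TreeAt (σ'.narr 16) (σ.nreg 8) T) ∧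
      ∀ i < σ.nreg 8, σ'.narr 16 i = σ.narr 16 i) _ ⟨_, _, _, hD₁, rfl⟩ ?_ ?_).mono ?_
  · rintro p σ' hF ⟨S, O, T, hD, rfl⟩ hb
    simp only [Test.Holds, NExpr.eval] at hb
    refine (wp_dijSettle (hr₁.of_fr hF (by decide) (by decide) (by decide)) hD hb).mono ?_
    rintro τ σ'' - ⟨S', O', T', hD', hτ⟩
    refine ⟨_, ?_, S', O', T', hD', rfl⟩
    simp only [Test.cost, NExpr.cost]
    omega
  · rintro p σ' hF ⟨S, O, T, hD, rfl⟩ hb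
    simp only [Test.Holds, NExpr.eval, not_not] at hb
    refine ⟨by simp [Test.cost, NExpr.cost], ⟨T, hD.inv.isSPTree fun v hv => ?_, hD.tree⟩, hD.low⟩
    have := (hD.ok.root hD.forest (x := v + 1) (by omega) v.2 ((hD.act v).2 hv)).1
    exact this hb
  · rintro τ σ' - ⟨hτ, hQ⟩
    refine ⟨?_, hQ⟩
    have : dijPot N ∅ = N.n * (Nat.log 2 N.n * 100 + 200) +
        N.m * (Nat.log 2 N.n * 100 + 210) := by simp [dijPot]
    rw [this] at hτ
    unfold dijTime
    simp only [Nat.add_mul, Nat.mul_add] at *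
    omega

end KSSP

namespace KSSP

open Network

variable {N : Network} {k : ℕ} {σ : Store}

/-! ### Initialization -/

/-- Build the linked lists of the edges that enter a node. -/
def setupAdj : Prog :=
  .nset 9 (.lit 0) ;;
  .loop (.nlt (.reg 9) (.reg 1))
    ((.nput 3 (.reg 9) (.get 2 (.get 1 (.reg 9))) ;;
      .nput 2 (.get 1 (.reg 9)) (.add (.reg 9) (.lit 1))) ;;
     .nset 9 (.add (.reg 9) (.lit 1)))

/-- Build the tree in which the children of `x` are `2 x` and `2 x + 1`. -/
def setupTree : Prog :=
  .nset 9 (.lit 1) ;;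
  .loop (.nlt (.reg 9) (.add (.reg 0) (.lit 1)))
    ((.ite (.nlt (.reg 0) (.add (.reg 9) (.reg 9))) .skip
        (.nput 5 (.reg 9) (.add (.reg 9) (.reg 9)) ;;
         .nput 4 (.add (.reg 9) (.reg 9)) (.reg 9)) ;;
      .ite (.nlt (.reg 0) (.add (.add (.reg 9) (.reg 9)) (.lit 1))) .skip
        (.nput 6 (.reg 9) (.add (.add (.reg 9) (.reg 9)) (.lit 1)) ;;
         .nput 4 (.add (.add (.reg 9) (.reg 9)) (.lit 1)) (.reg 9))) ;;
     .nset 9 (.add (.reg 9) (.lit 1)))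

theorem Linked.congr {m j : ℕ} {next next' : ℕ → ℕ} (h : ∀ i < j, next' i = next i) :
    ∀ {f : ℕ} {l : List (Fin m)}, (∀ e ∈ l, (e : ℕ) < j) → Linked next f l → Linked next' f l
  | _, [], _, h₁ => h₁
  | _, e :: l, hl, h₁ => by
    refine ⟨h₁.1, ?_⟩
    rw [h e (hl e (by simp))]
    exact Linked.congr h (fun e he => hl e (by simp [he])) h₁.2

theorem wp_setupAdj (hm : σ.nreg 1 = N.m) (hh : ∀ e : Fin N.m, σ.narr 1 e = N.head e)
    (h2 : ∀ i, σ.narr 2 i = 0) :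
    WP setupAdj σ fun τ σ' => τ ≤ N.m * 30 + 20 ∧ ∀ v : Fin N.n, ∃ l : List (Fin N.m), l.Nodup ∧
      (∀ e, e ∈ l ↔ N.head e = v) ∧ Linked (σ'.narr 3) (σ'.narr 2 v) l := by
  apply wp_seq; apply wp_nset
  apply wp_gen
  intro σ₁ hσ₁
  simp only [NExpr.eval] at hσ₁
  refine (wp_for (fun j σ' => ∀ v : Fin N.n, ∃ l : List (Fin N.m), l.Nodup ∧
      (∀ e, e ∈ l ↔ N.head e = v ∧ e < j) ∧ Linked (σ'.narr 3) (σ'.narr 2 v) l)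
      (Q := fun σ' => ∀ v : Fin N.n, ∃ l : List (Fin N.m), l.Nodup ∧
      (∀ e, e ∈ l ↔ N.head e = v) ∧ Linked (σ'.narr 3) (σ'.narr 2 v) l)
      N.m 20 ?_ ?_ ?_ ?_ ?_).mono ?_
  · intro v
    refine ⟨[], List.nodup_nil, by simp [hσ₁], ?_⟩
    simp [Linked, hσ₁, h2]
  · simp [hσ₁]
  · intro j σ' hF _
    simp only [NExpr.eval]
    rw [hF.nreg 1 rfl]
    simp [hσ₁, hm]
  · intro j σ' hF hI hj hjm
    have h1 : σ'.narr 1 = σ.narr 1 := by rw [hF.narr 1 rfl]; simp [hσ₁]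
    apply wp_seq; apply wp_nput; apply wp_nput
    have hhj := hh ⟨j, hjm⟩
    simp only at hhj
    simp only [NExpr.eval, NExpr.cost, hj, h1, hhj, ne_eq, Nat.reduceEqDiff, not_false_eq_true,
      Function.update_of_ne, Function.update_self]
    refine ⟨by omega, trivial, fun v => ?_⟩
    obtain ⟨l, h₁, h₂, h₃⟩ := hI v
    have hlt : ∀ e ∈ l, (e : ℕ) < j := fun e he => ((h₂ e).1 he).2
    have h₄ : ∀ f, Linked (σ'.narr 3) f l →
        Linked (Function.update (σ'.narr 3) j (σ'.narr 2 (N.head ⟨j, hjm⟩))) f l := fun f =>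
      Linked.congr (fun i hi => Function.update_of_ne (by omega) _ _) hlt
    by_cases hv : N.head ⟨j, hjm⟩ = v
    · subst hv
      refine ⟨⟨j, hjm⟩ :: l, List.nodup_cons.2 ⟨fun h => ?_, h₁⟩, fun e => ?_, ?_⟩
      · exact absurd (hlt _ h) (lt_irrefl _)
      · rw [List.mem_cons, h₂, Nat.lt_succ_iff_lt_or_eq, Fin.ext_iff]
        constructor
        · rintro (h | h)
          · exact ⟨by congr 1; exact Fin.ext h, Or.inr h⟩
          · exact ⟨h.1, Or.inl h.2⟩
        · rintro ⟨h, h' | h'⟩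
          · exact Or.inr ⟨h, h'⟩
          · exact Or.inl h'
      · refine ⟨by simp, ?_⟩
        simp only [Function.update_self]
        exact h₄ _ h₃
    · refine ⟨l, h₁, fun e => ?_, ?_⟩
      · rw [h₂, Nat.lt_succ_iff_lt_or_eq]
        constructor
        · rintro ⟨h, h'⟩; exact ⟨h, Or.inl h'⟩
        · rintro ⟨h, h' | h'⟩
          · exact ⟨h, h'⟩
          · exact absurd (by rw [← h]; congr 1; exact (Fin.ext h').symm) hv
      · rw [Function.update_of_ne (fun h => hv (Fin.ext h.symm))]
        exact h₄ _ h₃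
  · intro σ' _ h _ v
    obtain ⟨l, h₁, h₂, h₃⟩ := h v
    exact ⟨l, h₁, fun e => by simp [h₂], h₃⟩
  · rintro τ σ' - ⟨hτ, hQ⟩
    refine ⟨?_, hQ⟩
    simp only [hσ₁, NExpr.cost, Function.update_self] at hτ ⊢
    omega

theorem wp_setupTree (n : ℕ) (hn : σ.nreg 0 = n) (h4 : ∀ i, σ.narr 4 i = 0)
    (h5 : ∀ i, σ.narr 5 i = 0) (h6 : ∀ i, σ.narr 6 i = 0) :
    WP setupTree σ fun τ σ' => τ ≤ n * 60 + 20 ∧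
      (∀ y, σ'.narr 4 y = if 2 ≤ y ∧ y ≤ n then y / 2 else 0) ∧
      (∀ x, 1 ≤ x → x ≤ n → σ'.narr 5 x = if x + x ≤ n then x + x else 0) ∧
      (∀ x, 1 ≤ x → x ≤ n → σ'.narr 6 x = if x + x + 1 ≤ n then x + x + 1 else 0) := by
  apply wp_seq; apply wp_nset
  apply wp_gen
  intro σ₁ hσ₁
  simp only [NExpr.eval] at hσ₁
  refine (wp_for (fun j σ' => 1 ≤ j ∧
      (∀ y, σ'.narr 4 y = if 2 ≤ y ∧ y ≤ n ∧ y / 2 < j then y / 2 else 0) ∧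
      (∀ x, σ'.narr 5 x = if 1 ≤ x ∧ x + x ≤ n ∧ x < j then x + x else 0) ∧
      (∀ x, σ'.narr 6 x = if 1 ≤ x ∧ x + x + 1 ≤ n ∧ x < j then x + x + 1 else 0))
      (Q := fun σ' => (∀ y, σ'.narr 4 y = if 2 ≤ y ∧ y ≤ n then y / 2 else 0) ∧
      (∀ x, 1 ≤ x → x ≤ n → σ'.narr 5 x = if x + x ≤ n then x + x else 0) ∧
      (∀ x, 1 ≤ x → x ≤ n → σ'.narr 6 x = if x + x + 1 ≤ n then x + x + 1 else 0))
      (n + 1) 45 ?_ ?_ ?_ ?_ ?_).mono ?_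
  · simp only [hσ₁, Function.update_self, h4, h5, h6]
    refine ⟨le_rfl, fun y => ?_, fun x => ?_, fun x => ?_⟩ <;> rw [if_neg (by omega)]
  · simp [hσ₁]
  · intro j σ' hF _
    simp only [NExpr.eval]
    rw [hF.nreg 0 rfl]
    simp [hσ₁, hn]
  · rintro j σ' hF ⟨h₁, h₂, h₃, h₄⟩ hj hjm
    have h0 : σ'.nreg 0 = n := by rw [hF.nreg 0 rfl]; simp [hσ₁, hn]
    apply wp_seq; apply wp_ite <;> intro ha
    · apply wp_skip; apply wp_ite <;> intro hb
      · apply wp_skip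
        simp only [Test.Holds, NExpr.eval, hj, h0] at ha hb
        refine ⟨by simp [Test.cost, NExpr.cost], hj, by omega, fun y => ?_, fun x => ?_,
          fun x => ?_⟩
        · simp only [h₂]; congr 1; simp only [eq_iff_iff]; omega
        · simp only [h₃]; congr 1; simp only [eq_iff_iff]; omega
        · simp only [h₄]; congr 1; simp only [eq_iff_iff]; omega
      · simp only [Test.Holds, NExpr.eval, hj, h0] at ha hb
        omega
    · apply wp_seq; apply wp_nput; apply wp_nput
      simp only [Test.Holds, NExpr.eval, hj, h0] at ha
      apply wp_gen
      intro σ₂ hσ₂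
      simp only [NExpr.eval, hj] at hσ₂
      apply wp_ite <;> intro hb
      · apply wp_skip
        simp only [Test.Holds, NExpr.eval, hσ₂, hj, h0] at hb
        refine ⟨by simp [Test.cost, NExpr.cost], by simp [hσ₂, hj], by omega, fun y => ?_,
          fun x => ?_, fun x => ?_⟩
        · simp only [hσ₂, Function.update_self, ne_eq, Nat.reduceEqDiff, not_false_eq_true,
            Function.update_of_ne]
          rw [Function.update_apply, h₂]
          split_ifs <;> omega
        · simp only [hσ₂, Function.update_self, ne_eq, Nat.reduceEqDiff, not_false_eq_true,
            Function.update_of_ne]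
          rw [Function.update_apply, h₃]
          split_ifs <;> omega
        · simp only [hσ₂, ne_eq, Nat.reduceEqDiff, not_false_eq_true, Function.update_of_ne]
          rw [h₄]
          split_ifs <;> omega
      · simp only [Test.Holds, NExpr.eval, hσ₂, hj, h0] at hb
        apply wp_seq; apply wp_nput; apply wp_nput
        simp only [NExpr.eval, hσ₂, hj, Function.update_self, ne_eq, Nat.reduceEqDiff,
          not_false_eq_true, Function.update_of_ne]
        refine ⟨by simp [Test.cost, NExpr.cost], trivial, by omega, fun y => ?_,
          fun x => ?_, fun x => ?_⟩
        · rw [Function.update_apply, Function.update_apply, h₂]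
          split_ifs <;> omega
        · rw [Function.update_apply, h₃]
          split_ifs <;> omega
        · rw [Function.update_apply, h₄]
          split_ifs <;> omega
  · rintro σ' _ ⟨h₁, h₂, h₃, h₄⟩ _
    refine ⟨fun y => ?_, fun x hx hxn => ?_, fun x hx hxn => ?_⟩
    · rw [h₂]; split_ifs <;> omega
    · rw [h₃]; split_ifs <;> omega
    · rw [h₄]; split_ifs <;> omega
  · rintro τ σ' - ⟨hτ, hQ⟩
    refine ⟨?_, hQ⟩
    simp only [hσ₁, NExpr.cost, Function.update_self] at hτ ⊢
    omega

/-- Establish the static data. -/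
def setup : Prog := setupAdj ;; setupTree

theorem wp_setup (N : Network) (k : ℕ) : WP setup (inputStore N k) fun τ σ' =>
    τ ≤ N.m * 30 + N.n * 60 + 40 ∧ Ready N k σ' := by
  apply WP.mono (Q := fun τ σ' => τ ≤ N.m * 30 + N.n * 60 + 40 ∧
    (∀ v : Fin N.n, ∃ l : List (Fin N.m), l.Nodup ∧
      (∀ e, e ∈ l ↔ N.head e = v) ∧ Linked (σ'.narr 3) (σ'.narr 2 v) l) ∧
    (∀ y, σ'.narr 4 y = if 2 ≤ y ∧ y ≤ N.n then y / 2 else 0) ∧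
    (∀ x, 1 ≤ x → x ≤ N.n → σ'.narr 5 x = if x + x ≤ N.n then x + x else 0) ∧
    (∀ x, 1 ≤ x → x ≤ N.n → σ'.narr 6 x = if x + x + 1 ≤ N.n then x + x + 1 else 0))
  · apply wp_seq
    refine (wp_setupAdj (N := N) rfl (fun e => by simp [inputStore]) (fun i => ?_)).mono ?_
    · simp [inputStore]
    rintro τ₁ σ₁ hF₁ ⟨hτ₁, h₁⟩
    have hz : ∀ a, 4 ≤ a → setupAdj.wNA a = false → ∀ i, σ₁.narr a i = 0 := by
      intro a ha hw i
      rw [hF₁.narr a hw]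
      simp only [inputStore]
      split_ifs
      · obtain ⟨c, rfl⟩ := Nat.exists_eq_add_of_le' ha
        rfl
      · rfl
    refine (wp_setupTree N.n (by rw [hF₁.nreg 0 rfl]; rfl) (hz 4 (by norm_num) rfl)
      (hz 5 (by norm_num) rfl) (hz 6 (by norm_num) rfl)).mono ?_
    rintro τ₂ σ₂ hF₂ ⟨hτ₂, h₂⟩
    refine ⟨by omega, ?_, h₂⟩
    rw [hF₂.narr 3 rfl, hF₂.narr 2 rfl]
    exact h₁
  · rintro τ σ' hF ⟨hτ, hadj, h4, h5, h6⟩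
    refine ⟨hτ, ?_, ?_, ?_, ?_, ?_, ?_, ?_, ?_, hadj, ?_, ?_⟩
    · rw [hF.nreg 0 rfl]; rfl
    · rw [hF.nreg 1 rfl]; rfl
    · rw [hF.nreg 2 rfl]; rfl
    · rw [hF.nreg 3 rfl]; rfl
    · rw [hF.nreg 4 rfl]; rfl
    · rw [hF.narr 0 rfl]; intro e; simp [inputStore]
    · rw [hF.narr 1 rfl]; intro e; simp [inputStore]
    · rw [hF.rarr 0 rfl]; intro e; simp [inputStore]
    · intro T hp hl hr hb
      refine ⟨by rw [hp, h4]; simp, by rw [hp, h4]; simp, ?_, ?_, ?_, hb⟩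
      · intro y hy hyn
        rw [hp, hl, hr, h4, if_pos ⟨hy, hyn⟩, h5 _ (by omega) (by omega), h6 _ (by omega) (by omega)]
        refine ⟨by omega, by omega, ?_⟩
        split_ifs <;> omega
      · intro x hx hxn
        rw [hp, hl, h5 x hx hxn, h4]
        split_ifs <;> omega
      · intro x hx hxn
        rw [hp, hr, h6 x hx hxn, h4]
        split_ifs <;> omega
    · have key : ∀ d x, x ≤ N.n → x < 2 ^ d → (σ'.narr 4)^[d] x = 0 := by
        intro d
        induction d with
        | zero => intro x _ hx; simpa using hx
        | succ d ih =>
          intro x hxn hx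
          rw [Function.iterate_succ_apply, h4]
          rw [pow_succ] at hx
          split_ifs
          · exact ih _ (by omega) (by omega)
          · exact ih _ (by omega) (by positivity)
      intro x hx
      exact key _ x hx (hx.trans_lt (Nat.lt_pow_succ_log_self (by norm_num) _))

end KSSP

namespace KSSP
namespace Network

/-! ### Sidetrack sequences -/

variable {N : Network} {T₀ : N.Tree}

/-- The part of the represented path up to and including the last sidetrack. -/
def pre (T₀ : N.Tree) : N.Seq → List (Fin N.m)
  | [] => []
  | (e, _) :: q => trunk T₀ q (N.tail e) ++ [e]

/-- The nodes up to the tail of the last sidetrack. -/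
def devNodes (T₀ : N.Tree) : N.Seq → Set (Fin N.n)
  | [] => ∅
  | (e, _) :: q => prefixNodes T₀ q e

theorem trunk_eq (q : N.Seq) (u : Fin N.n) :
    trunk T₀ q u = pre T₀ q ++ follow (lastTree T₀ q) u N.n (suffixStart q) := by
  rcases q with _ | ⟨⟨e, T⟩, q⟩ <;> simp [trunk, pre, lastTree, suffixStart]

theorem path_eq (q : N.Seq) : path T₀ q = pre T₀ q ++ suffix T₀ q := trunk_eq q N.t

/-- The sequences that occur in the queue: the last tree is a shortest path tree that contains
the head of the last sidetrack, and the nodes up to the tail of the last sidetrack are distinct. -/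
structure Good (T₀ : N.Tree) (q : N.Seq) : Prop where
  spTree : ∃ X, IsSPTree X (lastTree T₀ q) ∧ N.t ∉ X
  inTree : InTree (lastTree T₀ q) (suffixStart q)
  pre : ∀ e T q', q = (e, T) :: q' → N.IsPath N.s (N.tail e) (trunk T₀ q' (N.tail e)) ∧
    (N.nodes N.s (trunk T₀ q' (N.tail e))).Nodup ∧ N.t ∉ prefixNodes T₀ q' e

variable {q : N.Seq}

theorem Good.nil (h : IsSPTree ∅ T₀) (hN : N.IsConnected) : Good T₀ [] := by
  refine ⟨⟨∅, h, by simp⟩, ?_, by simp⟩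
  obtain ⟨p, hp⟩ := (hN N.s).2
  obtain ⟨p', hp', -⟩ := (h.2 N.s).1 ⟨p, hp, by simp⟩
  exact ⟨p', hp'⟩

theorem Good.root (h : Good T₀ q) : lastTree T₀ q N.t = none := by
  obtain ⟨X, hX, -⟩ := h.spTree
  exact hX.1

theorem Good.suffix (h : Good T₀ q) :
    IsTreePath (lastTree T₀ q) (suffixStart q) (suffix T₀ q) := by
  obtain ⟨p, hp⟩ := h.inTree
  have := hp.follow_eq h.root
  rw [Network.suffix, this]
  exact hp

theorem Good.isPath_pre (h : Good T₀ q) : N.IsPath N.s (suffixStart q) (Network.pre T₀ q) := by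
  rcases q with _ | ⟨⟨e, T⟩, q⟩
  · rfl
  · exact isPath_append.2 ⟨_, (h.pre _ _ _ rfl).1, rfl, rfl⟩

theorem Good.isPath (h : Good T₀ q) : N.IsPath N.s N.t (path T₀ q) := by
  rw [path_eq]
  exact isPath_append.2 ⟨_, h.isPath_pre, h.suffix.1⟩

theorem Good.length_pre_le (h : Good T₀ q) : (Network.pre T₀ q).length ≤ N.n := by
  rcases q with _ | ⟨⟨e, T⟩, q⟩
  · simp [Network.pre]
  · have := length_lt_of_nodup (h.pre _ _ _ rfl).2.1
    simp [Network.pre]; omega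

theorem Good.length_path_le (h : Good T₀ q) : (path T₀ q).length ≤ 2 * N.n := by
  have h₁ := h.length_pre_le
  have h₂ := h.suffix.length_lt h.root
  rw [path_eq, List.length_append]
  omega

/-- With a shortest path tree that avoids the prefix, the path becomes simple. -/
theorem Good.repaired {e : Fin N.m} {T T' : N.Tree} (h : Good T₀ ((e, T') :: q))
    (hT : IsSPTree (prefixNodes T₀ q e) T) (hi : InTree T (N.head e)) :
    Good T₀ ((e, T) :: q) ∧ N.IsSimple N.s (path T₀ ((e, T) :: q)) := by
  obtain ⟨h₁, h₂, h₃⟩ := h.pre _ _ _ rfl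
  have hg : Good T₀ ((e, T) :: q) := by
    refine ⟨⟨_, hT, h₃⟩, hi, ?_⟩
    rintro _ _ _ ⟨⟩
    exact ⟨h₁, h₂, h₃⟩
  refine ⟨hg, ?_⟩
  have hs := hg.suffix
  have hav := hT.avoiding h₃ hs
  rw [IsSimple, path_eq, nodes_append hg.isPath_pre, List.nodup_append]
  have hpre : (Network.pre T₀ ((e, T) :: q)).map N.tail =
      N.nodes N.s (trunk T₀ q (N.tail e)) := by
    rw [nodes_eq h₁]; simp [Network.pre]
  rw [hpre]
  refine ⟨h₂, hs.nodup hT.1, ?_⟩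
  rintro a ha b hb rfl
  exact hav.2 a hb ha

theorem Good.isExtension_iff (h : Good T₀ q) (e : Fin N.m) :
    IsExtension T₀ q e ↔
      N.tail e ∈ ((path T₀ q).drop (Network.pre T₀ q).length).map N.tail ∧
      lastTree T₀ q (N.tail e) ≠ some e ∧
      (N.head e = N.t ∨ lastTree T₀ q (N.head e) ≠ none) := by
  obtain ⟨X, hX, htX⟩ := h.spTree
  have hn := h.suffix.nodup h.root
  rw [IsExtension, hX.inTree_iff htX, path_eq, List.drop_left, nodes_eq h.suffix.1]
  rw [nodes_eq h.suffix.1, List.nodup_append] at hn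
  have : N.tail e ∈ (Network.suffix T₀ q).map N.tail → N.tail e ≠ N.t := fun h₁ h₂ =>
    hn.2.2 _ h₁ N.t (by simp) h₂
  simp only [List.mem_append, List.mem_singleton]
  tauto

/-- The prefix of a simple path up to the node before its edge with the index `i`. -/
theorem Good.take (h : Good T₀ q) (hs : N.IsSimple N.s (path T₀ q)) {i : ℕ}
    (hi : i < (path T₀ q).length) :
    N.IsPath N.s (N.tail (path T₀ q)[i]) ((path T₀ q).take i) ∧
      N.nodes N.s ((path T₀ q).take i) = ((path T₀ q).take (i + 1)).map N.tail ∧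
      (((path T₀ q).take (i + 1)).map N.tail).Nodup ∧
      N.t ∉ ((path T₀ q).take (i + 1)).map N.tail := by
  have hp := h.isPath
  have h₁ : N.IsPath N.s (N.tail (path T₀ q)[i]) ((path T₀ q).take i) := by
    rw [← List.take_append_drop i (path T₀ q), isPath_append,
      List.drop_eq_getElem_cons hi] at hp
    obtain ⟨u, h₂, h₃, -⟩ := hp
    rwa [h₃]
  rw [IsSimple, nodes_eq hp, List.nodup_append] at hs
  refine ⟨h₁, ?_, ?_, ?_⟩
  · rw [nodes_eq h₁, List.take_succ_eq_append_getElem hi, List.map_append]; rfl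
  · rw [List.map_take]
    exact hs.1.sublist (List.take_sublist _ _)
  · intro ht
    rw [List.map_take] at ht
    exact hs.2.2 _ (List.mem_of_mem_take ht) N.t (by simp) rfl

/-- The extension of a simple path by the sidetrack `e`. -/
theorem Good.extend (h : Good T₀ q) (hs : N.IsSimple N.s (path T₀ q)) {i : ℕ}
    (hi : i < (path T₀ q).length) (hpi : (Network.pre T₀ q).length ≤ i) {e : Fin N.m}
    (he : N.tail e = N.tail (path T₀ q)[i]) (hT : InTree (lastTree T₀ q) (N.head e)) :
    trunk T₀ q (N.tail e) = (path T₀ q).take i ∧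
      prefixNodes T₀ q e = {u | u ∈ ((path T₀ q).take (i + 1)).map N.tail} ∧
      Good T₀ ((e, lastTree T₀ q) :: q) ∧
      path T₀ ((e, lastTree T₀ q) :: q) = (path T₀ q).take i ++ e ::
        follow (lastTree T₀ q) N.t N.n (N.head e) := by
  obtain ⟨h₁, h₂, h₃, h₄⟩ := h.take hs hi
  have ht : trunk T₀ q (N.tail e) = (path T₀ q).take i := by
    obtain ⟨j, rfl⟩ := Nat.exists_eq_add_of_le hpi
    have h₅ : (path T₀ q).take ((Network.pre T₀ q).length + j) =
        Network.pre T₀ q ++ (Network.suffix T₀ q).take j := by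
      rw [path_eq, List.take_length_add_append]
    have hsuf := h.suffix
    rw [← List.take_append_drop j (Network.suffix T₀ q)] at hsuf
    rw [trunk_eq, h₅]
    congr 1
    refine Network.follow_eq h.root hsuf ?_ _ ?_
    · rw [h₅, isPath_append, ← he] at h₁
      obtain ⟨u, h₆, h₇⟩ := h₁
      have : u = suffixStart q := by
        have h₈ := nodes_eq h₆
        rw [nodes_eq h.isPath_pre] at h₈
        simpa using h₈.symm
      rwa [← this]
    · have := h.suffix.length_lt h.root
      rw [List.length_take]; omega
  have hp : prefixNodes T₀ q e = {u | u ∈ ((path T₀ q).take (i + 1)).map N.tail} := by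
    rw [prefixNodes, ht, h₂]
  refine ⟨ht, hp, ⟨h.spTree, hT, ?_⟩, ?_⟩
  · rintro _ _ _ ⟨⟩
    rw [ht, he, h₂, hp]
    exact ⟨h₁, h₃, h₄⟩
  · rw [path, trunk, ht]

theorem devNodes_eq (h : Good T₀ q) :
    devNodes T₀ q = {u | u ∈ (Network.pre T₀ q).map N.tail} := by
  rcases q with _ | ⟨⟨e, T⟩, q⟩
  · simp [devNodes, Network.pre]
  · rw [devNodes, prefixNodes, nodes_eq (h.pre _ _ _ rfl).1]
    simp [Network.pre]

end Network
end KSSP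

namespace KSSP

open Network

variable {N : Network} {k : ℕ} {σ σ' : Store}

/-! ### Storing, checking, and writing paths -/

/-- The array `f` contains the edges of the path `p`, from the address `b`. -/
def PathAt {m : ℕ} (f : ℕ → ℕ) (b : ℕ) (p : List (Fin m)) : Prop :=
  ∀ i (h : i < p.length), f (b + i) = p[i]

theorem PathAt.map_range {m : ℕ} {f : ℕ → ℕ} {b : ℕ} {p : List (Fin m)} (h : PathAt f b p) :
    (List.range p.length).map (fun i => f (b + i)) = p.map fun e : Fin m => (e : ℕ) := by
  apply List.ext_getElem
  · simp
  · intro i h₁ h₂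
    simp at h₁ h₂
    simp [h i h₁]

theorem PathAt.take {m : ℕ} {f : ℕ → ℕ} {b : ℕ} {p : List (Fin m)} (h : PathAt f b p) (i : ℕ) :
    PathAt f b (p.take i) := by
  intro j hj
  rw [List.length_take] at hj
  rw [List.getElem_take]
  exact h j (by omega)

theorem PathAt.append {m : ℕ} {f : ℕ → ℕ} {b : ℕ} {p q : List (Fin m)} (h : PathAt f b p)
    (h' : PathAt f (b + p.length) q) : PathAt f b (p ++ q) := by
  intro j hj
  rw [List.getElem_append]
  split_ifs with h₁
  · exact h j h₁
  · rw [List.length_append] at hj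
    rw [← h' (j - p.length) (by omega)]
    congr 1; omega

theorem TreeAt.map_range {f : ℕ → ℕ} {b : ℕ} {T : N.Tree} (h : TreeAt f b T) :
    (List.range N.n).map (fun i => f (b + i)) = encodeTree T := by
  apply List.ext_getElem
  · simp [encodeTree]
  · intro i h₁ h₂
    simp only [List.length_map, List.length_range] at h₁
    have := h ⟨i, h₁⟩
    simp only at this
    simp only [List.getElem_map, List.getElem_range, this, encodeTree, List.getElem_finRange]
    cases hT : T ⟨i, h₁⟩ <;> simp [enc, hT]

/-- The paths in the array `17` have been extended by `p`; the first free address is in the number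
register `20`, and the real register `0` adds up the weights. -/
structure Appended (p : List (Fin N.m)) (σ σ' : Store) : Prop where
  top : σ'.nreg 20 = σ.nreg 20 + p.length
  path : PathAt (σ'.narr 17) (σ.nreg 20) p
  low : ∀ i < σ.nreg 20, σ'.narr 17 i = σ.narr 17 i
  acc : σ'.rreg 0 = σ.rreg 0 + N.length p

theorem Appended.nil (h₁ : σ'.nreg 20 = σ.nreg 20) (h₂ : σ'.narr 17 = σ.narr 17)
    (h₃ : σ'.rreg 0 = σ.rreg 0) : Appended (N := N) [] σ σ' :=
  ⟨by simpa using h₁, by simp [PathAt], fun i _ => by rw [h₂], by simp [length, h₃]⟩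

theorem Appended.trans {p q : List (Fin N.m)} {σ'' : Store} (h : Appended p σ σ')
    (h' : Appended q σ' σ'') : Appended (p ++ q) σ σ'' := by
  refine ⟨by rw [h'.top, h.top, List.length_append, add_assoc], PathAt.append ?_ ?_, ?_, ?_⟩
  · intro i hi
    rw [h'.low _ (by rw [h.top]; omega), h.path i hi]
  · have := h'.path; rwa [h.top] at this
  · intro i hi
    rw [h'.low _ (by rw [h.top]; omega), h.low i hi]
  · rw [h'.acc, h.acc, length_append, NNReal.coe_add, add_assoc]

/-- Only the path log matters. -/
theorem Appended.congr {p : List (Fin N.m)} {σ₁ σ₁' : Store} (h : Appended p σ σ')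
    (h₁ : σ₁.nreg 20 = σ.nreg 20) (h₂ : σ₁.narr 17 = σ.narr 17) (h₃ : σ₁.rreg 0 = σ.rreg 0)
    (h₄ : σ₁'.nreg 20 = σ'.nreg 20) (h₅ : σ₁'.narr 17 = σ'.narr 17)
    (h₆ : σ₁'.rreg 0 = σ'.rreg 0) : Appended p σ₁ σ₁' := by
  refine ⟨?_, ?_, ?_, ?_⟩
  · rw [h₄, h₁, h.top]
  · rw [h₅, h₁]; exact h.path
  · rw [h₅, h₁, h₂]; exact h.low
  · rw [h₆, h₃, h.acc]

/-- Append the edge in the number register `17`. -/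
def appendEdge : Prog :=
  .nput 17 (.reg 20) (.reg 17) ;; .nset 20 (.add (.reg 20) (.lit 1)) ;;
  .rset 0 (.add (.reg 0) (.get 0 (.reg 17)))

theorem wp_appendEdge (hr : Ready N k σ) {e : Fin N.m} (he : σ.nreg 17 = e) :
    WP appendEdge σ fun τ σ' => τ ≤ 12 ∧ Appended [e] σ σ' := by
  apply wp_seq; apply wp_nput; apply wp_seq; apply wp_nset; apply wp_rset
  refine ⟨by simp [NExpr.cost, RExpr.cost], ?_, ?_, ?_, ?_⟩
  · simp [NExpr.eval]
  · intro i hi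
    simp only [List.length_singleton, Nat.lt_one_iff] at hi
    subst hi
    simp [NExpr.eval, he]
  · intro i hi
    simp only [NExpr.eval, Function.update_self]
    rw [Function.update_of_ne (by omega)]
  · have := hr.weight e
    simp [NExpr.eval, RExpr.eval, he, this, length]

/-- Append a copy of the part of the array `17` that starts in the address in the register `14`
and whose length is in the register `15`. -/
def copyPart : Prog :=
  .nset 16 (.lit 0) ;;
  .loop (.nlt (.reg 16) (.reg 15))
    ((.nset 17 (.get 17 (.add (.reg 14) (.reg 16))) ;; appendEdge) ;;
     .nset 16 (.add (.reg 16) (.lit 1)))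

theorem wp_copyPart (hr : Ready N k σ) {p : List (Fin N.m)}
    (hp : PathAt (σ.narr 17) (σ.nreg 14) p) (hl : σ.nreg 15 = p.length)
    (ht : σ.nreg 14 + σ.nreg 15 ≤ σ.nreg 20) :
    WP copyPart σ fun τ σ' => τ ≤ p.length * 30 + 10 ∧ Appended p σ σ' := by
  apply wp_seq; apply wp_nset
  apply wp_gen
  intro σ₁ hσ₁
  simp only [NExpr.eval] at hσ₁
  refine (wp_for (fun j σ' => Appended (p.take j) σ σ') (Q := fun σ' => Appended p σ σ')
    p.length 20 ?_ ?_ ?_ ?_ ?_).mono ?_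
  · simp only [hσ₁, Function.update_self, List.take_zero]
    exact Appended.nil (by simp) rfl rfl
  · simp [hσ₁]
  · intro j σ' hF _
    simp only [NExpr.eval]
    rw [hF.nreg 15 rfl]
    simp [hσ₁, hl]
  · intro j σ' hF hA hj hjp
    have hr' : Ready N k σ' := by
      refine Ready.of_fr (σ := σ₁) ?_ hF (by decide) (by decide) (by decide)
      refine hr.congr ?_ ?_ ?_
      · intro x hx; interval_cases x <;> simp [hσ₁]
      · intro x hx; simp [hσ₁]
      · simp [hσ₁]
    have h14 : σ'.nreg 14 = σ.nreg 14 := by rw [hF.nreg 14 rfl]; simp [hσ₁]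
    have hpj := hp j hjp
    apply wp_seq; apply wp_nset
    apply wp_gen
    intro σ₂ hσ₂
    simp only [NExpr.eval, h14, hj, hA.low _ (show σ.nreg 14 + j < σ.nreg 20 by omega), hpj]
      at hσ₂
    have hr₂ : Ready N k σ₂ := by
      refine hr'.congr ?_ ?_ ?_
      · intro x hx; interval_cases x <;> simp [hσ₂]
      · intro x hx; simp [hσ₂]
      · simp [hσ₂]
    refine (wp_appendEdge hr₂ (e := p[j]) (by simp [hσ₂])).mono ?_
    rintro τ σ₃ hF₃ ⟨hτ, hA₃⟩
    refine ⟨by simp [NExpr.cost]; omega, by rw [hF₃.nreg 16 rfl]; simp [hσ₂, hj], ?_⟩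
    rw [List.take_succ_eq_append_getElem hjp]
    refine hA.trans (hA₃.congr ?_ ?_ ?_ ?_ ?_ ?_) <;> simp [hσ₂]
  · intro σ' _ h _
    simpa using h
  · rintro τ σ' - ⟨hτ, hA⟩
    refine ⟨?_, hA⟩
    simp only [hσ₁, NExpr.cost, Function.update_self] at hτ ⊢
    omega

/-- Append the path from the node in the register `18` along the tree at the address in the
register `19`. -/
def followPart : Prog :=
  .loop (.not (.neq (.get 16 (.add (.reg 19) (.reg 18))) (.lit 0)))
    (.nset 17 (.sub (.get 16 (.add (.reg 19) (.reg 18))) (.lit 1)) ;; appendEdge ;;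
     .nset 18 (.get 1 (.reg 17)))

theorem wp_followPart (hr : Ready N k σ) {T : N.Tree} (hT : TreeAt (σ.narr 16) (σ.nreg 19) T)
    (ht : T N.t = none) {v : Fin N.n} {p : List (Fin N.m)} (hp : IsTreePath T v p)
    (hv : σ.nreg 18 = v) :
    WP followPart σ fun τ σ' => τ ≤ p.length * 40 + 20 ∧ Appended p σ σ' := by
  refine wp_loop (fun c σ' => ∃ p₁ p₂ v, p = p₁ ++ p₂ ∧ IsTreePath T v p₂ ∧ σ'.nreg 18 = v ∧
    Appended p₁ σ σ' ∧ c = p₂.length * 40 + 20) _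
    ⟨[], p, v, rfl, hp, hv, Appended.nil rfl rfl rfl, rfl⟩ ?_ ?_
  · rintro c σ' hF ⟨p₁, p₂, v, rfl, hp₂, hv', hA, rfl⟩ hb
    have hr' : Ready N k σ' := hr.of_fr hF (by decide) (by decide) (by decide)
    have h16 : σ'.narr 16 = σ.narr 16 := hF.narr 16 rfl
    have h19 : σ'.nreg 19 = σ.nreg 19 := hF.nreg 19 rfl
    simp only [Test.Holds, NExpr.eval, h16, h19, hv', hT v] at hb
    cases p₂ with
    | nil =>
      rw [isTreePath_nil] at hp₂
      subst hp₂
      simp [ht, enc] at hb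
    | cons e p₂ =>
      rw [isTreePath_cons] at hp₂
      obtain ⟨-, hTe, hp₂⟩ := hp₂
      apply wp_seq; apply wp_nset; apply wp_seq
      apply wp_gen
      intro σ₂ hσ₂
      simp only [NExpr.eval, h16, h19, hv', hT v, hTe, enc, Nat.add_sub_cancel] at hσ₂
      have hr₂ : Ready N k σ₂ := by
        refine hr'.congr ?_ ?_ ?_
        · intro x hx; interval_cases x <;> simp [hσ₂]
        · intro x hx; simp [hσ₂]
        · simp [hσ₂]
      refine (wp_appendEdge hr₂ (e := e) (by simp [hσ₂])).mono ?_
      rintro τ σ₃ hF₃ ⟨hτ, hA₃⟩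
      have h17 : σ₃.nreg 17 = e := by rw [hF₃.nreg 17 rfl]; simp [hσ₂]
      have h1 : σ₃.narr 1 e = N.head e :=
        (hr₂.of_fr hF₃ (by decide) (by decide) (by decide)).head e
      apply wp_nset
      refine ⟨p₂.length * 40 + 20, ?_, p₁ ++ [e], p₂, N.head e, by simp, hp₂, ?_, ?_, rfl⟩
      · simp only [Test.cost, NExpr.cost, List.length_cons]; omega
      · simp [NExpr.eval, h17, h1]
      · refine hA.trans (hA₃.congr ?_ ?_ ?_ ?_ ?_ ?_) <;> simp [hσ₂]
  · rintro c σ' hF ⟨p₁, p₂, v, rfl, hp₂, hv', hA, rfl⟩ hb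
    have h16 : σ'.narr 16 = σ.narr 16 := hF.narr 16 rfl
    have h19 : σ'.nreg 19 = σ.nreg 19 := hF.nreg 19 rfl
    simp only [Test.Holds, NExpr.eval, h16, h19, hv', hT v, not_not] at hb
    cases p₂ with
    | nil => exact ⟨by simp [Test.cost, NExpr.cost], by simpa using hA⟩
    | cons e p₂ => simp [(isTreePath_cons.1 hp₂).2.1, enc] at hb

/-- Append a copy of a part of the array `17`, then the edge in the register `31`, then the path
from its head along the tree at the address in the register `19`. The real register `0` is set to
the length of the new path. -/
def makePath : Prog :=
  .rset 0 .zero ;; copyPart ;; .nset 17 (.reg 31) ;; appendEdge ;; .nset 18 (.get 1 (.reg 31)) ;;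
  followPart

theorem wp_makePath (hr : Ready N k σ) {p : List (Fin N.m)}
    (hp : PathAt (σ.narr 17) (σ.nreg 14) p) (hl : σ.nreg 15 = p.length)
    (htop : σ.nreg 14 + σ.nreg 15 ≤ σ.nreg 20) {e : Fin N.m} (he : σ.nreg 31 = e) {T : N.Tree}
    (hT : TreeAt (σ.narr 16) (σ.nreg 19) T) (ht : T N.t = none) {p' : List (Fin N.m)}
    (hp' : IsTreePath T (N.head e) p') :
    WP makePath σ fun τ σ' => τ ≤ (p.length + p'.length) * 40 + 60 ∧
      σ'.nreg 20 = σ.nreg 20 + (p ++ e :: p').length ∧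
      PathAt (σ'.narr 17) (σ.nreg 20) (p ++ e :: p') ∧
      (∀ i < σ.nreg 20, σ'.narr 17 i = σ.narr 17 i) ∧
      σ'.rreg 0 = N.length (p ++ e :: p') := by
  apply wp_seq; apply wp_rset; apply wp_seq
  apply wp_gen
  intro σ₁ hσ₁
  simp only [RExpr.eval] at hσ₁
  have hr₁ : Ready N k σ₁ := by
    refine hr.congr ?_ ?_ ?_ <;> simp [hσ₁]
  refine (wp_copyPart hr₁ (p := p) (by simpa [hσ₁] using hp) (by simpa [hσ₁] using hl)
    (by simpa [hσ₁] using htop)).mono ?_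
  rintro τ₂ σ₂ hF₂ ⟨hτ₂, hA₂⟩
  have hr₂ : Ready N k σ₂ := hr₁.of_fr hF₂ (by decide) (by decide) (by decide)
  apply wp_seq; apply wp_nset; apply wp_seq
  apply wp_gen
  intro σ₃ hσ₃
  have h31 : σ₂.nreg 31 = e := by rw [hF₂.nreg 31 rfl]; simp [hσ₁, he]
  simp only [NExpr.eval, h31] at hσ₃
  have hr₃ : Ready N k σ₃ := by
    refine hr₂.congr ?_ ?_ ?_
    · intro x hx; interval_cases x <;> simp [hσ₃]
    · intro x hx; simp [hσ₃]
    · simp [hσ₃]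
  refine (wp_appendEdge hr₃ (e := e) (by simp [hσ₃])).mono ?_
  rintro τ₄ σ₄ hF₄ ⟨hτ₄, hA₄⟩
  have hr₄ : Ready N k σ₄ := hr₃.of_fr hF₄ (by decide) (by decide) (by decide)
  apply wp_seq; apply wp_nset
  apply wp_gen
  intro σ₅ hσ₅
  have h31' : σ₄.nreg 31 = e := by rw [hF₄.nreg 31 rfl]; simp [hσ₃, h31]
  simp only [NExpr.eval, h31', hr₄.head] at hσ₅
  have hr₅ : Ready N k σ₅ := by
    refine hr₄.congr ?_ ?_ ?_
    · intro x hx; interval_cases x <;> simp [hσ₅]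
    · intro x hx; simp [hσ₅]
    · simp [hσ₅]
  have h16 : σ₅.narr 16 = σ.narr 16 := by
    rw [hσ₅]; simp only; rw [hF₄.narr 16 rfl, hσ₃]; simp only; rw [hF₂.narr 16 rfl, hσ₁]
  have h19 : σ₅.nreg 19 = σ.nreg 19 := by
    rw [hσ₅]; simp only; rw [Function.update_of_ne (by decide), hF₄.nreg 19 rfl, hσ₃]; simp only
    rw [Function.update_of_ne (by decide), hF₂.nreg 19 rfl, hσ₁]
  refine (wp_followPart hr₅ (T := T) (by rw [h16, h19]; exact hT) ht hp' (by simp [hσ₅])).mono ?_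
  rintro τ₆ σ₆ hF₆ ⟨hτ₆, hA₆⟩
  have hA : Appended (p ++ ([e] ++ p')) σ₁ σ₆ := by
    refine hA₂.trans ((hA₄.congr (σ₁' := σ₅) ?_ ?_ ?_ ?_ ?_ ?_).trans hA₆) <;> simp [hσ₃, hσ₅]
  rw [List.singleton_append] at hA
  refine ⟨?_, ?_, ?_, ?_, ?_⟩
  · simp only [NExpr.cost, RExpr.cost]; omega
  · rw [hA.top, hσ₁]
  · have := hA.path; rwa [hσ₁] at this
  · have := hA.low; rwa [hσ₁] at this
  · rw [hA.acc, hσ₁]; simp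

/-- Write the part of the array `a` that starts in the address in the register `14` and whose
length is in the register `15`. -/
def emitRange (a : ℕ) : Prog :=
  .nset 16 (.lit 0) ;;
  .loop (.nlt (.reg 16) (.reg 15))
    (.emit (.get a (.add (.reg 14) (.reg 16))) ;; .nset 16 (.add (.reg 16) (.lit 1)))

theorem wp_emitRange (a : ℕ) : WP (emitRange a) σ fun τ σ' => τ ≤ σ.nreg 15 * 20 + 10 ∧
    σ'.out = σ.out ++ (List.range (σ.nreg 15)).map fun i => σ.narr a (σ.nreg 14 + i) := by
  apply wp_seq; apply wp_nset
  apply wp_gen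
  intro σ₁ hσ₁
  simp only [NExpr.eval] at hσ₁
  refine (wp_for (fun j σ' => σ'.out = σ.out ++ (List.range j).map fun i =>
    σ.narr a (σ.nreg 14 + i)) (Q := fun σ' => σ'.out = σ.out ++ (List.range (σ.nreg 15)).map
    fun i => σ.narr a (σ.nreg 14 + i)) (σ.nreg 15) 10 ?_ ?_ ?_ ?_ ?_).mono ?_
  · simp [hσ₁]
  · simp [hσ₁]
  · intro j σ' hF _
    simp only [NExpr.eval]
    rw [hF.nreg 15 rfl]
    simp [hσ₁]
  · intro j σ' hF hA hj _
    have h14 : σ'.nreg 14 = σ.nreg 14 := by rw [hF.nreg 14 rfl]; simp [hσ₁]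
    have ha : σ'.narr a = σ.narr a := by rw [hF.narr a rfl]; simp [hσ₁]
    apply wp_emit
    refine ⟨by simp [NExpr.cost], hj, ?_⟩
    simp [NExpr.eval, hA, h14, ha, hj, List.range_succ]
  · intro σ' _ h _
    exact h
  · rintro τ σ' - ⟨hτ, hA⟩
    refine ⟨?_, hA⟩
    simp only [hσ₁, NExpr.cost, Function.update_self] at hτ ⊢
    omega

/-- Set the first `n` cells of the array `a` to `0`. -/
def clearArr (a : ℕ) : Prog :=
  .nset 16 (.lit 0) ;;
  .loop (.nlt (.reg 16) (.reg 0))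
    (.nput a (.reg 16) (.lit 0) ;; .nset 16 (.add (.reg 16) (.lit 1)))

theorem wp_clearArr (a : ℕ) : WP (clearArr a) σ fun τ σ' => τ ≤ σ.nreg 0 * 20 + 10 ∧
    ∀ i < σ.nreg 0, σ'.narr a i = 0 := by
  apply wp_seq; apply wp_nset
  apply wp_gen
  intro σ₁ hσ₁
  simp only [NExpr.eval] at hσ₁
  refine (wp_for (fun j σ' => ∀ i < j, σ'.narr a i = 0)
    (Q := fun σ' => ∀ i < σ.nreg 0, σ'.narr a i = 0) (σ.nreg 0) 10 ?_ ?_ ?_ ?_ ?_).mono ?_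
  · simp [hσ₁]
  · simp [hσ₁]
  · intro j σ' hF _
    simp only [NExpr.eval]
    rw [hF.nreg 0 rfl]
    simp [hσ₁]
  · intro j σ' hF hA hj _
    apply wp_nput
    refine ⟨by simp [NExpr.cost], hj, fun i hi => ?_⟩
    simp only [NExpr.eval, hj, Function.update_self]
    rcases Nat.lt_succ_iff_lt_or_eq.1 hi with hi | rfl
    · rw [Function.update_of_ne (by omega), hA i hi]
    · simp
  · intro σ' _ h _
    exact h
  · rintro τ σ' - ⟨hτ, hA⟩
    refine ⟨?_, hA⟩
    simp only [hσ₁, NExpr.cost, Function.update_self] at hτ ⊢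
    omega

/-- Set the register `24` to `1` or `0`, according to whether the path that is stored from the
address in the register `14`, with the length in the register `15`, is simple. -/
def checkSimple : Prog :=
  clearArr 25 ;; .nput 25 (.reg 3) (.lit 1) ;; .nset 24 (.lit 1) ;; .nset 16 (.lit 0) ;;
  .loop (.nlt (.reg 16) (.reg 15))
    ((.nset 18 (.get 1 (.get 17 (.add (.reg 14) (.reg 16)))) ;;
      .ite (.neq (.get 25 (.reg 18)) (.lit 0)) (.nput 25 (.reg 18) (.lit 1)) (.nset 24 (.lit 0))) ;;
     .nset 16 (.add (.reg 16) (.lit 1)))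

theorem wp_checkSimple (hr : Ready N k σ) {p : List (Fin N.m)}
    (hp : PathAt (σ.narr 17) (σ.nreg 14) p) (hl : σ.nreg 15 = p.length) :
    WP checkSimple σ fun τ σ' => τ ≤ N.n * 20 + p.length * 30 + 40 ∧
      (σ'.nreg 24 = 1 ↔ N.IsSimple N.s p) := by
  apply wp_seq
  refine (wp_clearArr (σ := σ) 25).mono ?_
  rintro τ₁ σ₁ hF₁ ⟨hτ₁, hc⟩
  have hr₁ : Ready N k σ₁ := hr.of_fr hF₁ (by decide) (by decide) (by decide)
  apply wp_seq; apply wp_nput; apply wp_seq; apply wp_nset; apply wp_seq; apply wp_nset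
  apply wp_gen
  intro σ₂ hσ₂
  simp only [NExpr.eval, hr₁.s] at hσ₂
  have hr₂ : Ready N k σ₂ := by
    refine hr₁.congr ?_ ?_ ?_
    · intro x hx; interval_cases x <;> simp [hσ₂]
    · intro x hx; interval_cases x <;> simp [hσ₂]
    · simp [hσ₂]
  refine (wp_for (fun j σ' => (∀ v : Fin N.n, σ'.narr 25 v ≠ 0 ↔ v ∈ N.nodes N.s (p.take j)) ∧
    (σ'.nreg 24 = 1 ↔ (N.nodes N.s (p.take j)).Nodup))
    (Q := fun σ' => σ'.nreg 24 = 1 ↔ N.IsSimple N.s p) p.length 22 ?_ ?_ ?_ ?_ ?_).mono ?_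
  · simp only [hσ₂, Function.update_self, List.take_zero, nodes, List.map_nil]
    refine ⟨fun v => ?_, by simp⟩
    rw [Function.update_apply, List.mem_singleton, Fin.ext_iff]
    split_ifs with h
    · simp [h]
    · simp [h, hc v (by rw [hr.n]; exact v.2)]
  · simp [hσ₂]
  · intro j σ' hF _
    simp only [NExpr.eval]
    rw [hF.nreg 15 rfl]
    simp only [hσ₂]
    simp only [Function.update_of_ne, ne_eq, Nat.reduceEqDiff, not_false_eq_true]
    rw [hF₁.nreg 15 rfl, hl]
  · rintro j σ' hF ⟨hm, hs⟩ hj hjp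
    have hr' : Ready N k σ' := hr₂.of_fr hF (by decide) (by decide) (by decide)
    have h14 : σ'.nreg 14 = σ.nreg 14 := by
      rw [hF.nreg 14 rfl, ← hF₁.nreg 14 rfl]; simp [hσ₂]
    have h17 : σ'.narr 17 = σ.narr 17 := by
      rw [hF.narr 17 rfl, ← hF₁.narr 17 rfl]; simp [hσ₂]
    have hn : N.nodes N.s (p.take (j + 1)) = N.nodes N.s (p.take j) ++ [N.head p[j]] := by
      rw [List.take_succ_eq_append_getElem hjp, nodes, nodes, List.map_append]; rfl
    apply wp_seq; apply wp_nset
    have hpj := hp j hjp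
    apply wp_gen
    intro σ₃ hσ₃
    simp only [NExpr.eval, h14, h17, hj, hpj, hr'.head] at hσ₃
    have hv := hm (N.head p[j])
    apply wp_ite <;> intro hb
    · simp only [Test.Holds, NExpr.eval, hσ₃, Function.update_self] at hb
      have hv' : N.head p[j] ∉ N.nodes N.s (p.take j) := fun h => (hv.2 h) hb
      apply wp_nput
      simp only [NExpr.eval, hσ₃, Function.update_self]
      refine ⟨by simp [NExpr.cost, Test.cost], by simp [hj], fun v => ?_, ?_⟩
      · rw [hn, Function.update_apply, List.mem_append, List.mem_singleton, Fin.ext_iff]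
        split_ifs with h
        · simp [h]
        · simp [h, ← hm]
      · rw [hn, List.nodup_append]
        simp only [ne_eq, Nat.reduceEqDiff, not_false_eq_true, Function.update_of_ne, hs]
        constructor
        · intro h
          refine ⟨h, by simp, ?_⟩
          simp only [List.mem_singleton, forall_eq]
          rintro a ha rfl
          exact hv' ha
        · exact fun h => h.1
    · simp only [Test.Holds, NExpr.eval, hσ₃, Function.update_self] at hb
      have hv' := hv.1 hb
      apply wp_nset
      simp only [NExpr.eval, hσ₃]
      refine ⟨by simp [NExpr.cost, Test.cost], by simp [hj], fun v => ?_, ?_⟩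
      · rw [hn, hm, List.mem_append, List.mem_singleton]
        constructor
        · exact Or.inl
        · rintro (h | rfl)
          · exact h
          · exact hv'
      · rw [hn, List.nodup_append]
        simp only [ne_eq, Nat.reduceEqDiff, not_false_eq_true, Function.update_of_ne,
          Function.update_self]
        constructor
        · intro h; simp at h
        · intro h
          exact absurd rfl (h.2.2 _ hv' _ (by simp))
  · rintro σ' - ⟨-, h⟩ -
    simpa [IsSimple] using h
  · rintro τ σ' - ⟨hτ, hQ⟩
    refine ⟨?_, hQ⟩
    rw [hr.n] at hτ₁
    simp only [hσ₂, NExpr.cost, Function.update_self] at hτ ⊢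
    omega

end KSSP

namespace KSSP

open Network

variable {N : Network} {k : ℕ} {T₀ : N.Tree} {σ σ' : Store}

/-! ### The queue -/

/-- The trees and the paths that have been stored in `σ` are still stored in `σ'`. -/
structure Logs (σ σ' : Store) : Prop where
  treeTop : σ.nreg 8 ≤ σ'.nreg 8
  pathTop : σ.nreg 20 ≤ σ'.nreg 20
  tree : ∀ i < σ.nreg 8, σ'.narr 16 i = σ.narr 16 i
  path : ∀ i < σ.nreg 20, σ'.narr 17 i = σ.narr 17 i

theorem Logs.trans {σ'' : Store} (h : Logs σ σ') (h' : Logs σ' σ'') : Logs σ σ'' :=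
  ⟨h.treeTop.trans h'.treeTop, h.pathTop.trans h'.pathTop,
    fun i hi => (h'.tree i (hi.trans_le h.treeTop)).trans (h.tree i hi),
    fun i hi => (h'.path i (hi.trans_le h.pathTop)).trans (h.path i hi)⟩

theorem Logs.of_fr {P : Prog} (hF : Fr P σ σ') (h₁ : P.wN 8 = false) (h₂ : P.wN 20 = false)
    (h₃ : P.wNA 16 = false) (h₄ : P.wNA 17 = false) : Logs σ σ' :=
  ⟨(hF.nreg 8 h₁).ge, (hF.nreg 20 h₂).ge, fun i _ => by rw [hF.narr 16 h₃],
    fun i _ => by rw [hF.narr 17 h₄]⟩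

theorem TreeAt.logs {T : N.Tree} {b : ℕ} (h : TreeAt (σ.narr 16) b T) (hb : b + N.n ≤ σ.nreg 8)
    (hL : Logs σ σ') : TreeAt (σ'.narr 16) b T := fun v => by
  rw [hL.tree _ (by have := v.2; omega), h v]

/-- The record `x` represents the sequence `q`: the cells `x` of the arrays `18, …, 23` hold the
address and the number of edges of the represented path, the number of edges before the last
sidetrack, the code of the last sidetrack, the address of the last tree, and the address of the
shortest path tree that avoids the nodes up to the tail of the last sidetrack. -/
structure RecAt (T₀ : N.Tree) (σ : Store) (x : ℕ) (q : N.Seq) : Prop where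
  good : Good T₀ q
  path : PathAt (σ.narr 17) (σ.narr 18 x) (path T₀ q)
  plen : σ.narr 19 x = (Network.path T₀ q).length
  top : σ.narr 18 x + σ.narr 19 x ≤ σ.nreg 20
  key : σ.rarr 2 x = N.length (Network.path T₀ q)
  tree : TreeAt (σ.narr 16) (σ.narr 22 x) (lastTree T₀ q)
  treeTop : σ.narr 22 x + N.n ≤ σ.nreg 8
  edge : σ.narr 21 x = enc (q.head?.map Prod.fst)
  side : ∀ e T q', q = (e, T) :: q' → σ.narr 20 x = (trunk T₀ q' (N.tail e)).length ∧
    ∃ T', IsSPTree (prefixNodes T₀ q' e) T' ∧ TreeAt (σ.narr 16) (σ.narr 23 x) T' ∧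
      σ.narr 23 x + N.n ≤ σ.nreg 8

theorem RecAt.mono {x : ℕ} {q : N.Seq} (h : RecAt T₀ σ x q) (hL : Logs σ σ')
    (h₁ : ∀ a, 18 ≤ a → a ≤ 23 → σ'.narr a x = σ.narr a x) (h₂ : σ'.rarr 2 x = σ.rarr 2 x) :
    RecAt T₀ σ' x q := by
  have h18 := h₁ 18 (by norm_num) (by norm_num)
  have h19 := h₁ 19 (by norm_num) (by norm_num)
  have h20 := h₁ 20 (by norm_num) (by norm_num)
  have h21 := h₁ 21 (by norm_num) (by norm_num)
  have h22 := h₁ 22 (by norm_num) (by norm_num)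
  have h23 := h₁ 23 (by norm_num) (by norm_num)
  refine ⟨h.good, ?_, by rw [h19, h.plen], ?_, by rw [h₂, h.key], ?_, ?_, by rw [h21, h.edge], ?_⟩
  · intro i hi
    have := h.top
    rw [h.plen] at this
    rw [h18, hL.path _ (by omega), h.path i hi]
  · rw [h18, h19]; exact h.top.trans hL.pathTop
  · rw [h22]; exact h.tree.logs h.treeTop hL
  · rw [h22]; exact h.treeTop.trans hL.treeTop
  · intro e T q' hq
    obtain ⟨h₃, T', h₄, h₅, h₆⟩ := h.side e T q' hq
    rw [h20, h23]
    exact ⟨h₃, T', h₄, h₅.logs h₆ hL, h₆.trans hL.treeTop⟩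

/-- The queue: the records in `A` are active, the record `x` represents the sequence `seq x`, and
`U` contains the records whose tree has not been replaced yet. The depth of a record in
the tournament tree is bounded by the number of edges that leave the nodes up to the tail of the
last sidetrack. -/
structure QInv (N : Network) (k : ℕ) (T₀ : N.Tree) (σ : Store) (A U : Finset ℕ)
    (seq : ℕ → N.Seq) : Prop where
  ready : Ready N k σ
  pos : 1 ≤ σ.nreg 22
  forest : (σ.tour 9 2).Forest (σ.nreg 22)
  ok : (σ.tour 9 2).AllOK (σ.nreg 22)
  mem : ∀ x ∈ A, 1 ≤ x ∧ x ≤ σ.nreg 22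
  act : ∀ x, 1 ≤ x → x ≤ σ.nreg 22 → (σ.narr 12 x ≠ 0 ↔ x ∈ A)
  leaf : ∀ x ∈ A, σ.narr 10 x = 0
  record : ∀ x ∈ A, RecAt T₀ σ x (seq x)
  dep : ∀ x ∈ A, ∃ F : Finset (Fin N.m), (∀ f ∈ F, N.tail f ∈ devNodes T₀ (seq x)) ∧
    (σ.narr 9)^[F.card + 1] x = 0
  simple : ∀ x ∈ A, x ∉ U → N.IsSimple N.s (path T₀ (seq x))
  sub : U ⊆ A

theorem QInv.mono {A U : Finset ℕ} {seq : ℕ → N.Seq} (h : QInv N k T₀ σ A U seq)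
    (hr : Ready N k σ') (hL : Logs σ σ') (h₁ : σ'.nreg 22 = σ.nreg 22)
    (h₂ : ∀ a, 9 ≤ a → a ≤ 13 → σ'.narr a = σ.narr a)
    (h₃ : ∀ a, 18 ≤ a → a ≤ 23 → σ'.narr a = σ.narr a) (h₄ : σ'.rarr 2 = σ.rarr 2) :
    QInv N k T₀ σ' A U seq := by
  have ht : σ'.tour 9 2 = σ.tour 9 2 := by
    simp only [Store.tour, h₄, h₂ 9 (by norm_num) (by norm_num),
      h₂ (9 + 1) (by norm_num) (by norm_num), h₂ (9 + 2) (by norm_num) (by norm_num),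
      h₂ (9 + 3) (by norm_num) (by norm_num), h₂ (9 + 4) (by norm_num) (by norm_num)]
  refine ⟨hr, ?_, ?_, ?_, ?_, ?_, ?_, ?_, ?_, h.simple, h.sub⟩
  · rw [h₁]; exact h.pos
  · rw [h₁, ht]; exact h.forest
  · rw [h₁, ht]; exact h.ok
  · rw [h₁]; exact h.mem
  · rw [h₁, h₂ 12 (by norm_num) (by norm_num)]; exact h.act
  · rw [h₂ 10 (by norm_num) (by norm_num)]; exact h.leaf
  · intro x hx
    exact (h.record x hx).mono hL (fun a ha ha' => by rw [h₃ a ha ha']) (by rw [h₄])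
  · rw [h₂ 9 (by norm_num) (by norm_num)]; exact h.dep

/-- The program `P` contains no assignment to the data of the network, to the records, and
to the tournament tree of the queue. -/
def Prog.keepsQueue (P : Prog) : Bool :=
  ((List.range 5).all fun x => !P.wN x) && !P.wN 22 && ((List.range 7).all fun a => !P.wNA a)
    && ((List.range' 9 5).all fun a => !P.wNA a) && ((List.range' 18 6).all fun a => !P.wNA a)
    && !P.wRA 0 && !P.wRA 2

theorem RecAt.of_fr {x : ℕ} {q : N.Seq} {P : Prog} (h : RecAt T₀ σ x q) (hF : Fr P σ σ')
    (hL : Logs σ σ') (h₁ : P.keepsQueue) : RecAt T₀ σ' x q := by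
  simp only [Prog.keepsQueue, Bool.and_eq_true, List.all_eq_true, List.mem_range,
    Bool.not_eq_true', List.mem_range'_1] at h₁
  refine h.mono hL (fun a ha ha' => ?_) (by rw [hF.rarr 2 h₁.2])
  rw [hF.narr a (h₁.1.1.2 a ⟨ha, by omega⟩)]

theorem QInv.of_fr {A U : Finset ℕ} {seq : ℕ → N.Seq} {P : Prog} (h : QInv N k T₀ σ A U seq)
    (hF : Fr P σ σ') (hL : Logs σ σ') (h₁ : P.keepsQueue) : QInv N k T₀ σ' A U seq := by
  simp only [Prog.keepsQueue, Bool.and_eq_true, List.all_eq_true, List.mem_range,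
    Bool.not_eq_true', List.mem_range'_1] at h₁
  obtain ⟨⟨⟨⟨⟨⟨h₁, h₂⟩, h₃⟩, h₄⟩, h₅⟩, h₆⟩, h₇⟩ := h₁
  exact h.mono (h.ready.of_fr hF h₁ h₃ h₆) hL (hF.nreg _ h₂)
    (fun a ha ha' => hF.narr a (h₄ a ⟨ha, by omega⟩))
    (fun a ha ha' => hF.narr a (h₅ a ⟨ha, by omega⟩)) (hF.rarr 2 h₇)

theorem QInv.and_of_fr {A U : Finset ℕ} {seq : ℕ → N.Seq} {x : ℕ} {q : N.Seq} {P : Prog}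
    (h : QInv N k T₀ σ A U seq ∧ RecAt T₀ σ x q) (hF : Fr P σ σ')
    (h₁ : P.keepsQueue && !P.wN 8 && !P.wN 20 && !P.wNA 16 && !P.wNA 17) :
    QInv N k T₀ σ' A U seq ∧ RecAt T₀ σ' x q := by
  simp only [Bool.and_eq_true, Bool.not_eq_true'] at h₁
  obtain ⟨⟨⟨⟨h₁, h₂⟩, h₃⟩, h₄⟩, h₅⟩ := h₁
  have hL := Logs.of_fr hF h₂ h₃ h₄ h₅
  exact ⟨h.1.of_fr hF hL h₁, h.2.of_fr hF hL h₁⟩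

/-- The state while the extensions of the sequence `q` of the record `x` are pushed. So far the
extensions by the edges in `es` have been pushed; `R` is the rest of the queue. The new
records form a chain, which ends in the record in the register `28`. -/
structure Exp (N : Network) (k : ℕ) (T₀ : N.Tree) (q : N.Seq) (x : ℕ) (F : Finset (Fin N.m))
    (R : Multiset N.Seq) (u : ℕ) (es : List (Fin N.m)) (σ : Store) : Prop where
  inv : ∃ A U seq, QInv N k T₀ σ A U seq ∧
    A.val.map seq = R + (es.map fun e => (e, lastTree T₀ q) :: q : List N.Seq) ∧
    U.card = u + es.length
  record : RecAt T₀ σ x q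
  pos : 1 ≤ x
  le : x ≤ σ.nreg 22
  inact : σ.narr 12 x = 0
  last_pos : 1 ≤ σ.nreg 28
  last_le : σ.nreg 28 ≤ σ.nreg 22
  last_eq : σ.nreg 28 = x → σ.narr 10 (σ.nreg 28) = 0
  last_ne : σ.nreg 28 ≠ x → σ.narr 11 (σ.nreg 28) = 0
  depth : (σ.narr 9)^[F.card + es.length + 1] (σ.nreg 28) = 0
  count : σ.nreg 29 = es.length
  ext : PathAt (σ.narr 24) 0 es
  nodup : es.Nodup
  mem : ∀ e ∈ es, IsExtension T₀ q e
  rx : σ.nreg 23 = x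
  rpath : σ.nreg 33 = σ.narr 18 x
  rlen : σ.nreg 34 = σ.narr 19 x
  rtree : σ.nreg 19 = σ.narr 22 x

theorem Exp.of_fr {q : N.Seq} {x : ℕ} {F : Finset (Fin N.m)} {R : Multiset N.Seq} {u : ℕ}
    {es : List (Fin N.m)} {P : Prog} (h : Exp N k T₀ q x F R u es σ) (hF : Fr P σ σ')
    (hL : Logs σ σ')
    (h₁ : P.keepsQueue)
    (h₂ : !P.wN 28 && !P.wN 29 && !P.wN 23 && !P.wN 33 && !P.wN 34 && !P.wN 19 && !P.wNA 24) :
    Exp N k T₀ q x F R u es σ' := by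
  obtain ⟨A, U, seq, hA, hA'⟩ := h.inv
  have hQ := hA.of_fr hF hL h₁
  simp only [Prog.keepsQueue, Bool.and_eq_true, List.all_eq_true, List.mem_range,
    Bool.not_eq_true', List.mem_range'_1] at h₁ h₂
  obtain ⟨⟨⟨⟨⟨⟨h28, h29⟩, h23⟩, h33⟩, h34⟩, h19⟩, h24⟩ := h₂
  obtain ⟨⟨⟨⟨⟨⟨-, h₂⟩, -⟩, h₄⟩, h₅⟩, -⟩, h₇⟩ := h₁
  have e9 := hF.narr 9 (h₄ 9 (by norm_num))
  have e10 := hF.narr 10 (h₄ 10 (by norm_num))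
  have e11 := hF.narr 11 (h₄ 11 (by norm_num))
  have e12 := hF.narr 12 (h₄ 12 (by norm_num))
  have e18 := hF.narr 18 (h₅ 18 (by norm_num))
  have e19 := hF.narr 19 (h₅ 19 (by norm_num))
  have e22 := hF.narr 22 (h₅ 22 (by norm_num))
  have r22 := hF.nreg 22 h₂
  have r28 := hF.nreg 28 h28
  refine ⟨⟨A, U, seq, hQ, hA'⟩, h.record.mono hL (fun a ha ha' => ?_) (by rw [hF.rarr 2 h₇]), h.pos,
    by rw [r22]; exact h.le, by rw [e12]; exact h.inact, by rw [r28]; exact h.last_pos,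
    by rw [r28, r22]; exact h.last_le, by rw [r28, e10]; exact h.last_eq,
    by rw [r28, e11]; exact h.last_ne, by rw [e9, r28]; exact h.depth,
    by rw [hF.nreg 29 h29]; exact h.count, by rw [hF.narr 24 h24]; exact h.ext, h.nodup, h.mem,
    by rw [hF.nreg 23 h23]; exact h.rx, by rw [hF.nreg 33 h33, e18]; exact h.rpath,
    by rw [hF.nreg 34 h34, e19]; exact h.rlen, by rw [hF.nreg 19 h19, e22]; exact h.rtree⟩
  rw [hF.narr a (h₅ a ⟨ha, by omega⟩)]

/-- Make the record in the register `22` the first child of the record in the register `23` if this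
is also in the register `28`, and the next sibling of the record in the register `28` otherwise. -/
def attach : Prog :=
  .nput 10 (.reg 22) (.lit 0) ;; .nput 11 (.reg 22) (.lit 0) ;;
  .ite (.neq (.reg 28) (.reg 23)) (.nput 10 (.reg 28) (.reg 22)) (.nput 11 (.reg 28) (.reg 22))

theorem wp_attach (h : σ.nreg 28 < σ.nreg 22)
    (h₁ : σ.nreg 28 = σ.nreg 23 → σ.narr 10 (σ.nreg 28) = 0)
    (h₂ : σ.nreg 28 ≠ σ.nreg 23 → σ.narr 11 (σ.nreg 28) = 0) :
    WP attach σ fun τ σ' => τ ≤ 20 ∧ ∃ l r : ℕ → ℕ,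
      σ' = { σ with narr := Function.update (Function.update σ.narr 10 l) 11 r } ∧
      l (σ.nreg 22) = 0 ∧ r (σ.nreg 22) = 0 ∧
      (∀ y < σ.nreg 22, y ≠ σ.nreg 28 → l y = σ.narr 10 y ∧ r y = σ.narr 11 y) ∧
      (σ.nreg 28 ≠ σ.nreg 23 → l (σ.nreg 28) = σ.narr 10 (σ.nreg 28)) ∧
      ((σ.narr 10 (σ.nreg 28) = 0 ∧ l (σ.nreg 28) = σ.nreg 22 ∧
          r (σ.nreg 28) = σ.narr 11 (σ.nreg 28)) ∨
        (σ.narr 11 (σ.nreg 28) = 0 ∧ l (σ.nreg 28) = σ.narr 10 (σ.nreg 28) ∧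
          r (σ.nreg 28) = σ.nreg 22)) := by
  apply wp_seq; apply wp_nput; apply wp_seq; apply wp_nput
  apply wp_ite <;> intro hb <;> apply wp_nput <;> simp only [Test.Holds, NExpr.eval] at hb
  · refine ⟨by simp [NExpr.cost, Test.cost], Function.update (Function.update (σ.narr 10)
      (σ.nreg 22) 0) (σ.nreg 28) (σ.nreg 22), Function.update (σ.narr 11) (σ.nreg 22) 0,
      ?_, ?_, by simp, ?_, fun h => absurd hb h, Or.inl ⟨h₁ hb, by simp, ?_⟩⟩
    · simp only [NExpr.eval]
      congr 1
      ext a : 1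
      by_cases h10 : a = 10
      · subst h10; simp
      · by_cases h11 : a = 11
        · subst h11; simp
        · simp [h10, h11]
    · rw [Function.update_of_ne (by omega)]; simp
    · intro y hy hy'
      rw [Function.update_of_ne hy', Function.update_of_ne (by omega),
        Function.update_of_ne (by omega)]
      exact ⟨rfl, rfl⟩
    · rw [Function.update_of_ne (by omega)]
  · refine ⟨by simp [NExpr.cost, Test.cost], Function.update (σ.narr 10) (σ.nreg 22) 0,
      Function.update (Function.update (σ.narr 11) (σ.nreg 22) 0) (σ.nreg 28) (σ.nreg 22),
      ?_, by simp, ?_, ?_, fun _ => ?_, Or.inr ⟨h₂ hb, ?_, by simp⟩⟩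
    · simp only [NExpr.eval]
      congr 1
      ext a : 1
      by_cases h10 : a = 10
      · subst h10; simp
      · by_cases h11 : a = 11
        · subst h11; simp
        · simp [h10, h11]
    · rw [Function.update_of_ne (by omega)]; simp
    · intro y hy hy'
      rw [Function.update_of_ne hy', Function.update_of_ne (by omega),
        Function.update_of_ne (by omega)]
      exact ⟨rfl, rfl⟩
    · rw [Function.update_of_ne (by omega)]
    · rw [Function.update_of_ne (by omega)]

/-- Push the extension of the record in the register `23` by the edge in the register `27`, whose
tail is the node with the index in the register `25` on the path. -/
def push : Prog :=
  .nset 14 (.reg 33) ;; .nset 15 (.reg 25) ;; .nset 31 (.reg 27) ;; .nset 32 (.reg 20) ;;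
  makePath ;; .nset 22 (.add (.reg 22) (.lit 1)) ;; attach ;;
  .nput 18 (.reg 22) (.reg 32) ;; .nput 19 (.reg 22) (.sub (.reg 20) (.reg 32)) ;;
  .nput 20 (.reg 22) (.reg 25) ;; .nput 21 (.reg 22) (.add (.reg 27) (.lit 1)) ;;
  .nput 22 (.reg 22) (.reg 19) ;; .nput 23 (.reg 22) (.reg 36) ;;
  .nput 9 (.reg 22) (.reg 28) ;; .nput 12 (.reg 22) (.lit 1) ;; .nput 13 (.reg 22) (.lit 0) ;;
  .rput 2 (.reg 22) (.reg 0) ;; .nput 24 (.reg 29) (.reg 27) ;;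
  .nset 29 (.add (.reg 29) (.lit 1)) ;; .nset 28 (.reg 22) ;; .nset 5 (.reg 22) ;; sift 9 2

set_option maxHeartbeats 1000000 in
/-- The depth of the new record is at most the depth of the record `x`, plus the number of
extensions of `q` so far, plus one. The edges in `F`, these extensions, and the new edge are distinct,
and their tails lie on the prefix path of the new sequence, so that the bound on the depth is
passed on. -/
theorem wp_push {q : N.Seq} {x : ℕ} {F : Finset (Fin N.m)} {R : Multiset N.Seq} {u : ℕ}
    {es : List (Fin N.m)} (h : Exp N k T₀ q x F R u es σ) (hs : N.IsSimple N.s (path T₀ q))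
    (hF : ∀ f ∈ F, N.tail f ∈ devNodes T₀ q) {i : ℕ} (hi : i < (path T₀ q).length)
    (hpi : (pre T₀ q).length ≤ i) {e : Fin N.m} (he : N.tail e = N.tail (path T₀ q)[i])
    (hext : IsExtension T₀ q e) (hnew : e ∉ es)
    (hes : ∀ f ∈ es, N.tail f ∈ ((path T₀ q).take (i + 1)).map N.tail)
    (h25 : σ.nreg 25 = i) (h27 : σ.nreg 27 = e) {T' : N.Tree}
    (hT' : IsSPTree (prefixNodes T₀ q e) T') (hTA : TreeAt (σ.narr 16) (σ.nreg 36) T')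
    (h36 : σ.nreg 36 + N.n ≤ σ.nreg 8) :
    WP push σ fun τ σ' => τ ≤ N.n * 80 + N.m * 100 + 500 ∧
      Exp N k T₀ q x F R u (es ++ [e]) σ' := by
  obtain ⟨A, U, seq, hQ, hA, hU⟩ := h.inv
  have hg := h.record.good
  obtain ⟨ht, hp, hg', hpath⟩ := hg.extend hs hi hpi he hext.2.2.2
  obtain ⟨p', hp'⟩ := hext.2.2.2
  rw [hp'.follow_eq hg.root] at hpath
  have hilt : i < N.n := hi.trans (length_lt_of_nodup hs)
  have hplt := hp'.length_lt hg.root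
  -- These edges bound the depth of the new record.
  obtain ⟨F', hF', hFcard⟩ : ∃ F' : Finset (Fin N.m),
      (∀ f ∈ F', N.tail f ∈ prefixNodes T₀ q e) ∧ F'.card = F.card + es.length + 1 := by
    have hdev : devNodes T₀ q = {v | v ∈ (pre T₀ q).map N.tail} := devNodes_eq hg
    have hnd := hs
    rw [IsSimple, nodes_eq hg.isPath, List.nodup_append] at hnd
    have hnd := hnd.1
    rw [path_eq, List.map_append, List.nodup_append] at hnd
    -- The edges in `F` leave nodes before the suffix path, the extensions leave nodes on it.
    have hdisj : ∀ f ∈ F, ∀ g, IsExtension T₀ q g → f ≠ g := by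
      rintro f hf g hg₂ rfl
      have h₁ := hF f hf
      rw [hdev] at h₁
      have h₂ := ((hg.isExtension_iff _).1 hg₂).1
      rw [path_eq, List.drop_left] at h₂
      exact hnd.2.2 _ h₁ _ h₂ rfl
    refine ⟨F ∪ (e :: es).toFinset, fun f hf => ?_, ?_⟩
    · rw [hp]
      rw [Finset.mem_union, List.mem_toFinset, List.mem_cons] at hf
      rcases hf with hf | rfl | hf
      · have h₁ := hF f hf
        rw [hdev] at h₁
        have h₂ : pre T₀ q = ((path T₀ q).take (i + 1)).take (pre T₀ q).length := by
          rw [List.take_take, min_eq_left (by omega), path_eq, List.take_left]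
        rw [h₂, List.map_take] at h₁
        exact List.mem_of_mem_take h₁
      · rw [Set.mem_ofPred_eq, he, List.take_succ_eq_append_getElem hi, List.map_append]
        exact List.mem_append_right _ (by simp)
      · exact hes f hf
    · rw [Finset.card_union_of_disjoint, List.toFinset_card_of_nodup]
      · simp [add_assoc]
      · exact List.nodup_cons.2 ⟨hnew, h.nodup⟩
      · rw [Finset.disjoint_left]
        intro f hf hf'
        rw [List.mem_toFinset, List.mem_cons] at hf'
        rcases hf' with rfl | hf'
        · exact hdisj f hf f hext rfl
        · exact hdisj f hf f (h.mem f hf') rfl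
  have hFm : F'.card ≤ N.m := by simpa using Finset.card_le_univ F'
  apply wp_seq; apply wp_nset; apply wp_seq; apply wp_nset; apply wp_seq; apply wp_nset
  apply wp_seq; apply wp_nset; apply wp_seq
  apply wp_gen
  intro σ₁ hσ₁
  simp only [NExpr.eval, ne_eq, Nat.reduceEqDiff, not_false_eq_true, Function.update_of_ne, h25,
    h27, h.rpath] at hσ₁
  have hr₁ : Ready N k σ₁ := by
    refine hQ.ready.congr ?_ ?_ ?_
    · intro y hy; interval_cases y <;> simp [hσ₁]
    · intro y hy; simp [hσ₁]
    · simp [hσ₁]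
  have htop := h.record.top
  rw [h.record.plen] at htop
  refine (wp_makePath hr₁ (p := (path T₀ q).take i) (e := e) (T := lastTree T₀ q) (p' := p')
    ?_ ?_ ?_ ?_ ?_ hg.root hp').mono ?_
  · simpa [hσ₁] using h.record.path.take i
  · simp [hσ₁]; omega
  · simp [hσ₁]; omega
  · simp [hσ₁]
  · simpa [hσ₁, h.rtree] using h.record.tree
  rintro τ₂ σ₂ hF₂ ⟨hτ₂, h20, hP, hlow, hacc⟩
  rw [← hpath] at h20 hP hacc
  have s22 : σ₂.nreg 22 = σ.nreg 22 := by rw [hF₂.nreg 22 rfl]; simp [hσ₁]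
  have s28 : σ₂.nreg 28 = σ.nreg 28 := by rw [hF₂.nreg 28 rfl]; simp [hσ₁]
  have s23 : σ₂.nreg 23 = x := by rw [hF₂.nreg 23 rfl]; simp [hσ₁, h.rx]
  have s10 : σ₂.narr 10 = σ.narr 10 := by rw [hF₂.narr 10 rfl]; simp [hσ₁]
  have s11 : σ₂.narr 11 = σ.narr 11 := by rw [hF₂.narr 11 rfl]; simp [hσ₁]
  have s25 : σ₂.nreg 25 = i := by rw [hF₂.nreg 25 rfl]; simp [hσ₁, h25]
  have s27 : σ₂.nreg 27 = e := by rw [hF₂.nreg 27 rfl]; simp [hσ₁, h27]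
  have s19 : σ₂.nreg 19 = σ.narr 22 x := by rw [hF₂.nreg 19 rfl]; simp [hσ₁, h.rtree]
  have s36 : σ₂.nreg 36 = σ.nreg 36 := by rw [hF₂.nreg 36 rfl]; simp [hσ₁]
  have s29 : σ₂.nreg 29 = es.length := by rw [hF₂.nreg 29 rfl]; simp [hσ₁, h.count]
  have s32 : σ₂.nreg 32 = σ.nreg 20 := by rw [hF₂.nreg 32 rfl]; simp [hσ₁]
  have s20 : σ₂.nreg 20 = σ.nreg 20 + (path T₀ ((e, lastTree T₀ q) :: q)).length := by
    rw [h20]; simp [hσ₁]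
  have hL₂ : Logs σ σ₂ := by
    refine ⟨?_, by omega, ?_, ?_⟩
    · rw [hF₂.nreg 8 rfl]; simp [hσ₁]
    · rw [hF₂.narr 16 rfl]; simp [hσ₁]
    · simpa [hσ₁] using hlow
  have hr₂ : Ready N k σ₂ := hr₁.of_fr hF₂ (by decide) (by decide) (by decide)
  have hQ₂ : QInv N k T₀ σ₂ A U seq := by
    refine hQ.mono hr₂ hL₂ s22 ?_ ?_ (by rw [hF₂.rarr 2 rfl]; simp [hσ₁])
    · intro a ha ha'
      rw [hF₂.narr a (by interval_cases a <;> rfl)]; simp [hσ₁]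
    · intro a ha ha'
      rw [hF₂.narr a (by interval_cases a <;> rfl)]; simp [hσ₁]
  have hP₂ : PathAt (σ₂.narr 17) (σ.nreg 20) (path T₀ ((e, lastTree T₀ q) :: q)) := by
    have : σ₁.nreg 20 = σ.nreg 20 := by simp [hσ₁]
    rwa [this] at hP
  have s18 : ∀ a, 18 ≤ a → a ≤ 23 → σ₂.narr a = σ.narr a := by
    intro a ha ha'
    rw [hF₂.narr a (by interval_cases a <;> rfl)]; simp [hσ₁]
  have s12 : σ₂.narr 12 = σ.narr 12 := by rw [hF₂.narr 12 rfl]; simp [hσ₁]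
  have s9 : σ₂.narr 9 = σ.narr 9 := by rw [hF₂.narr 9 rfl]; simp [hσ₁]
  have s24 : σ₂.narr 24 = σ.narr 24 := by rw [hF₂.narr 24 rfl]; simp [hσ₁]
  have s8 : σ₂.nreg 8 = σ.nreg 8 := by rw [hF₂.nreg 8 rfl]; simp [hσ₁]
  have hrec₂ : RecAt T₀ σ₂ x q := h.record.mono hL₂
    (fun a ha ha' => by rw [s18 a ha ha']) (by rw [hF₂.rarr 2 rfl]; simp [hσ₁])
  have hxle := h.le
  have hlle := h.last_le
  apply wp_seq; apply wp_nset; apply wp_seq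
  apply wp_gen
  intro σ₃ hσ₃
  simp only [NExpr.eval, s22] at hσ₃
  have t22 : σ₃.nreg 22 = σ.nreg 22 + 1 := by simp [hσ₃]
  have t28 : σ₃.nreg 28 = σ.nreg 28 := by simp [hσ₃, s28]
  have t23 : σ₃.nreg 23 = x := by simp [hσ₃, s23]
  have t10 : σ₃.narr 10 = σ.narr 10 := by simp [hσ₃, s10]
  have t11 : σ₃.narr 11 = σ.narr 11 := by simp [hσ₃, s11]
  refine (wp_attach (by omega) (by rw [t28, t23, t10]; exact h.last_eq)
    (by rw [t28, t23, t11]; exact h.last_ne)).mono ?_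
  rintro τ₄ σ₄ - ⟨hτ₄, l, r, hσ₄, hl, hr, hlr, hlne, hlrz⟩
  rw [t22] at hl hr hlr hlrz
  rw [t28] at hlr hlne hlrz
  rw [t23] at hlne
  rw [t10] at hlr hlne hlrz
  rw [t11] at hlr hlrz
  subst hσ₃
  apply wp_seq; apply wp_nput; apply wp_seq; apply wp_nput; apply wp_seq; apply wp_nput
  apply wp_seq; apply wp_nput; apply wp_seq; apply wp_nput; apply wp_seq; apply wp_nput
  apply wp_seq; apply wp_nput; apply wp_seq; apply wp_nput; apply wp_seq; apply wp_nput
  apply wp_seq; apply wp_rput; apply wp_seq; apply wp_nput; apply wp_seq; apply wp_nset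
  apply wp_seq; apply wp_nset; apply wp_seq; apply wp_nset
  apply wp_gen
  intro σ₅ hσ₅
  subst hσ₄
  simp only [NExpr.eval, RExpr.eval, ne_eq, Nat.reduceEqDiff, not_false_eq_true,
    Function.update_of_ne, Function.update_self, s28, s25, s27, s19, s36, s29, s32, s20,
    Nat.add_sub_cancel_left] at hσ₅
  set y := σ.nreg 22 + 1 with hy
  set q' : N.Seq := (e, lastTree T₀ q) :: q with hq'
  have u22 : σ₅.nreg 22 = y := by simp [hσ₅]
  have u28 : σ₅.nreg 28 = y := by simp [hσ₅]
  have u5 : σ₅.nreg 5 = y := by simp [hσ₅]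
  have u9 : σ₅.narr 9 = Function.update (σ.narr 9) y (σ.nreg 28) := by simp [hσ₅, s9]
  have u10 : σ₅.narr 10 = l := by simp [hσ₅]
  have u11 : σ₅.narr 11 = r := by simp [hσ₅]
  have u12 : σ₅.narr 12 = Function.update (σ.narr 12) y 1 := by simp [hσ₅, s12]
  have hins := Tour.AllOK.insert (T := σ₂.tour 9 2) (T' := σ₅.tour 9 2) (n := σ.nreg 22)
    (z := σ.nreg 28) (s22 ▸ hQ₂.forest) (s22 ▸ hQ₂.ok) h.last_pos h.last_le
    (fun w hw => by
      change σ₅.narr 9 w = σ₂.narr 9 w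
      rw [u9, s9, Function.update_of_ne (by omega)])
    (by change σ₅.narr 9 y = _; rw [u9]; simp)
    (fun w hw => by
      change σ₅.narr 12 w = σ₂.narr 12 w
      rw [u12, s12, Function.update_of_ne (by omega)])
    (fun w hw => by
      change σ₅.narr 13 w = σ₂.narr 13 w
      simp only [hσ₅, ne_eq, Nat.reduceEqDiff, not_false_eq_true, Function.update_of_ne,
        Function.update_self]
      rw [Function.update_of_ne (by omega)])
    (fun w hw => by
      change σ₅.rarr 2 w = σ₂.rarr 2 w
      simp only [hσ₅, Function.update_self]
      rw [Function.update_of_ne (by omega)])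
    (by change σ₅.narr 10 y = 0; rw [u10, hl])
    (by change σ₅.narr 11 y = 0; rw [u11, hr])
    (fun w hw hw' => by
      change σ₅.narr 10 w = σ₂.narr 10 w ∧ σ₅.narr 11 w = σ₂.narr 11 w
      rw [u10, u11, s10, s11]
      exact hlr w (by omega) hw')
    (by
      change (σ₂.narr 10 (σ.nreg 28) = 0 ∧ σ₅.narr 10 (σ.nreg 28) = _ ∧
        σ₅.narr 11 (σ.nreg 28) = σ₂.narr 11 (σ.nreg 28)) ∨ (σ₂.narr 11 (σ.nreg 28) = 0 ∧
        σ₅.narr 10 (σ.nreg 28) = σ₂.narr 10 (σ.nreg 28) ∧ σ₅.narr 11 (σ.nreg 28) = _)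
      rw [u10, u11, s10, s11]
      exact hlrz)
  have hiter : ∀ c w, w ≤ σ.nreg 22 → (σ₅.narr 9)^[c] w = (σ.narr 9)^[c] w := by
    intro c w hw
    exact (Tour.Forest.iterate_congr (T := σ.tour 9 2) (T' := σ₅.tour 9 2) hQ.forest
      (fun w hw => by
        change σ₅.narr 9 w = σ.narr 9 w
        rw [u9, Function.update_of_ne (by omega)]) c hw).1
  have hdepth : (σ₅.narr 9)^[F'.card + 1] y = 0 := by
    have h9y : σ₅.narr 9 y = σ.nreg 28 := by rw [u9]; simp
    rw [Function.iterate_succ_apply, h9y, hiter _ _ h.last_le, hFcard]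
    exact h.depth
  refine (wp_sift 9 2 σ₅ y (F'.card + 1) hins.1 (by rw [u5]; exact hins.2) (by omega)
    (by rw [u5]; exact hdepth)).mono ?_
  rintro τ₆ σ₆ hF₆ ⟨hτ₆, hf, ho, htr⟩
  have htr' : ∀ a, 9 ≤ a → a ≤ 12 → σ₆.narr a = σ₅.narr a := by
    intro a ha ha'
    rw [hF₆.narr a (by interval_cases a <;> rfl)]
  have v22 : σ₆.nreg 22 = y := by rw [hF₆.nreg 22 rfl, u22]
  have v28 : σ₆.nreg 28 = y := by rw [hF₆.nreg 28 rfl, u28]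
  have v9 := htr' 9 (by norm_num) (by norm_num)
  have v10 := (htr' 10 (by norm_num) (by norm_num)).trans u10
  have v11 := (htr' 11 (by norm_num) (by norm_num)).trans u11
  have v12 := (htr' 12 (by norm_num) (by norm_num)).trans u12
  have hL₅ : Logs σ₂ σ₆ := by
    refine ⟨?_, ?_, ?_, ?_⟩
    · rw [hF₆.nreg 8 rfl]; simp [hσ₅]
    · rw [hF₆.nreg 20 rfl]; simp [hσ₅]
    · rw [hF₆.narr 16 rfl]; simp [hσ₅]
    · rw [hF₆.narr 17 rfl]; simp [hσ₅]
  have hold : ∀ a, 18 ≤ a → a ≤ 23 → ∀ w < y, σ₆.narr a w = σ₂.narr a w := by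
    intro a ha ha' w hw
    rw [hF₆.narr a (by interval_cases a <;> rfl)]
    interval_cases a <;> simp [hσ₅, Function.update_of_ne hw.ne]
  have holdk : ∀ w < y, σ₆.rarr 2 w = σ₂.rarr 2 w := by
    intro w hw
    rw [hF₆.rarr 2 rfl]
    simp [hσ₅, Function.update_of_ne hw.ne]
  have hr₆ : Ready N k σ₆ := by
    refine Ready.of_fr (σ := σ₅) (hr₂.congr ?_ ?_ ?_) hF₆ (by decide) (by decide) (by decide)
    · intro w hw; interval_cases w <;> simp [hσ₅]
    · intro w hw; interval_cases w <;> simp [hσ₅]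
    · simp [hσ₅]
  have hyA : y ∉ A := fun hh => by have := (hQ.mem y hh).2; omega
  have hxA : x ∉ A := fun hh => (hQ.act x h.pos h.le).2 hh h.inact
  have w18 : σ₆.narr 18 y = σ.nreg 20 := by rw [hF₆.narr 18 rfl]; simp [hσ₅]
  have w19 : σ₆.narr 19 y = (path T₀ q').length := by rw [hF₆.narr 19 rfl]; simp [hσ₅]
  have w20 : σ₆.narr 20 y = i := by rw [hF₆.narr 20 rfl]; simp [hσ₅]
  have w21 : σ₆.narr 21 y = e + 1 := by rw [hF₆.narr 21 rfl]; simp [hσ₅]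
  have w22 : σ₆.narr 22 y = σ.narr 22 x := by rw [hF₆.narr 22 rfl]; simp [hσ₅]
  have w23 : σ₆.narr 23 y = σ.nreg 36 := by rw [hF₆.narr 23 rfl]; simp [hσ₅]
  have wk : σ₆.rarr 2 y = N.length (path T₀ q') := by
    rw [hF₆.rarr 2 rfl]; simp [hσ₅, hacc]
  have x22 : σ₂.narr 22 x = σ.narr 22 x := by rw [s18 22 (by norm_num) (by norm_num)]
  have hrecy : RecAt T₀ σ₆ y q' := by
    refine ⟨hg', ?_, w19, ?_, wk, ?_, ?_, by rw [w21]; rfl, ?_⟩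
    · rw [w18]
      intro j hj
      rw [hL₅.path _ (by omega), hP₂ j hj]
    · rw [w18, w19, hF₆.nreg 20 rfl]
      simp [hσ₅, s20]
    · rw [w22, ← x22]
      exact hrec₂.tree.logs hrec₂.treeTop hL₅
    · rw [w22, ← x22]
      exact hrec₂.treeTop.trans hL₅.treeTop
    · intro e₁ T₁ q₁ hq₁
      simp only [hq', List.cons.injEq, Prod.mk.injEq] at hq₁
      obtain ⟨⟨rfl, rfl⟩, rfl⟩ := hq₁
      rw [w20, w23, ht, List.length_take]
      exact ⟨by omega, T', hT', hTA.logs h36 (hL₂.trans hL₅),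
        h36.trans (hL₂.trans hL₅).treeTop⟩
  refine ⟨?_, ⟨insert y A, insert y U, Function.update seq y q', ?_, ?_, ?_⟩, ?_, h.pos, ?_, ?_,
    ?_, ?_, ?_, ?_, ?_, ?_, ?_, ?_, ?_, ?_, ?_, ?_, ?_⟩
  · have hτ₂' : τ₂ ≤ (N.n + N.n) * 40 + 60 := hτ₂.trans (by rw [List.length_take]; omega)
    simp only [NExpr.cost, RExpr.cost]
    clear * - hτ₂' hτ₄ hτ₆ hFm
    linarith
  · refine ⟨hr₆, by omega, by rw [v22]; exact hf, by rw [v22]; exact ho, ?_, ?_, ?_, ?_, ?_, ?_, ?_⟩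
    · intro w hw
      rw [v22]
      rcases Finset.mem_insert.1 hw with rfl | hw
      · exact ⟨by omega, le_rfl⟩
      · have := hQ.mem w hw; omega
    · intro w hw hw'
      rw [v22] at hw'
      rw [v12, Finset.mem_insert, Function.update_apply]
      split_ifs with hwy
      · simp [hwy]
      · rw [hQ.act w hw (by omega)]; simp [hwy]
    · intro w hw
      rw [v10]
      rcases Finset.mem_insert.1 hw with rfl | hw
      · exact hl
      · have h₁ := hQ.mem w hw
        by_cases hwl : w = σ.nreg 28
        · have hwx : σ.nreg 28 ≠ x := fun hh => hxA (by rwa [← hh, ← hwl])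
          rw [hwl, hlne hwx, ← hwl]
          exact hQ.leaf w hw
        · rw [(hlr w (by omega) hwl).1]
          exact hQ.leaf w hw
    · intro w hw
      rcases Finset.mem_insert.1 hw with rfl | hw
      · rw [Function.update_self]; exact hrecy
      · have h₁ := hQ.mem w hw
        rw [Function.update_of_ne (fun hh => hyA (by rwa [← hh]))]
        exact (hQ₂.record w hw).mono hL₅ (fun a ha ha' => hold a ha ha' w (by omega))
          (holdk w (by omega))
    · intro w hw
      rw [v9]
      rcases Finset.mem_insert.1 hw with rfl | hw
      · rw [Function.update_self]; exact ⟨F', hF', hdepth⟩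
      · rw [Function.update_of_ne (fun hh => hyA (by rwa [← hh]))]
        obtain ⟨G, hG, hG'⟩ := hQ.dep w hw
        exact ⟨G, hG, by rw [hiter _ _ (hQ.mem w hw).2, hG']⟩
    · intro w hw hwU
      rw [Finset.mem_insert, not_or] at hwU
      rw [Function.update_of_ne hwU.1]
      exact hQ.simple w ((Finset.mem_insert.1 hw).resolve_left hwU.1) hwU.2
    · exact Finset.insert_subset_insert _ hQ.sub
  · rw [Finset.insert_val_of_notMem hyA, Multiset.map_cons, Function.update_self]
    have : A.val.map (Function.update seq y q') = A.val.map seq := by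
      apply Multiset.map_congr rfl
      intro w hw
      rw [Function.update_of_ne]
      rintro rfl
      exact hyA hw
    rw [this, hA, List.map_append, ← Multiset.coe_add, ← add_assoc]
    simp [← Multiset.singleton_add, hq', add_comm]
  · rw [Finset.card_insert_of_notMem (fun hh => hyA (hQ.sub hh)), hU, List.length_append]
    simp [add_assoc]
  · exact hrec₂.mono hL₅ (fun a ha ha' => hold a ha ha' x (by omega)) (holdk x (by omega))
  · omega
  · rw [v12, Function.update_of_ne (by omega)]; exact h.inact
  · omega
  · omega
  · intro hh; omega
  · intro _; rw [v28, v11]; exact hr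
  · rw [v28, v9, List.length_append, List.length_singleton, ← add_assoc, ← hFcard]
    exact hdepth
  · rw [hF₆.nreg 29 rfl]; simp [hσ₅]
  · rw [hF₆.narr 24 rfl]
    have h24 : σ₅.narr 24 = Function.update (σ.narr 24) es.length e := by simp [hσ₅, s24]
    rw [h24]
    intro j hj
    rw [List.length_append, List.length_singleton] at hj
    rw [List.getElem_append]
    split_ifs with hj'
    · rw [Function.update_of_ne (by omega), h.ext j hj']
    · obtain rfl : j = es.length := by omega
      simp
  · rw [List.nodup_append]
    refine ⟨h.nodup, by simp, ?_⟩
    simp only [List.mem_singleton, forall_eq]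
    rintro a ha rfl
    exact hnew ha
  · intro f hf
    rcases List.mem_append.1 hf with hf | hf
    · exact h.mem f hf
    · rw [List.mem_singleton.1 hf]; exact hext
  · rw [hF₆.nreg 23 rfl]; simp [hσ₅, s23]
  · rw [hF₆.nreg 33 rfl, hold 18 (by norm_num) (by norm_num) x (by omega),
      s18 18 (by norm_num) (by norm_num), ← h.rpath]
    simp only [hσ₅, ne_eq, Nat.reduceEqDiff, not_false_eq_true, Function.update_of_ne]
    rw [hF₂.nreg 33 rfl]; simp [hσ₁]
  · rw [hF₆.nreg 34 rfl, hold 19 (by norm_num) (by norm_num) x (by omega),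
      s18 19 (by norm_num) (by norm_num), ← h.rlen]
    simp only [hσ₅, ne_eq, Nat.reduceEqDiff, not_false_eq_true, Function.update_of_ne]
    rw [hF₂.nreg 34 rfl]; simp [hσ₁]
  · rw [hF₆.nreg 19 rfl, hold 22 (by norm_num) (by norm_num) x (by omega), x22]
    simp [hσ₅, s19]

end KSSP

namespace KSSP

open Network

variable {N : Network} {k : ℕ} {T₀ : N.Tree} {σ σ' : Store} {q : N.Seq} {x : ℕ}
  {F : Finset (Fin N.m)} {R : Multiset N.Seq} {u : ℕ} {es : List (Fin N.m)}

/-! ### Extending a simple path -/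

/-- The edge in the register `27` is an extension at the node in the register `35`. -/
def isExt : Test :=
  .and (.neq (.get 0 (.reg 27)) (.reg 35))
    (.and (.not (.neq (.get 16 (.add (.reg 19) (.reg 35))) (.add (.reg 27) (.lit 1))))
      (.not (.and (.not (.neq (.get 1 (.reg 27)) (.reg 4)))
        (.neq (.get 16 (.add (.reg 19) (.get 1 (.reg 27)))) (.lit 0)))))

/-- Push the extension by the edge in the register `27`, if this is an extension at the node in
the register `35`. -/
def tryPush : Prog := .ite isExt push .skip

/-- A bound for the time of `push`. -/
def pushTime (N : Network) : ℕ := N.n * 80 + N.m * 100 + 500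

theorem enc_eq_succ {m : ℕ} {o : Option (Fin m)} {e : Fin m} : enc o = e + 1 ↔ o = some e := by
  cases o <;> simp [enc, Fin.ext_iff]

theorem enc_eq_zero {m : ℕ} {o : Option (Fin m)} : enc o = 0 ↔ o = none := by
  cases o <;> simp [enc]

theorem wp_tryPush (h : Exp N k T₀ q x F R u es σ) (hs : N.IsSimple N.s (path T₀ q))
    (hF : ∀ f ∈ F, N.tail f ∈ devNodes T₀ q) {i : ℕ} (hi : i < (path T₀ q).length)
    (hpi : (pre T₀ q).length ≤ i) {e : Fin N.m}
    (hes : ∀ f, f ∈ es ↔ IsExtension T₀ q f ∧ (N.tail f ∈ ((path T₀ q).take i).map N.tail ∨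
      (N.tail f = N.tail (path T₀ q)[i] ∧ (f : ℕ) < e)))
    (h25 : σ.nreg 25 = i) (h27 : σ.nreg 27 = e) (h35 : σ.nreg 35 = N.tail (path T₀ q)[i])
    {T' : N.Tree} (hT' : IsSPTree {v | v ∈ ((path T₀ q).take (i + 1)).map N.tail} T')
    (hTA : TreeAt (σ.narr 16) (σ.nreg 36) T') (h36 : σ.nreg 36 + N.n ≤ σ.nreg 8) :
    WP tryPush σ fun τ σ' => ∃ es', es.length ≤ es'.length ∧
      τ ≤ 50 + (es'.length - es.length) * pushTime N ∧ Exp N k T₀ q x F R u es' σ' ∧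
      ∀ f, f ∈ es' ↔ IsExtension T₀ q f ∧ (N.tail f ∈ ((path T₀ q).take i).map N.tail ∨
        (N.tail f = N.tail (path T₀ q)[i] ∧ (f : ℕ) < e + 1)) := by
  obtain ⟨A, U, seq, hQ, -, -⟩ := h.inv
  have hr := hQ.ready
  have hg := h.record.good
  have hnd := (hg.take hs hi).2.2.1
  rw [List.take_succ_eq_append_getElem hi, List.map_append, List.nodup_append] at hnd
  -- The nodes on the path are distinct, so edges that leave earlier nodes do not leave this one.
  have hsep : ∀ f, N.tail f = N.tail (path T₀ q)[i] →
      N.tail f ∉ ((path T₀ q).take i).map N.tail := by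
    intro f hf hf'
    exact hnd.2.2 _ hf' _ (by simp) hf
  have htr := h.record.tree
  rw [← h.rtree] at htr
  have hcond : N.tail e = N.tail (path T₀ q)[i] → (IsExtension T₀ q e ↔
      (lastTree T₀ q (N.tail e) ≠ some e ∧
        (N.head e = N.t ∨ lastTree T₀ q (N.head e) ≠ none))) := by
    intro he
    rw [hg.isExtension_iff]
    have : N.tail e ∈ ((path T₀ q).drop (pre T₀ q).length).map N.tail := by
      rw [he]
      apply List.mem_map_of_mem
      rw [List.mem_iff_getElem]
      refine ⟨i - (pre T₀ q).length, by rw [List.length_drop]; omega, ?_⟩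
      rw [List.getElem_drop]
      congr 1; omega
    exact and_iff_right this
  have htest : isExt.Holds σ ↔
      N.tail e = N.tail (path T₀ q)[i] ∧ IsExtension T₀ q e := by
    simp only [isExt, Test.Holds, NExpr.eval, h27, h35, hr.tail, hr.head, hr.t, htr (N.head e),
      htr (N.tail (path T₀ q)[i]), enc_eq_succ, enc_eq_zero, ← Fin.ext_iff]
    constructor
    · rintro ⟨h₁, h₂, h₃⟩
      rw [hcond h₁, h₁]
      exact ⟨rfl, h₂, by tauto⟩
    · rintro ⟨h₁, h₂⟩
      rw [hcond h₁, h₁] at h₂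
      exact ⟨h₁, h₂.1, by tauto⟩
  have hlt : ∀ f : Fin N.m, (f : ℕ) < e + 1 ↔ (f : ℕ) < e ∨ f = e := by
    intro f
    rw [Nat.lt_succ_iff_lt_or_eq, Fin.ext_iff]
  apply wp_ite
  · intro hb
    obtain ⟨he, hext⟩ := htest.1 hb
    have hnew : e ∉ es := by
      intro hmem
      rcases ((hes e).1 hmem).2 with h₁ | h₁
      · exact hsep e he h₁
      · omega
    have hpn := (hg.extend hs hi hpi he hext.2.2.2).2.1
    refine (wp_push h hs hF hi hpi he hext hnew ?_ h25 h27 (hpn ▸ hT') hTA h36).mono ?_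
    · intro f hf
      rw [List.take_succ_eq_append_getElem hi, List.map_append, List.mem_append]
      rcases ((hes f).1 hf).2 with h₁ | h₁
      · exact Or.inl h₁
      · exact Or.inr (by simp [h₁.1])
    · rintro τ σ' - ⟨hτ, hE⟩
      refine ⟨es ++ [e], by simp, ?_, hE, fun f => ?_⟩
      · rw [List.length_append, List.length_singleton, Nat.add_sub_cancel_left, one_mul]
        change τ ≤ pushTime N at hτ
        have : isExt.cost ≤ 40 := by decide
        omega
      · rw [List.mem_append, List.mem_singleton, hes, hlt]
        constructor
        · rintro (⟨h₁, h₂ | ⟨h₂, h₃⟩⟩ | rfl)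
          · exact ⟨h₁, Or.inl h₂⟩
          · exact ⟨h₁, Or.inr ⟨h₂, Or.inl h₃⟩⟩
          · exact ⟨hext, Or.inr ⟨he, Or.inr rfl⟩⟩
        · rintro ⟨h₁, h₂ | ⟨h₂, h₃ | h₃⟩⟩
          · exact Or.inl ⟨h₁, Or.inl h₂⟩
          · exact Or.inl ⟨h₁, Or.inr ⟨h₂, h₃⟩⟩
          · exact Or.inr h₃
  · intro hb
    apply wp_skip
    refine ⟨es, le_rfl, by simp [isExt, Test.cost, NExpr.cost], h, fun f => ?_⟩
    rw [hes, hlt]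
    have : f = e → ¬ (IsExtension T₀ q f ∧ N.tail f = N.tail (path T₀ q)[i]) := by
      rintro rfl h₁
      exact hb (htest.2 ⟨h₁.2, h₁.1⟩)
    constructor
    · rintro ⟨h₁, h₂ | ⟨h₂, h₃⟩⟩
      · exact ⟨h₁, Or.inl h₂⟩
      · exact ⟨h₁, Or.inr ⟨h₂, Or.inl h₃⟩⟩
    · rintro ⟨h₁, h₂ | ⟨h₂, h₃ | h₃⟩⟩
      · exact ⟨h₁, Or.inl h₂⟩
      · exact ⟨h₁, Or.inr ⟨h₂, h₃⟩⟩
      · exact absurd ⟨h₁, h₂⟩ (this h₃)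

/-- Push all extensions at the node with the index in the register `25` on the path. The array `15`
marks the nodes before it. -/
def expandNode : Prog :=
  (.nset 35 (.get 0 (.get 17 (.add (.reg 33) (.reg 25)))) ;; .nput 15 (.reg 35) (.lit 1)) ;;
  dijkstra ;; (.nset 36 (.reg 8) ;; .nset 8 (.add (.reg 8) (.reg 0)) ;; .nset 27 (.lit 0)) ;;
  .loop (.nlt (.reg 27) (.reg 1)) (tryPush ;; .nset 27 (.add (.reg 27) (.lit 1)))

/-- A bound for the time of `expandNode`, without the calls of `push`. -/
def nodeTime (N : Network) : ℕ := dijTime N.n N.m + N.m * 70 + 60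

theorem Exp.length_le (h : Exp N k T₀ q x F R u es σ) : es.length ≤ N.m := by
  have := h.nodup.length_le_card
  rwa [Fintype.card_fin] at this

/-- One call of Dijkstra's algorithm serves all extensions at the node: the shortest path tree by which
the tree of an extension is replaced depends only on the tail of the new sidetrack. The time
of the calls of `push` is charged to the new extensions. -/
theorem wp_expandNode (h : Exp N k T₀ q x F R u es σ) (hs : N.IsSimple N.s (path T₀ q))
    (hF : ∀ f ∈ F, N.tail f ∈ devNodes T₀ q) {i : ℕ} (hi : i < (path T₀ q).length)
    (hpi : (pre T₀ q).length ≤ i)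
    (hes : ∀ f, f ∈ es ↔ IsExtension T₀ q f ∧ N.tail f ∈ ((path T₀ q).take i).map N.tail)
    (h15 : ∀ v : Fin N.n, σ.narr 15 v ≠ 0 ↔ v ∈ ((path T₀ q).take i).map N.tail)
    (h25 : σ.nreg 25 = i) :
    WP expandNode σ fun τ σ' => ∃ es', es.length ≤ es'.length ∧
      τ ≤ nodeTime N + (es'.length - es.length) * pushTime N ∧ Exp N k T₀ q x F R u es' σ' ∧
      (∀ f, f ∈ es' ↔ IsExtension T₀ q f ∧ N.tail f ∈ ((path T₀ q).take (i + 1)).map N.tail) ∧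
      ∀ v : Fin N.n, σ'.narr 15 v ≠ 0 ↔ v ∈ ((path T₀ q).take (i + 1)).map N.tail := by
  obtain ⟨A, U, seq, hQ, -, -⟩ := h.inv
  have hr := hQ.ready
  have hg := h.record.good
  have htake : ∀ v, v ∈ ((path T₀ q).take (i + 1)).map N.tail ↔
      v ∈ ((path T₀ q).take i).map N.tail ∨ v = N.tail (path T₀ q)[i] := by
    intro v
    rw [List.take_succ_eq_append_getElem hi, List.map_append, List.mem_append]
    simp
  have hpi' := h.record.path i hi
  rw [← h.rpath] at hpi'
  apply wp_seq
  refine WP.mono (Q := fun τ σ' => τ ≤ 20 ∧ σ'.nreg 35 = N.tail (path T₀ q)[i] ∧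
    σ'.narr 15 = Function.update (σ.narr 15) (N.tail (path T₀ q)[i]) 1) ?_ ?_
  · apply wp_seq; apply wp_nset; apply wp_nput
    simp [NExpr.eval, NExpr.cost, h25, hpi', hr.tail]
  rintro τ₁ σ₁ hF₁ ⟨hτ₁, s35, s15⟩
  have hE₁ := h.of_fr hF₁ (Logs.of_fr hF₁ (by decide) (by decide) (by decide) (by decide))
    (by decide) (by decide)
  -- The forbidden nodes are those up to and including the tail of the new sidetracks.
  have h15₁ : ∀ v : Fin N.n, σ₁.narr 15 v ≠ 0 ↔
      v ∈ {v | v ∈ ((path T₀ q).take (i + 1)).map N.tail} := by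
    intro v
    rw [Set.mem_ofPred_eq, htake, ← h15 v]
    simp only [s15, Function.update_apply, Fin.ext_iff]
    split_ifs with hv <;> simp [hv]
  obtain ⟨_, _, _, hQ₁, -, -⟩ := hE₁.inv
  apply wp_seq
  refine (wp_dijkstra hQ₁.ready h15₁ (hg.take hs hi).2.2.2).mono ?_
  rintro τ₂ σ₂ hF₂ ⟨hτ₂, ⟨T', hT', hTA⟩, hlow⟩
  have s8 : σ₂.nreg 8 = σ₁.nreg 8 := hF₂.nreg 8 rfl
  have hE₂ := hE₁.of_fr hF₂ ⟨s8.ge, (hF₂.nreg 20 rfl).ge, hlow, fun _ _ => by rw [hF₂.narr 17 rfl]⟩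
    (by decide) (by decide)
  obtain ⟨_, _, _, hQ₂, -, -⟩ := hE₂.inv
  apply wp_seq
  refine WP.mono (Q := fun τ σ' => τ ≤ 20 ∧ σ'.nreg 36 = σ₁.nreg 8 ∧
    σ'.nreg 8 = σ₁.nreg 8 + N.n ∧ σ'.nreg 27 = 0) ?_ ?_
  · apply wp_seq; apply wp_nset; apply wp_seq; apply wp_nset; apply wp_nset
    simp [NExpr.eval, NExpr.cost, s8, hQ₂.ready.n]
  rintro τ₃ σ₃ hF₃ ⟨hτ₃, t36, t8, t27⟩
  have hE₃ := hE₂.of_fr hF₃ ⟨by omega, (hF₃.nreg 20 rfl).ge, fun _ _ => by rw [hF₃.narr 16 rfl],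
    fun _ _ => by rw [hF₃.narr 17 rfl]⟩ (by decide) (by decide)
  have t16 : TreeAt (σ₃.narr 16) (σ₃.nreg 36) T' := by rw [hF₃.narr 16 rfl, t36]; exact hTA
  have t25 : σ₃.nreg 25 = i := by
    rw [hF₃.nreg 25 rfl, hF₂.nreg 25 rfl, hF₁.nreg 25 rfl, h25]
  have t35 : σ₃.nreg 35 = N.tail (path T₀ q)[i] := by
    rw [hF₃.nreg 35 rfl, hF₂.nreg 35 rfl, s35]
  refine (wp_loop_rest (fun p σ' => ∃ es', Exp N k T₀ q x F R u es' σ' ∧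
      es.length ≤ es'.length ∧ (∀ f, f ∈ es' ↔ IsExtension T₀ q f ∧
        (N.tail f ∈ ((path T₀ q).take i).map N.tail ∨
        (N.tail f = N.tail (path T₀ q)[i] ∧ (f : ℕ) < σ'.nreg 27))) ∧ σ'.nreg 27 ≤ N.m ∧
      p = (N.m - σ'.nreg 27) * 70 + 10 + (N.m - es'.length) * pushTime N)
    (fun p σ' => ∃ es', Exp N k T₀ q x F R u es' σ' ∧ es.length ≤ es'.length ∧
      (∀ f, f ∈ es' ↔ IsExtension T₀ q f ∧ N.tail f ∈ ((path T₀ q).take (i + 1)).map N.tail) ∧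
      p = (N.m - es'.length) * pushTime N) _
    ⟨es, hE₃, le_rfl, fun f => by rw [hes, t27]; simp, by omega, rfl⟩ ?_ ?_).mono ?_
  · rintro p σ₄ hF₄ ⟨es', hE₄, hle, hes', -, rfl⟩ hb
    obtain ⟨_, _, _, hQ₄, -, -⟩ := hE₄.inv
    simp only [Test.Holds, NExpr.eval, hQ₄.ready.m] at hb
    have v36 : σ₄.nreg 36 = σ₃.nreg 36 := hF₄.nreg 36 rfl
    have v8 : σ₄.nreg 8 = σ₃.nreg 8 := hF₄.nreg 8 rfl
    apply wp_seq
    refine (wp_tryPush (e := ⟨_, hb⟩) hE₄ hs hF hi hpi hes' (by rw [hF₄.nreg 25 rfl, t25]) rfl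
      (by rw [hF₄.nreg 35 rfl, t35]) hT' (by rw [hF₄.narr 16 rfl, v36]; exact t16)
      (by omega)).mono ?_
    rintro τ₅ σ₅ hF₅ ⟨es'', hle', hτ₅, hE₅, hes''⟩
    have w27 : σ₅.nreg 27 = σ₄.nreg 27 := hF₅.nreg 27 rfl
    refine WP.mono (Q := fun τ σ' => τ = 4 ∧ σ'.nreg 27 = σ₄.nreg 27 + 1) ?_ ?_
    · apply wp_nset
      simp [NExpr.eval, NExpr.cost, w27]
    rintro τ₆ σ₆ hF₆ ⟨rfl, y27⟩
    have hE₆ := hE₅.of_fr hF₆ (Logs.of_fr hF₆ (by decide) (by decide) (by decide) (by decide))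
      (by decide) (by decide)
    refine ⟨_, ?_, es'', hE₆, hle.trans hle', by rw [y27]; exact hes'', by omega, rfl⟩
    have h₁ := hE₅.length_le
    obtain ⟨d, hd⟩ := Nat.exists_eq_add_of_le hle'
    obtain ⟨r, hr'⟩ := Nat.exists_eq_add_of_le h₁
    rw [show es''.length - es'.length = d by omega] at hτ₅
    rw [show N.m - es''.length = r by omega, show N.m - es'.length = d + r by omega, y27,
      Nat.add_mul]
    obtain ⟨j, hj⟩ : ∃ j, N.m - σ₄.nreg 27 = j + 1 := ⟨N.m - σ₄.nreg 27 - 1, by omega⟩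
    rw [show N.m - (σ₄.nreg 27 + 1) = j by omega, hj]
    simp only [Test.cost, NExpr.cost]
    linarith
  · rintro p σ₄ hF₄ ⟨es', hE₄, hle, hes', hj, rfl⟩ hb
    obtain ⟨_, _, _, hQ₄, -, -⟩ := hE₄.inv
    simp only [Test.Holds, NExpr.eval, hQ₄.ready.m] at hb
    refine ⟨_, ?_, es', hE₄, hle, fun f => ?_, rfl⟩
    · simp only [Test.cost, NExpr.cost]; omega
    · rw [hes', htake]
      have : (f : ℕ) < σ₄.nreg 27 := by have := f.2; omega
      simp [this]
  · rintro τ₄ σ₄ hF₄ ⟨p', hp', es', hE₄, hle, hes', rfl⟩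
    refine ⟨es', hle, ?_, hE₄, hes', fun v => ?_⟩
    · have h₁ := hE₄.length_le
      obtain ⟨d, hd⟩ := Nat.exists_eq_add_of_le hle
      obtain ⟨r, hr'⟩ := Nat.exists_eq_add_of_le h₁
      rw [show N.m - es'.length = r by omega, show N.m - es.length = d + r by omega,
        Nat.add_mul, t27] at hp'
      rw [show es'.length - es.length = d by omega, nodeTime]
      simp only [Nat.sub_zero] at hp'
      linarith
    · rw [hF₄.narr 15 rfl, hF₃.narr 15 rfl, hF₂.narr 15 rfl]
      exact h15₁ v

end KSSP

namespace KSSP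

open Network

variable {N : Network} {k : ℕ} {T₀ : N.Tree} {σ σ' : Store} {q : N.Seq} {x : ℕ}
  {F : Finset (Fin N.m)} {R : Multiset N.Seq} {u : ℕ} {es : List (Fin N.m)}

/-- Because of the coercion, the definition of `encodeEdges` maps over a monadic bind. -/
theorem encodeEdges_eq (p : List (Fin N.m)) :
    encodeEdges p = p.length :: p.map fun e : Fin N.m => (e : ℕ) := by
  simp only [encodeEdges, List.bind_eq_flatMap, List.pure_def, List.map_id']
  rw [← List.map_eq_flatMap]

/-- Prepare the extension of the record in the register `23`: mark the tails of the edges before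
the suffix path in the array `15`, and let the register `25` point to the suffix path. -/
def expandInit : Prog :=
  clearArr 15 ;;
  (.nset 33 (.get 18 (.reg 23)) ;; .nset 34 (.get 19 (.reg 23)) ;; .nset 19 (.get 22 (.reg 23)) ;;
    .nset 28 (.reg 23) ;; .nset 29 (.lit 0) ;; .nset 25 (.lit 0)) ;;
  .ite (.neq (.get 21 (.reg 23)) (.lit 0)) (.nset 26 (.lit 0))
    (.nset 26 (.add (.get 20 (.reg 23)) (.lit 1))) ;;
  .loop (.nlt (.reg 25) (.reg 26))
    (.nput 15 (.get 0 (.get 17 (.add (.reg 33) (.reg 25)))) (.lit 1) ;;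
     .nset 25 (.add (.reg 25) (.lit 1)))

theorem wp_expandInit (hr : Ready N k σ) (h : RecAt T₀ σ x q) (hx : σ.nreg 23 = x) :
    WP expandInit σ fun τ σ' => τ ≤ N.n * 60 + 100 ∧ σ'.nreg 25 = (pre T₀ q).length ∧
      σ'.nreg 33 = σ.narr 18 x ∧ σ'.nreg 34 = σ.narr 19 x ∧ σ'.nreg 19 = σ.narr 22 x ∧
      σ'.nreg 28 = x ∧ σ'.nreg 29 = 0 ∧ ∀ v : Fin N.n, σ'.narr 15 v ≠ 0 ↔
        v ∈ ((path T₀ q).take (pre T₀ q).length).map N.tail := by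
  have hle : (pre T₀ q).length ≤ (path T₀ q).length := by
    rw [path_eq, List.length_append]; omega
  apply wp_seq
  refine (wp_clearArr 15).mono ?_
  rintro τ₁ σ₁ hF₁ ⟨hτ₁, hc⟩
  rw [hr.n] at hτ₁ hc
  have h23 : σ₁.nreg 23 = x := by rw [hF₁.nreg 23 rfl, hx]
  apply wp_seq
  refine WP.mono (Q := fun τ σ' => τ ≤ 20 ∧ σ'.nreg 33 = σ.narr 18 x ∧ σ'.nreg 34 = σ.narr 19 x ∧
    σ'.nreg 19 = σ.narr 22 x ∧ σ'.nreg 28 = x ∧ σ'.nreg 29 = 0 ∧ σ'.nreg 25 = 0) ?_ ?_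
  · apply wp_seq; apply wp_nset; apply wp_seq; apply wp_nset; apply wp_seq; apply wp_nset
    apply wp_seq; apply wp_nset; apply wp_seq; apply wp_nset; apply wp_nset
    simp [NExpr.eval, NExpr.cost, h23, hF₁.narr 18 rfl, hF₁.narr 19 rfl, hF₁.narr 22 rfl]
  rintro τ₂ σ₂ hF₂ ⟨hτ₂, s33, s34, s19, s28, s29, s25⟩
  apply wp_seq
  refine WP.mono (Q := fun τ σ' => τ ≤ 20 ∧ σ'.nreg 26 = (pre T₀ q).length) ?_ ?_
  · have t23 : σ₂.nreg 23 = x := by rw [hF₂.nreg 23 rfl, h23]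
    have t21 : σ₂.narr 21 = σ.narr 21 := by rw [hF₂.narr 21 rfl, hF₁.narr 21 rfl]
    have t20 : σ₂.narr 20 = σ.narr 20 := by rw [hF₂.narr 20 rfl, hF₁.narr 20 rfl]
    rcases q with _ | ⟨⟨e, T⟩, q'⟩
    · apply wp_ite <;> intro hb
      · apply wp_nset
        simp [NExpr.eval, NExpr.cost, Test.cost, Network.pre]
      · simp [Test.Holds, NExpr.eval, t23, t21, h.edge, enc] at hb
    · apply wp_ite <;> intro hb
      · simp [Test.Holds, NExpr.eval, t23, t21, h.edge, enc] at hb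
      · apply wp_nset
        simp [NExpr.eval, NExpr.cost, Test.cost, Network.pre, t23, t20, (h.side e T q' rfl).1]
  rintro τ₃ σ₃ hF₃ ⟨hτ₃, t26⟩
  have t25 : σ₃.nreg 25 = 0 := by rw [hF₃.nreg 25 rfl, s25]
  have t33 : σ₃.nreg 33 = σ.narr 18 x := by rw [hF₃.nreg 33 rfl, s33]
  have t17 : σ₃.narr 17 = σ.narr 17 := by rw [hF₃.narr 17 rfl, hF₂.narr 17 rfl, hF₁.narr 17 rfl]
  have t0 : σ₃.narr 0 = σ.narr 0 := by rw [hF₃.narr 0 rfl, hF₂.narr 0 rfl, hF₁.narr 0 rfl]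
  have t15 : σ₃.narr 15 = σ₁.narr 15 := by rw [hF₃.narr 15 rfl, hF₂.narr 15 rfl]
  refine (wp_for (fun j σ' => ∀ v : Fin N.n, σ'.narr 15 v ≠ 0 ↔
      v ∈ ((path T₀ q).take j).map N.tail)
    (Q := fun σ' => σ'.nreg 25 = (pre T₀ q).length ∧ ∀ v : Fin N.n, σ'.narr 15 v ≠ 0 ↔
        v ∈ ((path T₀ q).take (pre T₀ q).length).map N.tail) (pre T₀ q).length 10
    ?_ ?_ ?_ ?_ ?_).mono ?_
  · intro v; rw [t25, t15, hc v v.2]; simp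
  · omega
  · intro j σ₄ hF₄ _
    simp only [NExpr.eval]
    rw [hF₄.nreg 26 rfl, t26]
  · intro j σ₄ hF₄ hI hj hjlt
    apply wp_nput
    have hjl : j < (path T₀ q).length := by omega
    have hval : σ₄.narr 0 (σ₄.narr 17 (σ₄.nreg 33 + σ₄.nreg 25)) = N.tail (path T₀ q)[j] := by
      rw [hF₄.narr 0 rfl, hF₄.narr 17 rfl, hF₄.nreg 33 rfl, hj, t0, t17, t33, h.path j hjl, hr.tail]
    refine ⟨by simp [NExpr.cost], hj, fun v => ?_⟩
    rw [List.take_succ_eq_append_getElem hjl, List.map_append, List.mem_append, ← hI v]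
    simp only [NExpr.eval, hval, Function.update_self, Function.update_apply, ← Fin.ext_iff,
      List.map_cons, List.map_nil, List.mem_singleton]
    split_ifs with hv <;> simp [hv]
  · intro σ₄ hF₄ hI h25
    exact ⟨h25, hI⟩
  · rintro τ₄ σ₄ hF₄ ⟨hτ₄, h25, h15⟩
    refine ⟨?_, h25, by rw [hF₄.nreg 33 rfl, t33], by rw [hF₄.nreg 34 rfl, hF₃.nreg 34 rfl, s34],
      by rw [hF₄.nreg 19 rfl, hF₃.nreg 19 rfl, s19], by rw [hF₄.nreg 28 rfl, hF₃.nreg 28 rfl, s28],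
      by rw [hF₄.nreg 29 rfl, hF₃.nreg 29 rfl, s29], h15⟩
    have := h.good.length_pre_le
    simp only [NExpr.cost] at hτ₄
    omega

/-- Push the extensions at all nodes of the suffix path. -/
def expandLoop : Prog :=
  .loop (.nlt (.reg 25) (.reg 34)) (expandNode ;; .nset 25 (.add (.reg 25) (.lit 1)))

theorem wp_expandLoop (h : Exp N k T₀ q x F R u [] σ) (hs : N.IsSimple N.s (path T₀ q))
    (hF : ∀ f ∈ F, N.tail f ∈ devNodes T₀ q) (h25 : σ.nreg 25 = (pre T₀ q).length)
    (h15 : ∀ v : Fin N.n, σ.narr 15 v ≠ 0 ↔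
      v ∈ ((path T₀ q).take (pre T₀ q).length).map N.tail) :
    WP expandLoop σ fun τ σ' => τ ≤ N.n * (nodeTime N + 10) + N.m * pushTime N + 10 ∧
      ∃ es, Exp N k T₀ q x F R u es σ' ∧ ∀ f, f ∈ es ↔ IsExtension T₀ q f := by
  have hg := h.record.good
  have hlen : ∀ {σ' es}, Exp N k T₀ q x F R u es σ' → σ'.nreg 34 = (path T₀ q).length :=
    fun h => by rw [h.rlen, h.record.plen]
  refine (wp_loop (fun p σ' => ∃ es', Exp N k T₀ q x F R u es' σ' ∧
      (∀ f, f ∈ es' ↔ IsExtension T₀ q f ∧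
        N.tail f ∈ ((path T₀ q).take (σ'.nreg 25)).map N.tail) ∧
      (∀ v : Fin N.n, σ'.narr 15 v ≠ 0 ↔ v ∈ ((path T₀ q).take (σ'.nreg 25)).map N.tail) ∧
      (pre T₀ q).length ≤ σ'.nreg 25 ∧ σ'.nreg 25 ≤ (path T₀ q).length ∧
      p = ((path T₀ q).length - σ'.nreg 25) * (nodeTime N + 10) + 10 +
        (N.m - es'.length) * pushTime N)
    (Q := fun σ' => ∃ es, Exp N k T₀ q x F R u es σ' ∧ ∀ f, f ∈ es ↔ IsExtension T₀ q f) _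
    ⟨[], h, fun f => ?_, by rw [h25]; exact h15, h25.ge, ?_, rfl⟩ ?_ ?_).mono ?_
  -- No extension leaves a node before the suffix path, so the empty list is complete at its start.
  · have hnd := hs
    rw [IsSimple, nodes_eq hg.isPath, List.nodup_append] at hnd
    have hnd := hnd.1
    rw [path_eq, List.map_append, List.nodup_append] at hnd
    rw [h25, hg.isExtension_iff, path_eq, List.drop_left, List.take_left]
    simp only [List.not_mem_nil, false_iff]
    rintro ⟨h₁, h₂⟩
    exact hnd.2.2 _ h₂ _ h₁.1 rfl
  · rw [h25, path_eq, List.length_append]; omega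
  · rintro p σ₁ hF₁ ⟨es', hE₁, hes', h15', hpl, -, rfl⟩ hb
    simp only [Test.Holds, NExpr.eval, hlen hE₁] at hb
    apply wp_seq
    refine (wp_expandNode hE₁ hs hF hb hpl hes' h15' rfl).mono ?_
    rintro τ₂ σ₂ hF₂ ⟨es'', hle, hτ₂, hE₂, hes'', h15''⟩
    have s25 : σ₂.nreg 25 = σ₁.nreg 25 := hF₂.nreg 25 rfl
    refine WP.mono (Q := fun τ σ' => τ = 4 ∧ σ'.nreg 25 = σ₁.nreg 25 + 1) ?_ ?_
    · apply wp_nset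
      simp [NExpr.eval, NExpr.cost, s25]
    rintro τ₃ σ₃ hF₃ ⟨rfl, y25⟩
    have hE₃ := hE₂.of_fr hF₃ (Logs.of_fr hF₃ (by decide) (by decide) (by decide) (by decide))
      (by decide) (by decide)
    refine ⟨_, ?_, es'', hE₃, by rw [y25]; exact hes'',
      by rw [y25, hF₃.narr 15 rfl]; exact h15'', by omega, by omega, rfl⟩
    have h₁ := hE₃.length_le
    obtain ⟨d, hd⟩ := Nat.exists_eq_add_of_le hle
    obtain ⟨r, hr'⟩ := Nat.exists_eq_add_of_le h₁
    rw [show es''.length - es'.length = d by omega] at hτ₂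
    rw [show N.m - es''.length = r by omega, show N.m - es'.length = d + r by omega, y25,
      Nat.add_mul d]
    obtain ⟨j, hj⟩ : ∃ j, (path T₀ q).length - σ₁.nreg 25 = j + 1 :=
      ⟨(path T₀ q).length - σ₁.nreg 25 - 1, by omega⟩
    rw [show (path T₀ q).length - (σ₁.nreg 25 + 1) = j by omega, hj]
    simp only [Test.cost, NExpr.cost]
    linarith
  · rintro p σ₁ hF₁ ⟨es', hE₁, hes', h15', hpl, hle, rfl⟩ hb
    simp only [Test.Holds, NExpr.eval, hlen hE₁] at hb
    refine ⟨by simp only [Test.cost, NExpr.cost]; omega, es', hE₁, fun f => ?_⟩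
    rw [hes', List.take_of_length_le (by omega)]
    refine and_iff_left_of_imp fun h₁ => ?_
    have h₂ := ((hg.isExtension_iff f).1 h₁).1
    rw [List.map_drop] at h₂
    exact List.mem_of_mem_drop h₂
  · rintro τ₁ σ₁ hF₁ ⟨hτ₁, h₁⟩
    refine ⟨hτ₁.trans ?_, h₁⟩
    have h₂ : (path T₀ q).length - σ.nreg 25 ≤ N.n := by
      have := length_lt_of_nodup hs; omega
    have h₃ := Nat.mul_le_mul_right (nodeTime N + 10) h₂
    simp only [List.length_nil, Nat.sub_zero]
    linarith

/-- Push all extensions of the record in the register `23`, and write them to the output. -/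
def expand : Prog :=
  expandInit ;; expandLoop ;; (.emit (.reg 29) ;; .nset 14 (.lit 0) ;; .nset 15 (.reg 29)) ;;
  emitRange 24

/-- A bound for the time of `expand`. -/
def expandTime (N : Network) : ℕ :=
  N.n * (nodeTime N + 70) + N.m * (pushTime N + 20) + 200

theorem wp_expand {A U : Finset ℕ} {seq : ℕ → N.Seq} (hQ : QInv N k T₀ σ A U seq)
    (h : RecAt T₀ σ x q) (hs : N.IsSimple N.s (path T₀ q)) (hpos : 1 ≤ x) (hle : x ≤ σ.nreg 22)
    (hact : σ.narr 12 x = 0) (hleaf : σ.narr 10 x = 0)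
    (hF : ∀ f ∈ F, N.tail f ∈ devNodes T₀ q) (hdep : (σ.narr 9)^[F.card + 1] x = 0)
    (hx : σ.nreg 23 = x) :
    WP expand σ fun τ σ' => τ ≤ expandTime N ∧ ∃ (es : List (Fin N.m)) (A' U' : Finset ℕ)
      (seq' : ℕ → N.Seq), es.Nodup ∧ (∀ f, f ∈ es ↔ IsExtension T₀ q f) ∧
      QInv N k T₀ σ' A' U' seq' ∧
      A'.val.map seq' = A.val.map seq + (es.map fun e => (e, lastTree T₀ q) :: q : List N.Seq) ∧
      U'.card ≤ U.card + N.m ∧ σ'.out = σ.out ++ encodeEdges es := by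
  apply wp_seq
  refine (wp_expandInit hQ.ready h hx).mono ?_
  rintro τ₁ σ₁ hF₁ ⟨hτ₁, s25, s33, s34, s19, s28, s29, s15⟩
  have hL₁ : Logs σ σ₁ := Logs.of_fr hF₁ (by decide) (by decide) (by decide) (by decide)
  have s22 : σ₁.nreg 22 = σ.nreg 22 := hF₁.nreg 22 rfl
  have hE₁ : Exp N k T₀ q x F (A.val.map seq) U.card [] σ₁ := by
    refine ⟨⟨A, U, seq, hQ.of_fr hF₁ hL₁ (by decide), by simp, by simp⟩, h.mono hL₁ ?_ ?_, hpos,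
      by omega, ?_, by omega, by omega, fun _ => ?_, fun hne => absurd s28 hne, ?_, by simpa using s29,
      fun i hi => by simp at hi, by simp, by simp, by rw [hF₁.nreg 23 rfl, hx], ?_, ?_, ?_⟩
    · intro a ha ha'
      rw [hF₁.narr a (by interval_cases a <;> rfl)]
    · rw [hF₁.rarr 2 rfl]
    · rw [hF₁.narr 12 rfl, hact]
    · rw [hF₁.narr 10 rfl, s28, hleaf]
    · rw [hF₁.narr 9 rfl, s28]; exact hdep
    · rw [hF₁.narr 18 rfl, s33]
    · rw [hF₁.narr 19 rfl, s34]
    · rw [hF₁.narr 22 rfl, s19]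
  apply wp_seq
  refine (wp_expandLoop hE₁ hs hF s25 s15).mono ?_
  rintro τ₂ σ₂ hF₂ ⟨hτ₂, es, hE₂, hes⟩
  have hlen := hE₂.length_le
  apply wp_seq
  refine WP.mono (Q := fun τ σ' => τ ≤ 20 ∧ σ'.nreg 14 = 0 ∧ σ'.nreg 15 = es.length ∧
    σ'.out = σ.out ++ [es.length]) ?_ ?_
  · apply wp_seq; apply wp_emit; apply wp_seq; apply wp_nset; apply wp_nset
    have : σ₂.out = σ.out := by rw [hF₂.out rfl, hF₁.out rfl]
    simp [NExpr.eval, NExpr.cost, hE₂.count, this]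
  rintro τ₃ σ₃ hF₃ ⟨hτ₃, t14, t15, hout⟩
  have hE₃ := hE₂.of_fr hF₃ (Logs.of_fr hF₃ (by decide) (by decide) (by decide) (by decide))
    (by decide) (by decide)
  refine (wp_emitRange 24).mono ?_
  rintro τ₄ σ₄ hF₄ ⟨hτ₄, hout'⟩
  have hE₄ := hE₃.of_fr hF₄ (Logs.of_fr hF₄ (by decide) (by decide) (by decide) (by decide))
    (by decide) (by decide)
  obtain ⟨A', U', seq', hQ', hA', hU'⟩ := hE₄.inv
  refine ⟨?_, es, A', U', seq', hE₄.nodup, hes, hQ', hA', by omega, ?_⟩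
  · rw [t15] at hτ₄
    rw [expandTime]
    linarith
  · rw [hout', hout, t14, t15, hE₃.ext.map_range, encodeEdges_eq, List.append_assoc]
    rfl

end KSSP

namespace KSSP

open Network

variable {N : Network} {k : ℕ} {T₀ : N.Tree} {σ σ' : Store} {q : N.Seq} {x : ℕ}
  {A U : Finset ℕ} {seq : ℕ → N.Seq}

/-! ### One iteration -/

theorem edges_card_le {F : Finset (Fin N.m)} : F.card ≤ N.m := by
  simpa using Finset.card_le_univ F

/-- Extract a record with the least key from the queue; it is put into the register `23`. -/
def pop : Prog :=
  (.nset 23 (.get 13 (.lit 1)) ;; .nput 12 (.reg 23) (.lit 0) ;; .nset 5 (.reg 23)) ;; sift 9 2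

theorem QInv.eq_empty (h : QInv N k T₀ σ A U seq) (hb : σ.narr 13 1 = 0) : A = ∅ := by
  by_contra hA
  obtain ⟨y, hy⟩ := Finset.nonempty_iff_ne_empty.2 hA
  have h₁ := h.mem y hy
  exact (h.ok.root h.forest h₁.1 h₁.2 ((h.act y h₁.1 h₁.2).2 hy)).1 hb

theorem wp_pop (h : QInv N k T₀ σ A U seq) (hb : σ.narr 13 1 ≠ 0) :
    WP pop σ fun τ σ' => τ ≤ N.m * 100 + 150 ∧ ∃ x ∈ A, σ'.nreg 23 = x ∧
      (∀ y ∈ A, N.length (path T₀ (seq x)) ≤ N.length (path T₀ (seq y))) ∧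
      QInv N k T₀ σ' (A.erase x) (U.erase x) seq ∧ RecAt T₀ σ' x (seq x) ∧ 1 ≤ x ∧
      x ≤ σ'.nreg 22 ∧ σ'.narr 12 x = 0 ∧ σ'.narr 10 x = 0 ∧
      ∃ F : Finset (Fin N.m), (∀ f ∈ F, N.tail f ∈ devNodes T₀ (seq x)) ∧
        (σ'.narr 9)^[F.card + 1] x = 0 := by
  set x := σ.narr 13 1 with hx
  have hmem := (h.ok 1 le_rfl h.pos).mem hb
  have hpos : 1 ≤ x := Nat.one_le_iff_ne_zero.2 hb
  have hle : x ≤ σ.nreg 22 := hmem.2.1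
  have hxA : x ∈ A := (h.act x hpos hle).1 hmem.1
  obtain ⟨F, hF, hdep⟩ := h.dep x hxA
  apply wp_seq
  refine WP.mono (Q := fun τ σ' => τ ≤ 20 ∧ σ'.nreg 23 = x ∧ σ'.nreg 5 = x ∧
    σ'.narr 12 = Function.update (σ.narr 12) x 0) ?_ ?_
  · apply wp_seq; apply wp_nset; apply wp_seq; apply wp_nput; apply wp_nset
    simp [NExpr.eval, NExpr.cost, ← hx]
  rintro τ₁ σ₁ hF₁ ⟨hτ₁, s23, s5, s12⟩
  refine (wp_sift_change 9 2 (y := x) (a := 0) (q := σ.rarr 2 x) h.forest h.ok ?_ s5 hle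
    hdep).mono ?_
  · simp [Store.tour, s12, hF₁.narr 9 rfl, hF₁.narr 10 rfl, hF₁.narr 11 rfl, hF₁.narr 13 rfl,
      hF₁.rarr 2 rfl]
  rintro τ₂ σ₂ hF₂ ⟨hτ₂, hf, ho, -⟩
  have hL : Logs σ σ₂ := (Logs.of_fr hF₁ (by decide) (by decide) (by decide) (by decide)).trans
    (Logs.of_fr hF₂ (by decide) (by decide) (by decide) (by decide))
  have hr : Ready N k σ₂ := (h.ready.of_fr hF₁ (by decide) (by decide) (by decide)).of_fr hF₂
    (by decide) (by decide) (by decide)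
  have t22 : σ₂.nreg 22 = σ.nreg 22 := by rw [hF₂.nreg 22 rfl, hF₁.nreg 22 rfl]
  have t12 : σ₂.narr 12 = Function.update (σ.narr 12) x 0 := by rw [hF₂.narr 12 rfl, s12]
  have t10 : σ₂.narr 10 = σ.narr 10 := by rw [hF₂.narr 10 rfl, hF₁.narr 10 rfl]
  have t9 : σ₂.narr 9 = σ.narr 9 := by rw [hF₂.narr 9 rfl, hF₁.narr 9 rfl]
  have hrec : ∀ y ∈ A, RecAt T₀ σ₂ y (seq y) := fun y hy => (h.record y hy).mono hL
    (fun a ha ha' => by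
      rw [hF₂.narr a (by interval_cases a <;> rfl), hF₁.narr a (by interval_cases a <;> rfl)])
    (by rw [hF₂.rarr 2 rfl, hF₁.rarr 2 rfl])
  refine ⟨?_, x, hxA, by rw [hF₂.nreg 23 rfl, s23], fun y hy => ?_, ?_, hrec x hxA, hpos,
    by omega, by rw [t12, Function.update_self], by rw [t10, h.leaf x hxA], F, hF, by rw [t9, hdep]⟩
  · have := edges_card_le (F := F)
    omega
  · have h₁ := h.mem y hy
    have h₂ := (h.ok.root h.forest h₁.1 h₁.2 ((h.act y h₁.1 h₁.2).2 hy)).2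
    change σ.rarr 2 x ≤ σ.rarr 2 y at h₂
    rw [(h.record x hxA).key, (h.record y hy).key] at h₂
    exact_mod_cast h₂
  · refine ⟨hr, by rw [t22]; exact h.pos, by rw [t22]; exact hf, by rw [t22]; exact ho, ?_, ?_, ?_,
      fun y hy => hrec y (Finset.mem_of_mem_erase hy), ?_, ?_, Finset.erase_subset_erase _ h.sub⟩
    · rw [t22]; exact fun y hy => h.mem y (Finset.mem_of_mem_erase hy)
    · intro y hy hy'
      rw [t22] at hy'
      rw [t12, Finset.mem_erase, Function.update_apply]
      split_ifs with hyx
      · simp [hyx]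
      · rw [h.act y hy hy']; simp [hyx]
    · rw [t10]; exact fun y hy => h.leaf y (Finset.mem_of_mem_erase hy)
    · rw [t9]; exact fun y hy => h.dep y (Finset.mem_of_mem_erase hy)
    · intro y hy hyU
      refine h.simple y (Finset.mem_of_mem_erase hy) fun hyU' => hyU ?_
      exact Finset.mem_erase.2 ⟨(Finset.mem_erase.1 hy).1, hyU'⟩

/-- Write the number `c`, and then the path of the record in the register `23`. -/
def emitPath (c : ℕ) : Prog :=
  (.emit (.lit c) ;; .nset 14 (.get 18 (.reg 23)) ;; .nset 15 (.get 19 (.reg 23)) ;;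
    .emit (.reg 15)) ;; emitRange 17

theorem wp_emitPath (c : ℕ) (h : RecAt T₀ σ x q) (hx : σ.nreg 23 = x) :
    WP (emitPath c) σ fun τ σ' => τ ≤ N.n * 40 + 40 ∧
      σ'.out = σ.out ++ c :: encodeEdges (path T₀ q) := by
  apply wp_seq
  refine WP.mono (Q := fun τ σ' => τ ≤ 20 ∧ σ'.nreg 14 = σ.narr 18 x ∧
    σ'.nreg 15 = (path T₀ q).length ∧ σ'.out = σ.out ++ [c, (path T₀ q).length]) ?_ ?_
  · apply wp_seq; apply wp_emit; apply wp_seq; apply wp_nset; apply wp_seq; apply wp_nset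
    apply wp_emit
    simp [NExpr.eval, NExpr.cost, hx, h.plen]
  rintro τ₁ σ₁ hF₁ ⟨hτ₁, s14, s15, hout⟩
  refine (wp_emitRange 17).mono ?_
  rintro τ₂ σ₂ hF₂ ⟨hτ₂, hout₂⟩
  constructor
  · rw [s15] at hτ₂
    have := h.good.length_path_le
    omega
  · rw [hout₂, s15, s14, hF₁.narr 17 rfl, h.path.map_range, hout, encodeEdges_eq]
    simp

/-- Write the tree with the address in the register `19`. -/
def emitTree : Prog := (.nset 14 (.reg 19) ;; .nset 15 (.reg 0)) ;; emitRange 16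

theorem wp_emitTree (hr : Ready N k σ) {T : N.Tree} (hT : TreeAt (σ.narr 16) (σ.nreg 19) T) :
    WP emitTree σ fun τ σ' => τ ≤ N.n * 20 + 30 ∧ σ'.out = σ.out ++ encodeTree T := by
  apply wp_seq
  refine WP.mono (Q := fun τ σ' => τ ≤ 10 ∧ σ'.nreg 14 = σ.nreg 19 ∧ σ'.nreg 15 = N.n) ?_ ?_
  · apply wp_seq; apply wp_nset; apply wp_nset
    simp [NExpr.eval, NExpr.cost, hr.n]
  rintro τ₁ σ₁ hF₁ ⟨hτ₁, s14, s15⟩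
  refine (wp_emitRange 16).mono ?_
  rintro τ₂ σ₂ hF₂ ⟨hτ₂, hout₂⟩
  constructor
  · rw [s15] at hτ₂; omega
  · rw [hout₂, s15, s14, hF₁.narr 16 rfl, hT.map_range, hF₁.out rfl]

/-- Write the number `c`, the path of the record in the register `23`, and the tree with the
address in the register `19`. -/
def emitRepair (c : ℕ) : Prog := emitPath c ;; emitTree

theorem wp_emitRepair (c : ℕ) (hr : Ready N k σ) (h : RecAt T₀ σ x q) (hx : σ.nreg 23 = x)
    {T : N.Tree} (hT : TreeAt (σ.narr 16) (σ.nreg 19) T) :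
    WP (emitRepair c) σ fun τ σ' => τ ≤ N.n * 60 + 70 ∧
      σ'.out = σ.out ++ c :: (encodeEdges (path T₀ q) ++ encodeTree T) := by
  apply wp_seq
  refine (wp_emitPath c h hx).mono ?_
  rintro τ₂ σ₂ hF₂ ⟨hτ₂, hout₂⟩
  refine (wp_emitTree (T := T) (hr.of_fr hF₂ (show ∀ x < 5, (emitPath 0).wN x = false by decide)
    (show ∀ a < 7, (emitPath 0).wNA a = false by decide)
    (show (emitPath 0).wRA 0 = false by decide)) ?_).mono ?_
  · rw [hF₂.narr 16 rfl, hF₂.nreg 19 rfl]; exact hT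
  · rintro τ₃ σ₃ hF₃ ⟨hτ₃, hout₃⟩
    exact ⟨by omega, by rw [hout₃, hout₂]; simp⟩

/-- Insert the record in the register `23` into the queue again; its tree is replaced by the tree
with the address in the register `19`. -/
def requeue : Prog :=
  (.nset 14 (.get 18 (.reg 23)) ;; .nset 15 (.get 20 (.reg 23)) ;; .nset 32 (.reg 20)) ;;
  makePath ;;
  (.nput 18 (.reg 23) (.reg 32) ;; .nput 19 (.reg 23) (.sub (.reg 20) (.reg 32)) ;;
    .nput 22 (.reg 23) (.reg 19) ;; .nput 12 (.reg 23) (.lit 1) ;; .rput 2 (.reg 23) (.reg 0) ;;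
    .nset 5 (.reg 23)) ;;
  sift 9 2

theorem wp_requeue {e : Fin N.m} {T T' : N.Tree} {F : Finset (Fin N.m)}
    (h : QInv N k T₀ σ A U seq) (hR : RecAt T₀ σ x ((e, T') :: q)) (hpos : 1 ≤ x)
    (hle : x ≤ σ.nreg 22) (hact : σ.narr 12 x = 0) (hleaf : σ.narr 10 x = 0)
    (hF : ∀ f ∈ F, N.tail f ∈ prefixNodes T₀ q e) (hdep : (σ.narr 9)^[F.card + 1] x = 0)
    (hT : IsSPTree (prefixNodes T₀ q e) T) (hi : InTree T (N.head e))
    (hTA : TreeAt (σ.narr 16) (σ.nreg 19) T) (h19 : σ.nreg 19 + N.n ≤ σ.nreg 8)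
    (h23 : σ.nreg 23 = x) (h31 : σ.nreg 31 = e) :
    WP requeue σ fun τ σ' => τ ≤ N.n * 80 + N.m * 100 + 300 ∧
      QInv N k T₀ σ' (insert x A) U (Function.update seq x ((e, T) :: q)) := by
  obtain ⟨hg, hsim⟩ := hR.good.repaired hT hi
  obtain ⟨h20, T₁, hT₁, hTA₁, htop₁⟩ := hR.side e T' q rfl
  obtain ⟨p', hp'⟩ := hi
  have hpath : path T₀ ((e, T) :: q) = trunk T₀ q (N.tail e) ++ e :: p' := by
    rw [← hp'.follow_eq hg.root]; rfl
  have hxA : x ∉ A := fun hh => (h.act x hpos hle).2 hh hact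
  -- The prefix path is copied from the stored path.
  have hold : PathAt (σ.narr 17) (σ.narr 18 x) (trunk T₀ q (N.tail e)) := by
    have h₁ := hR.path.take (trunk T₀ q (N.tail e)).length
    have h₂ : path T₀ ((e, T') :: q) = trunk T₀ q (N.tail e) ++ _ := rfl
    rwa [h₂, List.take_left] at h₁
  have hlen : (trunk T₀ q (N.tail e)).length ≤ σ.narr 19 x := by
    rw [hR.plen]
    have h₂ : path T₀ ((e, T') :: q) = trunk T₀ q (N.tail e) ++ _ := rfl
    rw [h₂, List.length_append]; omega
  apply wp_seq
  refine WP.mono (Q := fun τ σ' => τ ≤ 20 ∧ σ'.nreg 14 = σ.narr 18 x ∧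
    σ'.nreg 15 = (trunk T₀ q (N.tail e)).length ∧ σ'.nreg 32 = σ.nreg 20) ?_ ?_
  · apply wp_seq; apply wp_nset; apply wp_seq; apply wp_nset; apply wp_nset
    simp [NExpr.eval, NExpr.cost, h23, h20]
  rintro τ₁ σ₁ hF₁ ⟨hτ₁, s14, s15, s32⟩
  have s20 : σ₁.nreg 20 = σ.nreg 20 := hF₁.nreg 20 rfl
  have htop := hR.top
  apply wp_seq
  refine (wp_makePath (h.ready.of_fr hF₁ (by decide) (by decide) (by decide))
    (p := trunk T₀ q (N.tail e)) (e := e) (T := T) (p' := p') ?_ s15 (by omega) ?_ ?_ hg.root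
    hp').mono ?_
  · rw [hF₁.narr 17 rfl, s14]; exact hold
  · rw [hF₁.nreg 31 rfl, h31]
  · rw [hF₁.narr 16 rfl, hF₁.nreg 19 rfl]; exact hTA
  rw [← hpath]
  rintro τ₂ σ₂ hF₂ ⟨hτ₂, u20, hP, hlow, hacc⟩
  rw [s20] at u20 hP hlow
  rw [hF₁.narr 17 rfl] at hlow
  have s23 : σ₂.nreg 23 = x := by rw [hF₂.nreg 23 rfl, hF₁.nreg 23 rfl, h23]
  have s19 : σ₂.nreg 19 = σ.nreg 19 := by rw [hF₂.nreg 19 rfl, hF₁.nreg 19 rfl]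
  have s22 : σ₂.nreg 22 = σ.nreg 22 := by rw [hF₂.nreg 22 rfl, hF₁.nreg 22 rfl]
  have hL₂ : Logs σ σ₂ := by
    refine ⟨?_, by omega, ?_, hlow⟩
    · rw [hF₂.nreg 8 rfl, hF₁.nreg 8 rfl]
    · rw [hF₂.narr 16 rfl, hF₁.narr 16 rfl]; exact fun _ _ => rfl
  have sa : ∀ a, (9 ≤ a ∧ a ≤ 13) ∨ (18 ≤ a ∧ a ≤ 23) → σ₂.narr a = σ.narr a := by
    rintro a (⟨ha, ha'⟩ | ⟨ha, ha'⟩) <;>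
      rw [hF₂.narr a (by interval_cases a <;> rfl), hF₁.narr a (by interval_cases a <;> rfl)]
  have sk : σ₂.rarr 2 = σ.rarr 2 := by rw [hF₂.rarr 2 rfl, hF₁.rarr 2 rfl]
  apply wp_seq
  refine WP.mono (Q := fun τ σ' => τ ≤ 40 ∧ σ'.nreg 5 = x ∧
    σ'.narr 18 = Function.update (σ.narr 18) x (σ.nreg 20) ∧
    σ'.narr 19 = Function.update (σ.narr 19) x (path T₀ ((e, T) :: q)).length ∧
    σ'.narr 22 = Function.update (σ.narr 22) x (σ.nreg 19) ∧
    σ'.narr 12 = Function.update (σ.narr 12) x 1 ∧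
    σ'.rarr 2 = Function.update (σ.rarr 2) x (N.length (path T₀ ((e, T) :: q)))) ?_ ?_
  · apply wp_seq; apply wp_nput; apply wp_seq; apply wp_nput; apply wp_seq; apply wp_nput
    apply wp_seq; apply wp_nput; apply wp_seq; apply wp_rput; apply wp_nset
    have s32' : σ₂.nreg 32 = σ.nreg 20 := by rw [hF₂.nreg 32 rfl, s32]
    simp [NExpr.eval, RExpr.eval, NExpr.cost, RExpr.cost, s23, s19, s32', u20, hacc, sa, sk]
  rintro τ₃ σ₃ hF₃ ⟨hτ₃, t5, t18, t19, t22, t12, tk⟩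
  have t9 : σ₃.narr 9 = σ.narr 9 := by rw [hF₃.narr 9 rfl, sa 9 (by norm_num)]
  have t10 : σ₃.narr 10 = σ.narr 10 := by rw [hF₃.narr 10 rfl, sa 10 (by norm_num)]
  refine (wp_sift_change 9 2 (y := x) (a := 1) (q := N.length (path T₀ ((e, T) :: q))) h.forest
    h.ok ?_ t5 hle hdep).mono ?_
  · simp [Store.tour, t9, t10, t12, tk, hF₃.narr 11 rfl, hF₃.narr 13 rfl, sa]
  rintro τ₄ σ₄ hF₄ ⟨hτ₄, hf, ho, -⟩
  have hL : Logs σ σ₄ := (hL₂.trans (Logs.of_fr hF₃ (by decide) (by decide) (by decide)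
    (by decide))).trans (Logs.of_fr hF₄ (by decide) (by decide) (by decide) (by decide))
  have hr : Ready N k σ₄ := (((h.ready.of_fr hF₁ (by decide) (by decide) (by decide)).of_fr hF₂
    (by decide) (by decide) (by decide)).of_fr hF₃ (by decide) (by decide) (by decide)).of_fr hF₄
    (by decide) (by decide) (by decide)
  have v22 : σ₄.nreg 22 = σ.nreg 22 := by rw [hF₄.nreg 22 rfl, hF₃.nreg 22 rfl, s22]
  have v12 : σ₄.narr 12 = Function.update (σ.narr 12) x 1 := by rw [hF₄.narr 12 rfl, t12]
  have v10 : σ₄.narr 10 = σ.narr 10 := by rw [hF₄.narr 10 rfl, t10]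
  have v9 : σ₄.narr 9 = σ.narr 9 := by rw [hF₄.narr 9 rfl, t9]
  have v18 : σ₄.narr 18 x = σ.nreg 20 := by rw [hF₄.narr 18 rfl, t18, Function.update_self]
  have v19 : σ₄.narr 19 x = (path T₀ ((e, T) :: q)).length := by
    rw [hF₄.narr 19 rfl, t19, Function.update_self]
  have vt : σ₄.narr 22 x = σ.nreg 19 := by rw [hF₄.narr 22 rfl, t22, Function.update_self]
  have v17 : σ₄.narr 17 = σ₂.narr 17 := by rw [hF₄.narr 17 rfl, hF₃.narr 17 rfl]
  have v20 : σ₄.narr 20 = σ.narr 20 := by rw [hF₄.narr 20 rfl, hF₃.narr 20 rfl, sa 20 (by norm_num)]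
  have v21 : σ₄.narr 21 = σ.narr 21 := by rw [hF₄.narr 21 rfl, hF₃.narr 21 rfl, sa 21 (by norm_num)]
  have v23 : σ₄.narr 23 = σ.narr 23 := by rw [hF₄.narr 23 rfl, hF₃.narr 23 rfl, sa 23 (by norm_num)]
  have vtop : σ₄.nreg 20 = σ₂.nreg 20 := by rw [hF₄.nreg 20 rfl, hF₃.nreg 20 rfl]
  have hrecx : RecAt T₀ σ₄ x ((e, T) :: q) := by
    refine ⟨hg, by rw [v17, v18]; exact hP, v19, by rw [v18, v19, vtop, u20], ?_, ?_, ?_, ?_, ?_⟩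
    · rw [hF₄.rarr 2 rfl, tk, Function.update_self]
    · rw [vt]; exact hTA.logs h19 hL
    · rw [vt]; exact h19.trans hL.treeTop
    · rw [v21, hR.edge]; rfl
    · rintro e₁ T₂ q₁ ⟨⟩
      rw [v20, v23]
      exact ⟨h20, T₁, hT₁, hTA₁.logs htop₁ hL, htop₁.trans hL.treeTop⟩
  have hne : ∀ y ∈ A, y ≠ x := fun y hy hyx => hxA (hyx ▸ hy)
  refine ⟨?_, ⟨hr, by rw [v22]; exact h.pos, by rw [v22]; exact hf, by rw [v22]; exact ho, ?_, ?_, ?_,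
    ?_, ?_, ?_, h.sub.trans (Finset.subset_insert _ _)⟩⟩
  · have h₁ := edges_card_le (F := F)
    have h₂ := length_lt_of_nodup (hg.pre e T q rfl).2.1
    have h₃ := hp'.length_lt hg.root
    omega
  · intro y hy
    rw [v22]
    rcases Finset.mem_insert.1 hy with rfl | hy
    · exact ⟨hpos, hle⟩
    · exact h.mem y hy
  · intro y hy hy'
    rw [v22] at hy'
    rw [v12, Finset.mem_insert, Function.update_apply]
    split_ifs with hyx
    · simp [hyx]
    · rw [h.act y hy hy']; simp [hyx]
  · intro y hy
    rw [v10]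
    rcases Finset.mem_insert.1 hy with rfl | hy
    · exact hleaf
    · exact h.leaf y hy
  · intro y hy
    rcases Finset.mem_insert.1 hy with rfl | hy
    · rw [Function.update_self]; exact hrecx
    · rw [Function.update_of_ne (hne y hy)]
      refine (h.record y hy).mono hL (fun a ha ha' => ?_) ?_
      · rw [hF₄.narr a (by interval_cases a <;> rfl)]
        interval_cases a
        · rw [t18, Function.update_of_ne (hne y hy)]
        · rw [t19, Function.update_of_ne (hne y hy)]
        · rw [hF₃.narr 20 rfl, sa 20 (by norm_num)]
        · rw [hF₃.narr 21 rfl, sa 21 (by norm_num)]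
        · rw [t22, Function.update_of_ne (hne y hy)]
        · rw [hF₃.narr 23 rfl, sa 23 (by norm_num)]
      · rw [hF₄.rarr 2 rfl, tk, Function.update_of_ne (hne y hy)]
  · intro y hy
    rw [v9]
    rcases Finset.mem_insert.1 hy with rfl | hy
    · rw [Function.update_self]; exact ⟨F, hF, hdep⟩
    · rw [Function.update_of_ne (hne y hy)]; exact h.dep y hy
  · intro y hy hyU
    rcases Finset.mem_insert.1 hy with rfl | hy
    · rw [Function.update_self]; exact hsim
    · rw [Function.update_of_ne (hne y hy)]; exact h.simple y hy hyU

/-- The record in the register `23` represents a path that is not simple: replace its tree, and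
insert it into the queue again, unless the new tree does not contain the head of the last
sidetrack. -/
def repair : Prog :=
  (.nset 19 (.get 23 (.reg 23)) ;; .nset 31 (.sub (.get 21 (.reg 23)) (.lit 1)) ;;
    .nset 18 (.get 1 (.reg 31))) ;;
  .ite (.and (.not (.neq (.reg 18) (.reg 4))) (.neq (.get 16 (.add (.reg 19) (.reg 18))) (.lit 0)))
    (emitRepair 3) (emitRepair 2 ;; requeue)

/-- A bound for the time of `repair`. -/
def repairTime (N : Network) : ℕ := N.n * 140 + N.m * 100 + 500

/-- The new tree has been computed when the record was created; it only has to be looked up. -/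
theorem wp_repair {e : Fin N.m} {T' : N.Tree} {F : Finset (Fin N.m)}
    (h : QInv N k T₀ σ A U seq) (hR : RecAt T₀ σ x ((e, T') :: q)) (hpos : 1 ≤ x)
    (hle : x ≤ σ.nreg 22) (hact : σ.narr 12 x = 0) (hleaf : σ.narr 10 x = 0)
    (hF : ∀ f ∈ F, N.tail f ∈ prefixNodes T₀ q e) (hdep : (σ.narr 9)^[F.card + 1] x = 0)
    (h23 : σ.nreg 23 = x) :
    WP repair σ fun τ σ' => τ ≤ repairTime N ∧ ∃ T, IsSPTree (prefixNodes T₀ q e) T ∧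
      ((InTree T (N.head e) ∧
        QInv N k T₀ σ' (insert x A) U (Function.update seq x ((e, T) :: q)) ∧
        σ'.out = σ.out ++ encodeEvent T₀ (.repaired ((e, T') :: q) T)) ∨
      (¬ InTree T (N.head e) ∧ QInv N k T₀ σ' A U seq ∧
        σ'.out = σ.out ++ encodeEvent T₀ (.discarded ((e, T') :: q) T))) := by
  obtain ⟨h20, T, hT, hTA, htop⟩ := hR.side e T' q rfl
  have hin := hT.inTree_iff (hR.good.pre e T' q rfl).2.2 (N.head e)
  apply wp_seq
  refine WP.mono (Q := fun τ σ' => τ ≤ 20 ∧ σ'.nreg 19 = σ.narr 23 x ∧ σ'.nreg 31 = e ∧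
    σ'.nreg 18 = N.head e) ?_ ?_
  · apply wp_seq; apply wp_nset; apply wp_seq; apply wp_nset; apply wp_nset
    simp [NExpr.eval, NExpr.cost, h23, hR.edge, enc, h.ready.head]
  rintro τ₁ σ₁ hF₁ ⟨hτ₁, s19, s31, s18⟩
  have hL₁ : Logs σ σ₁ := Logs.of_fr hF₁ (by decide) (by decide) (by decide) (by decide)
  have hk₁ := QInv.and_of_fr ⟨h, hR⟩ hF₁ (by decide)
  have hTA₁ : TreeAt (σ₁.narr 16) (σ₁.nreg 19) T := by rw [s19]; exact hTA.logs htop hL₁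
  have htop₁ : σ₁.nreg 19 + N.n ≤ σ₁.nreg 8 := by rw [s19]; exact htop.trans hL₁.treeTop
  have h23₁ : σ₁.nreg 23 = x := by rw [hF₁.nreg 23 rfl, h23]
  have hin' : (Test.Holds σ₁ (.and (.not (.neq (.reg 18) (.reg 4)))
      (.neq (.get 16 (.add (.reg 19) (.reg 18))) (.lit 0)))) ↔ ¬ InTree T (N.head e) := by
    rw [hin]
    simp only [Test.Holds, NExpr.eval, s18, hk₁.1.ready.t, hTA₁ (N.head e), enc_eq_zero,
      ← Fin.ext_iff]
    tauto
  have hout₁ : σ₁.out = σ.out := hF₁.out rfl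
  apply wp_ite <;> intro hb
  · have hn := hin'.1 hb
    refine (wp_emitRepair 3 hk₁.1.ready hk₁.2 h23₁ hTA₁).mono ?_
    rintro τ₂ σ₂ hF₂ ⟨hτ₂, hout₂⟩
    refine ⟨?_, T, hT, Or.inr ⟨hn, ?_, by rw [hout₂, hout₁]; rfl⟩⟩
    · simp only [Test.cost, NExpr.cost, repairTime]
      omega
    · exact hk₁.1.of_fr hF₂ (Logs.of_fr hF₂ (by decide) (by decide) (by decide) (by decide))
        (by decide)
  · have hn := not_not.1 fun hh => hb (hin'.2 hh)
    apply wp_seq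
    refine (wp_emitRepair 2 hk₁.1.ready hk₁.2 h23₁ hTA₁).mono ?_
    rintro τ₂ σ₂ hF₂ ⟨hτ₂, hout₂⟩
    have hL₂ : Logs σ₁ σ₂ := Logs.of_fr hF₂ (by decide) (by decide) (by decide) (by decide)
    have hk₂ := QInv.and_of_fr hk₁ hF₂ (by decide)
    have t19 : σ₂.nreg 19 = σ₁.nreg 19 := hF₂.nreg 19 rfl
    refine (wp_requeue hk₂.1 hk₂.2 hpos ?_ ?_ ?_ hF ?_ hT hn ?_ ?_ ?_ ?_).mono ?_
    · rw [hF₂.nreg 22 rfl, hF₁.nreg 22 rfl]; exact hle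
    · rw [hF₂.narr 12 rfl, hF₁.narr 12 rfl]; exact hact
    · rw [hF₂.narr 10 rfl, hF₁.narr 10 rfl]; exact hleaf
    · rw [hF₂.narr 9 rfl, hF₁.narr 9 rfl]; exact hdep
    · rw [t19]; exact hTA₁.logs htop₁ hL₂
    · rw [t19]; exact htop₁.trans hL₂.treeTop
    · rw [hF₂.nreg 23 rfl, h23₁]
    · rw [hF₂.nreg 31 rfl, s31]
    · rintro τ₃ σ₃ hF₃ ⟨hτ₃, hQ₃⟩
      refine ⟨?_, T, hT, Or.inl ⟨hn, hQ₃, by rw [hF₃.out rfl, hout₂, hout₁]; rfl⟩⟩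
      simp only [Test.cost, NExpr.cost, repairTime]
      omega

end KSSP

namespace KSSP

open Network

variable {N : Network} {k : ℕ} {T₀ : N.Tree} {σ σ' : Store} {q : N.Seq} {x : ℕ}
  {A U : Finset ℕ} {seq : ℕ → N.Seq}

theorem Network.Steps.snoc {a b d : N.State} {evs : List N.Event} {ev : N.Event}
    (h : Steps T₀ k a evs b) (h' : Step T₀ k b ev d) : Steps T₀ k a (evs ++ [ev]) d := by
  induction h with
  | nil a => exact .cons h' (.nil _)
  | cons h₁ _ ih => exact .cons h₁ (ih h')

/-- The path of the empty sequence is a path in a tree. -/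
theorem Network.Good.isSimple_nil (h : Good T₀ ([] : N.Seq)) : N.IsSimple N.s (path T₀ []) := by
  have := h.suffix.nodup h.root
  rw [path_eq]
  exact this

/-- One iteration of the basic algorithm. -/
def iterate : Prog :=
  pop ;; (.nset 14 (.get 18 (.reg 23)) ;; .nset 15 (.get 19 (.reg 23))) ;; checkSimple ;;
  .ite (.neq (.reg 24) (.lit 1)) (.nset 21 (.add (.reg 21) (.lit 1)) ;; emitPath 1 ;; expand) repair

/-- A bound for the time of `iterate`, without `expand` and `repair`. -/
def overhead (N : Network) : ℕ := N.n * 120 + N.m * 100 + 300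

/-- An iteration either outputs a path and adds at most `m` records whose tree has not been
replaced, or removes such a record. -/
theorem wp_iterate (h : QInv N k T₀ σ A U seq) (hb : σ.narr 13 1 ≠ 0) (hk : σ.nreg 21 < k) :
    WP iterate σ fun τ σ' => ∃ (ev : N.Event) (A' U' : Finset ℕ) (seq' : ℕ → N.Seq),
      Step T₀ k ⟨A.val.map seq, σ.nreg 21⟩ ev ⟨A'.val.map seq', σ'.nreg 21⟩ ∧
      QInv N k T₀ σ' A' U' seq' ∧ σ'.out = σ.out ++ encodeEvent T₀ ev ∧
      ((σ'.nreg 21 = σ.nreg 21 + 1 ∧ U'.card ≤ U.card + N.m ∧ τ ≤ overhead N + expandTime N) ∨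
        (σ'.nreg 21 = σ.nreg 21 ∧ U'.card + 1 ≤ U.card ∧ τ ≤ overhead N + repairTime N)) := by
  apply wp_seq
  refine (wp_pop h hb).mono ?_
  rintro τ₁ σ₁ hF₁ ⟨hτ₁, x, hxA, s23, hmin, hQ₁, hR₁, hpos, hle, hact, hleaf, F, hF, hdep⟩
  have hqueue : A.val.map seq = seq x ::ₘ (A.erase x).val.map seq := by
    rw [← Multiset.map_cons, Finset.erase_val, Multiset.cons_erase hxA]
  have hmin' : ∀ q' ∈ (A.erase x).val.map seq,
      N.length (path T₀ (seq x)) ≤ N.length (path T₀ q') := by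
    intro q' hq'
    obtain ⟨y, hy, rfl⟩ := Multiset.mem_map.1 hq'
    exact hmin y (Finset.mem_of_mem_erase hy)
  have hsimpleU : x ∉ U → N.IsSimple N.s (path T₀ (seq x)) := h.simple x hxA
  generalize hq : seq x = q at *
  have hlen := hR₁.good.length_path_le
  apply wp_seq
  refine WP.mono (Q := fun τ σ' => τ ≤ 20 ∧ σ'.nreg 14 = σ₁.narr 18 x ∧
    σ'.nreg 15 = (path T₀ q).length) ?_ ?_
  · apply wp_seq; apply wp_nset; apply wp_nset
    simp [NExpr.eval, NExpr.cost, s23, hR₁.plen]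
  rintro τ₂ σ₂ hF₂ ⟨hτ₂, s14, s15⟩
  have hk₂ := QInv.and_of_fr ⟨hQ₁, hR₁⟩ hF₂ (by decide)
  apply wp_seq
  refine (wp_checkSimple hk₂.1.ready (p := path T₀ q) ?_ s15).mono ?_
  · rw [s14, hF₂.narr 17 rfl]; exact hR₁.path
  rintro τ₃ σ₃ hF₃ ⟨hτ₃, hiff⟩
  have hk₃ := QInv.and_of_fr hk₂ hF₃ (by decide)
  have t23 : σ₃.nreg 23 = x := by rw [hF₃.nreg 23 rfl, hF₂.nreg 23 rfl, s23]
  have t22 : σ₃.nreg 22 = σ₁.nreg 22 := by rw [hF₃.nreg 22 rfl, hF₂.nreg 22 rfl]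
  have t21 : σ₃.nreg 21 = σ.nreg 21 := by
    rw [hF₃.nreg 21 rfl, hF₂.nreg 21 rfl, hF₁.nreg 21 rfl]
  have tout : σ₃.out = σ.out := by rw [hF₃.out rfl, hF₂.out rfl, hF₁.out rfl]
  have t12 : σ₃.narr 12 = σ₁.narr 12 := by rw [hF₃.narr 12 rfl, hF₂.narr 12 rfl]
  have t10 : σ₃.narr 10 = σ₁.narr 10 := by rw [hF₃.narr 10 rfl, hF₂.narr 10 rfl]
  have t9 : σ₃.narr 9 = σ₁.narr 9 := by rw [hF₃.narr 9 rfl, hF₂.narr 9 rfl]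
  apply wp_ite
  · intro hb
    have hs := hiff.1 hb
    apply wp_seq
    refine WP.mono (Q := fun τ σ' => τ = 4 ∧ σ'.nreg 21 = σ.nreg 21 + 1) ?_ ?_
    · apply wp_nset
      simp [NExpr.eval, NExpr.cost, t21]
    rintro τ₄ σ₄ hF₄ ⟨rfl, u21⟩
    have hk₄ := QInv.and_of_fr hk₃ hF₄ (by decide)
    apply wp_seq
    refine (wp_emitPath 1 hk₄.2 (by rw [hF₄.nreg 23 rfl, t23])).mono ?_
    rintro τ₅ σ₅ hF₅ ⟨hτ₅, hout₅⟩
    have hk₅ := QInv.and_of_fr hk₄ hF₅ (by decide)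
    refine (wp_expand hk₅.1 hk₅.2 hs hpos ?_ ?_ ?_ hF ?_ ?_).mono ?_
    · rw [hF₅.nreg 22 rfl, hF₄.nreg 22 rfl, t22]; exact hle
    · rw [hF₅.narr 12 rfl, hF₄.narr 12 rfl, t12]; exact hact
    · rw [hF₅.narr 10 rfl, hF₄.narr 10 rfl, t10]; exact hleaf
    · rw [hF₅.narr 9 rfl, hF₄.narr 9 rfl, t9]; exact hdep
    · rw [hF₅.nreg 23 rfl, hF₄.nreg 23 rfl, t23]
    rintro τ₆ σ₆ hF₆ ⟨hτ₆, es, A', U', seq', hnd, hes, hQ₆, hA', hU', hout₆⟩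
    have v21 : σ₆.nreg 21 = σ.nreg 21 + 1 := by rw [hF₆.nreg 21 rfl, hF₅.nreg 21 rfl, u21]
    refine ⟨.simple q es, A', U', seq', ?_, hQ₆, ?_, Or.inl ⟨v21, ?_, ?_⟩⟩
    · rw [hqueue, hA', v21]
      exact .simple q _ _ es hk hmin' hs hnd hes
    · rw [hout₆, hout₅, hF₄.out rfl, tout]
      simp [encodeEvent]
    · have := Finset.card_erase_le (s := U) (a := x)
      omega
    · simp only [Test.cost, NExpr.cost, overhead]
      omega
  · intro hb
    have hns : ¬ N.IsSimple N.s (path T₀ q) := fun hh => hb (hiff.2 hh)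
    -- A record outside of `U` would represent a simple path.
    have hxU : x ∈ U := by
      by_contra hh
      exact hns (hsimpleU hh)
    have hcard := Finset.card_erase_add_one hxU
    obtain _ | ⟨⟨e, T'⟩, q'⟩ := q
    · exact absurd hk₃.2.good.isSimple_nil hns
    refine (wp_repair hk₃.1 hk₃.2 hpos ?_ ?_ ?_ hF ?_ t23).mono ?_
    · rw [t22]; exact hle
    · rw [t12]; exact hact
    · rw [t10]; exact hleaf
    · rw [t9]; exact hdep
    rintro τ₄ σ₄ hF₄ ⟨hτ₄, T, hT, hcase⟩
    have u21 : σ₄.nreg 21 = σ.nreg 21 := by rw [hF₄.nreg 21 rfl, t21]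
    have htime : τ₁ + (τ₂ + (τ₃ + ((Test.neq (.reg 24) (.lit 1)).cost + τ₄ + 1))) ≤
        overhead N + repairTime N := by
      simp only [Test.cost, NExpr.cost, overhead]
      omega
    rcases hcase with ⟨hin, hQ₄, hout₄⟩ | ⟨hin, hQ₄, hout₄⟩
    · refine ⟨_, _, _, _, ?_, hQ₄, by rw [hout₄, tout], Or.inr ⟨u21, hcard.le, htime⟩⟩
      have hxe : x ∉ A.erase x := Finset.notMem_erase x A
      have : (insert x (A.erase x)).val.map (Function.update seq x ((e, T) :: q')) =
          ((e, T) :: q') ::ₘ (A.erase x).val.map seq := by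
        rw [Finset.insert_val_of_notMem hxe, Multiset.map_cons, Function.update_self]
        congr 1
        apply Multiset.map_congr rfl
        intro w hw
        rw [Function.update_of_ne]
        rintro rfl
        exact hxe hw
      rw [hqueue, this, u21]
      exact .repaired q' e T' T _ _ hk hmin' hns hT hin
    · refine ⟨_, _, _, _, ?_, hQ₄, by rw [hout₄, tout], Or.inr ⟨u21, hcard.le, htime⟩⟩
      rw [hqueue, u21]
      exact .discarded q' e T' T _ _ hk hmin' hns hT hin

/-! ### The whole program -/

/-- The main loop. -/
def mainLoop : Prog :=
  .loop (.and (.nlt (.reg 21) (.reg 2)) (.not (.neq (.get 13 (.lit 1)) (.lit 0)))) iterate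

/-- A bound for the time of an iteration that replaces a tree. -/
def repairCost (N : Network) : ℕ := overhead N + repairTime N + 20

/-- A bound for the time of an iteration that outputs a path, together with the iterations that
replace the trees of the extensions of this path. -/
def simpleCost (N : Network) : ℕ := overhead N + expandTime N + 20 + N.m * repairCost N

/-- The remaining time is bounded by the number of missing paths times `simpleCost`, plus the number
of records whose tree has not been replaced times `repairCost`. -/
theorem wp_mainLoop (h : QInv N k T₀ σ A ∅ seq) (hA : A.val.map seq = {[]})
    (h21 : σ.nreg 21 = 0) :
    WP mainLoop σ fun τ σ' => τ ≤ k * simpleCost N + 20 ∧ ∃ (evs : List N.Event) (b : N.State),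
      Steps T₀ k ⟨{[]}, 0⟩ evs b ∧ (b.found = k ∨ b.queue = 0) ∧
      σ'.out = σ.out ++ evs.flatMap (encodeEvent T₀) := by
  refine (wp_loop (fun p σ' => ∃ (A U : Finset ℕ) (seq : ℕ → N.Seq) (evs : List N.Event),
      QInv N k T₀ σ' A U seq ∧ Steps T₀ k ⟨{[]}, 0⟩ evs ⟨A.val.map seq, σ'.nreg 21⟩ ∧
      σ'.nreg 21 ≤ k ∧ σ'.out = σ.out ++ evs.flatMap (encodeEvent T₀) ∧
      p = (k - σ'.nreg 21) * simpleCost N + U.card * repairCost N + 20)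
    (Q := fun σ' => ∃ (evs : List N.Event) (b : N.State),
      Steps T₀ k ⟨{[]}, 0⟩ evs b ∧ (b.found = k ∨ b.queue = 0) ∧
      σ'.out = σ.out ++ evs.flatMap (encodeEvent T₀)) _
    ⟨A, ∅, seq, [], h, by rw [hA, h21]; exact .nil _, by omega, by simp, rfl⟩ ?_ ?_).mono ?_
  · rintro p σ₁ hF₁ ⟨A, U, seq, evs, hQ, hS, hle, hout, rfl⟩ hb
    obtain ⟨hlt, hne⟩ := hb
    simp only [NExpr.eval, hQ.ready.k, Test.Holds] at hlt hne
    refine (wp_iterate hQ hne hlt).mono ?_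
    rintro τ₂ σ₂ hF₂ ⟨ev, A', U', seq', hS', hQ', hout', hcase⟩
    have hcost : (Test.and (.nlt (.reg 21) (.reg 2)) (.not (.neq (.get 13 (.lit 1))
      (.lit 0)))).cost ≤ 15 := by decide
    refine ⟨_, ?_, A', U', seq', evs ++ [ev], hQ', hS.snoc hS', ?_, by rw [hout', hout]; simp, rfl⟩
    -- A simple path pays for the replacements of its at most `m` extensions, see `simpleCost`.
    · rcases hcase with ⟨h₁, h₂, h₃⟩ | ⟨h₁, h₂, h₃⟩
      · obtain ⟨d, hd⟩ : ∃ d, k - σ₁.nreg 21 = d + 1 := ⟨k - σ₁.nreg 21 - 1, by omega⟩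
        have h₄ := Nat.mul_le_mul_right (repairCost N) h₂
        rw [h₁, hd, show k - (σ₁.nreg 21 + 1) = d by omega, Nat.add_mul d, one_mul]
        rw [Nat.add_mul] at h₄
        have h₅ : simpleCost N = overhead N + expandTime N + 20 + N.m * repairCost N := rfl
        omega
      · have h₄ := Nat.mul_le_mul_right (repairCost N) h₂
        rw [Nat.add_mul, one_mul] at h₄
        have h₅ : repairCost N = overhead N + repairTime N + 20 := rfl
        rw [h₁]
        omega
    · rcases hcase with ⟨h₁, -⟩ | ⟨h₁, -⟩ <;> omega
  · rintro p σ₁ hF₁ ⟨A, U, seq, evs, hQ, hS, hle, hout, rfl⟩ hb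
    have hcost : (Test.and (.nlt (.reg 21) (.reg 2)) (.not (.neq (.get 13 (.lit 1))
      (.lit 0)))).cost ≤ 15 := by decide
    refine ⟨by omega, evs, _, hS, ?_, hout⟩
    simp only [Test.Holds, NExpr.eval, hQ.ready.k, not_and_or, not_not] at hb
    rcases hb with hb | hb
    · left; change σ₁.nreg 21 = k; omega
    · right
      change A.val.map seq = 0
      rw [hQ.eq_empty hb]; rfl
  · rintro τ₁ σ₁ hF₁ ⟨hτ₁, h₁⟩
    refine ⟨hτ₁.trans ?_, h₁⟩
    rw [h21]; simp

/-- Store the record `1` of the empty sequence. -/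
def initRoot : Prog :=
  (.nset 8 (.reg 0) ;; .nset 18 (.reg 3) ;; .rset 0 .zero) ;; followPart ;;
  .nset 22 (.lit 1) ;; .nput 19 (.lit 1) (.reg 20) ;; .nput 12 (.lit 1) (.lit 1) ;;
  .nput 13 (.lit 1) (.lit 1) ;; .rput 2 (.lit 1) (.reg 0)

theorem wp_initRoot (hr : Ready N k σ) (hg : Good T₀ ([] : N.Seq))
    (hT : TreeAt (σ.narr 16) 0 T₀) (h19 : σ.nreg 19 = 0)
    (h20 : σ.nreg 20 = 0) (ha : ∀ a ∈ [9, 10, 11, 12, 13, 18, 19, 20, 21, 22, 23], σ.narr a = 0) :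
    WP initRoot σ fun τ σ' => τ ≤ N.n * 40 + 80 ∧ QInv N k T₀ σ' {1} ∅ fun _ => [] := by
  apply wp_seq
  refine WP.mono (Q := fun τ σ' => τ ≤ 20 ∧ σ'.nreg 8 = N.n ∧ σ'.nreg 18 = N.s ∧ σ'.rreg 0 = 0)
    ?_ ?_
  · apply wp_seq; apply wp_nset; apply wp_seq; apply wp_nset; apply wp_rset
    simp [NExpr.eval, RExpr.eval, NExpr.cost, RExpr.cost, hr.n, hr.s]
  rintro τ₁ σ₁ hF₁ ⟨hτ₁, s8, s18, sacc⟩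
  have s19 : σ₁.nreg 19 = 0 := by rw [hF₁.nreg 19 rfl, h19]
  have s20 : σ₁.nreg 20 = 0 := by rw [hF₁.nreg 20 rfl, h20]
  apply wp_seq
  refine (wp_followPart (hr.of_fr hF₁ (by decide) (by decide) (by decide)) (T := T₀)
    (p := path T₀ []) ?_ hg.root ?_ s18).mono ?_
  · rw [s19, hF₁.narr 16 rfl]; exact hT
  · rw [path_eq]; exact hg.suffix
  rintro τ₂ σ₂ hF₂ ⟨hτ₂, hApp⟩
  have ha₂ : ∀ a ∈ [9, 10, 11, 12, 13, 18, 19, 20, 21, 22, 23], σ₂.narr a = 0 := by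
    intro a h₁
    rw [hF₂.narr a (by fin_cases h₁ <;> rfl), hF₁.narr a rfl, ha a h₁]
  have htop := hApp.top
  have hacc := hApp.acc
  have hpath := hApp.path
  rw [s20] at htop hpath
  rw [sacc] at hacc
  simp only [zero_add] at htop hacc
  have hT₂ : TreeAt (σ₂.narr 16) 0 T₀ := by
    rw [hF₂.narr 16 rfl, hF₁.narr 16 rfl]; exact hT
  have t8 : σ₂.nreg 8 = N.n := by rw [hF₂.nreg 8 rfl, s8]
  have hr₂ : Ready N k σ₂ := (hr.of_fr hF₁ (by decide) (by decide) (by decide)).of_fr hF₂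
    (by decide) (by decide) (by decide)
  refine WP.mono (Q := fun τ σ' => τ ≤ 30 ∧ σ'.nreg 22 = 1 ∧
    σ'.narr 19 1 = (path T₀ []).length ∧ σ'.narr 12 = Function.update (0 : ℕ → ℕ) 1 1 ∧
    σ'.narr 13 = Function.update (0 : ℕ → ℕ) 1 1 ∧ σ'.rarr 2 1 = N.length (path T₀ [])) ?_ ?_
  · apply wp_seq; apply wp_nset; apply wp_seq; apply wp_nput; apply wp_seq; apply wp_nput
    apply wp_seq; apply wp_nput; apply wp_rput
    simp [NExpr.eval, RExpr.eval, NExpr.cost, RExpr.cost, htop, hacc, ha₂]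
  rintro τ₃ σ₃ hF₃ ⟨hτ₃, u22, u19, u12, u13, uk⟩
  have ua : ∀ a, a ∈ [9, 10, 11, 18, 20, 21, 22, 23] → σ₃.narr a = 0 := by
    intro a h₁
    rw [hF₃.narr a (by fin_cases h₁ <;> rfl), ha₂ a (by fin_cases h₁ <;> simp)]
  have u9 := ua 9 (by simp)
  have u10 := ua 10 (by simp)
  have u11 := ua 11 (by simp)
  have hlen := hg.suffix.length_lt hg.root
  have hpl : path T₀ [] = suffix T₀ [] := by rw [path_eq]; rfl
  refine ⟨by rw [hpl] at hτ₂; omega, ?_⟩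
  refine ⟨hr₂.of_fr hF₃ (by decide) (by decide) (by decide), u22.ge, ?_, ?_, ?_, ?_, ?_, ?_, ?_, ?_,
    Finset.empty_subset _⟩
  · refine ⟨?_, ?_, fun y h₁ h₂ => by omega, ?_, ?_, ?_⟩ <;> simp [Store.tour, u9, u10, u11, u13]
  · rw [u22]
    intro y h₁ h₂
    obtain rfl : y = 1 := by omega
    refine ⟨fun _ => ⟨?_, ?_, ?_⟩, fun _ => ⟨?_, ?_⟩, fun h₁ => absurd ?_ h₁,
      fun h₁ => absurd ?_ h₁⟩ <;> simp [Store.tour, u10, u11, u12, u13]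
    exact Tour.Anc.refl _ _
  · simp [u22]
  · intro y h₁ h₂
    obtain rfl : y = 1 := by omega
    simp [u12]
  · simp [u10]
  · intro y hy
    obtain rfl := Finset.mem_singleton.1 hy
    refine ⟨hg, ?_, u19, ?_, uk, ?_, ?_, ?_, by simp⟩
    · rw [ua 18 (by simp), hF₃.narr 17 rfl]; exact hpath
    · rw [ua 18 (by simp), u19, hF₃.nreg 20 rfl, htop]; simp
    · rw [ua 22 (by simp), hF₃.narr 16 rfl]; exact hT₂
    · rw [ua 22 (by simp), hF₃.nreg 8 rfl, t8]; simp
    · rw [ua 21 (by simp)]; rfl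
  · intro y hy
    refine ⟨∅, by simp, ?_⟩
    simp [u9]
  · intro _ _ _
    exact hg.isSimple_nil

/-- The program for the basic algorithm. -/
def basicAlgorithm : Prog := setup ;; dijkstra ;; emitTree ;; initRoot ;; mainLoop

/-- A bound for the time of `basicAlgorithm`. -/
def totalTime (N : Network) (k : ℕ) : ℕ :=
  N.m * 30 + N.n * 120 + 200 + dijTime N.n N.m + k * simpleCost N

theorem wp_basicAlgorithm (N : Network) (k : ℕ) (hN : N.IsConnected) :
    WP basicAlgorithm (inputStore N k) fun τ σ => τ ≤ totalTime N k ∧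
      ∃ (T₀ : N.Tree) (evs : List N.Event), IsRun T₀ k evs ∧ σ.out = encodeRun T₀ evs := by
  -- The memory outside of the input is zero at the beginning.
  have hn₀ : ∀ y, 5 ≤ y → (inputStore N k).nreg y = 0 := by
    intro y hy
    obtain ⟨z, rfl⟩ := Nat.exists_eq_add_of_le' hy
    rfl
  have ha₀ : ∀ a, 2 ≤ a → (inputStore N k).narr a = 0 := by
    intro a ha
    obtain ⟨z, rfl⟩ := Nat.exists_eq_add_of_le' ha
    ext i
    simp [inputStore]
  apply wp_seq
  refine (wp_setup N k).mono ?_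
  rintro τ₁ σ₁ hF₁ ⟨hτ₁, hr₁⟩
  apply wp_seq
  refine (wp_dijkstra (X := ∅) hr₁ (fun v => ?_) (by simp)).mono ?_
  · rw [hF₁.narr 15 rfl, ha₀ 15 (by norm_num)]; simp
  have s8 : σ₁.nreg 8 = 0 := by rw [hF₁.nreg 8 rfl, hn₀ 8 (by norm_num)]
  rw [s8]
  rintro τ₂ σ₂ hF₂ ⟨hτ₂, ⟨T₀, hT, hTA⟩, -⟩
  have hr₂ : Ready N k σ₂ := hr₁.of_fr hF₂ (by decide) (by decide) (by decide)
  have hn₂ : ∀ y ∈ [19, 20, 21], σ₂.nreg y = 0 := by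
    intro y hy
    rw [hF₂.nreg y (by fin_cases hy <;> rfl), hF₁.nreg y (by fin_cases hy <;> rfl),
      hn₀ y (by fin_cases hy <;> simp)]
  have ha₂ : ∀ a ∈ [9, 10, 11, 12, 13, 18, 19, 20, 21, 22, 23], σ₂.narr a = 0 := by
    intro a ha
    rw [hF₂.narr a (by fin_cases ha <;> rfl), hF₁.narr a (by fin_cases ha <;> rfl),
      ha₀ a (by fin_cases ha <;> simp)]
  apply wp_seq
  refine (wp_emitTree (T := T₀) hr₂ (by rw [hn₂ 19 (by simp)]; exact hTA)).mono ?_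
  rintro τ₃ σ₃ hF₃ ⟨hτ₃, hout₃⟩
  apply wp_seq
  refine (wp_initRoot (T₀ := T₀) (hr₂.of_fr hF₃ (by decide) (by decide) (by decide)) (Good.nil hT hN)
    (by rw [hF₃.narr 16 rfl]; exact hTA) ?_ ?_ ?_).mono ?_
  · rw [hF₃.nreg 19 rfl, hn₂ 19 (by simp)]
  · rw [hF₃.nreg 20 rfl, hn₂ 20 (by simp)]
  · intro a h₁
    rw [hF₃.narr a rfl, ha₂ a h₁]
  rintro τ₄ σ₄ hF₄ ⟨hτ₄, hQ₄⟩
  refine (wp_mainLoop hQ₄ rfl ?_).mono ?_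
  · rw [hF₄.nreg 21 rfl, hF₃.nreg 21 rfl, hn₂ 21 (by simp)]
  rintro τ₅ σ₅ hF₅ ⟨hτ₅, evs, b, hS, hb, hout⟩
  refine ⟨?_, T₀, evs, ⟨hT, b, hS, hb⟩, ?_⟩
  · rw [totalTime]; omega
  · rw [hout, hF₄.out rfl, hout₃, hF₂.out rfl, hF₁.out rfl, encodeRun]
    simp [inputStore]

end KSSP

namespace KSSP

/-! ### The time bound -/

/-- As every node lies between `s` and `t`, there are at most `m + 1` nodes. -/
theorem totalTime_le (N : Network) {k : ℕ} (hN : N.IsConnected) (hk : 0 < k) (hm : 0 < N.m) :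
    totalTime N k ≤ 8000 * (k * N.m * (N.m + N.n * Nat.log 2 N.n)) := by
  have hn := hN.n_le
  have hpos : 1 ≤ N.n := N.s.pos
  simp only [totalTime, simpleCost, repairCost, overhead, repairTime, expandTime, nodeTime,
    pushTime]
  have hdij : dijTime N.n N.m ≤ 400 * (N.m * Nat.log 2 N.n) + 1200 * N.m := by
    calc _ ≤ (4 * N.m) * (Nat.log 2 N.n * 100 + 300) := Nat.mul_le_mul_right _ (by omega)
      _ = _ := by ring
  generalize dijTime N.n N.m = D at hdij ⊢
  generalize Nat.log 2 N.n = L at hdij ⊢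
  generalize N.n = n at hn hpos hdij ⊢
  generalize N.m = m at hn hm hdij ⊢
  have hnm : n * m ≤ 2 * (m * m) := by
    rw [← mul_assoc]; exact Nat.mul_le_mul_right m (by omega)
  have hmm : m ≤ m * m := Nat.le_mul_of_pos_left m hm
  have hmL : m * L ≤ n * (m * L) := Nat.le_mul_of_pos_left _ hpos
  have hexp : n * (D + m * 70 + 60 + 70) ≤ 400 * (n * (m * L)) + 2800 * (m * m) := by
    calc _ ≤ n * (400 * (m * L) + 1400 * m) := Nat.mul_le_mul_left _ (by omega)
      _ = 400 * (n * (m * L)) + 1400 * (n * m) := by ring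
      _ ≤ _ := by omega
  have hpush : m * (n * 80 + m * 100 + 500 + 20) ≤ 780 * (m * m) := by
    calc _ ≤ m * (780 * m) := Nat.mul_le_mul_left _ (by omega)
      _ = _ := by ring
  have hrep : m * (n * 120 + m * 100 + 300 + (n * 140 + m * 100 + 500) + 20) ≤
      1540 * (m * m) := by
    calc _ ≤ m * (1540 * m) := Nat.mul_le_mul_left _ (by omega)
      _ = _ := by ring
  have hS : n * 120 + m * 100 + 300 + (n * (D + m * 70 + 60 + 70) +
      m * (n * 80 + m * 100 + 500 + 20) + 200) + 20 +
      m * (n * 120 + m * 100 + 300 + (n * 140 + m * 100 + 500) + 20) ≤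
      400 * (n * (m * L)) + 6000 * (m * m) := by omega
  have h₁ := Nat.mul_le_mul_left k hS
  have h₂ : m * 30 + n * 120 + 200 + D ≤ k * (400 * (n * (m * L)) + 1700 * (m * m)) :=
    le_trans (by omega) (Nat.le_mul_of_pos_left _ hk)
  calc _ ≤ k * (400 * (n * (m * L)) + 1700 * (m * m)) +
        k * (400 * (n * (m * L)) + 6000 * (m * m)) := Nat.add_le_add h₂ h₁
    _ = 800 * (k * (n * (m * L))) + 7700 * (k * (m * m)) := by ring
    _ ≤ 8000 * (k * (n * (m * L))) + 8000 * (k * (m * m)) := by omega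
    _ = _ := by ring

theorem natLog_two_le (n : ℕ) (hn : 1 ≤ n) : (Nat.log 2 n : ℝ) ≤ 2 * Real.log n := by
  have h₁ : (Nat.log 2 n : ℝ) ≤ Real.logb 2 n := by exact_mod_cast Real.natLog_le_logb n 2
  have h₂ : (0 : ℝ) ≤ Real.log n := Real.log_nonneg (by exact_mod_cast hn)
  have h₃ := Real.log_two_gt_d9
  rw [Real.logb, le_div_iff₀ (by linarith)] at h₁
  nlinarith [(Nat.cast_nonneg (Nat.log 2 n) : (0 : ℝ) ≤ _)]

end KSSP

theorem lemma2 :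
    ∃ (P : KSSP.Prog) (C : ℝ), ∀ (N : KSSP.Network) (k : ℕ),
      N.IsConnected → 0 < k → 0 < N.m →
      ∃ (T₀ : N.Tree) (evs : List N.Event) (τ : ℕ) (σ : KSSP.Store),
        KSSP.Network.IsRun T₀ k evs ∧
        KSSP.Exec P (KSSP.inputStore N k) τ σ ∧
        σ.out = KSSP.Network.encodeRun T₀ evs ∧
        (τ : ℝ) ≤ C * ((k : ℝ) * N.m * (N.m + N.n * Real.log N.n)) := by
  -- The factor is `8000`, times `2` for the change from the binary to the natural logarithm.
  refine ⟨KSSP.basicAlgorithm, 16000, fun N k hN hk hm => ?_⟩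
  obtain ⟨τ, σ, hE, hτ, T₀, evs, hrun, hout⟩ := KSSP.wp_basicAlgorithm N k hN
  refine ⟨T₀, evs, τ, σ, hrun, hE, hout, ?_⟩
  have h₁ : (τ : ℝ) ≤ 8000 * (k * N.m * (N.m + N.n * Nat.log 2 N.n)) := by
    exact_mod_cast hτ.trans (KSSP.totalTime_le N hN hk hm)
  have h₂ := KSSP.natLog_two_le N.n N.s.pos
  calc (τ : ℝ) ≤ 8000 * (k * N.m * (N.m + N.n * Nat.log 2 N.n)) := h₁
    _ ≤ 8000 * (k * N.m * (N.m + N.m + N.n * (2 * Real.log N.n))) := by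
      gcongr
      linarith [(Nat.cast_nonneg N.m : (0 : ℝ) ≤ N.m)]
    _ = 16000 * (k * N.m * (N.m + N.n * Real.log N.n)) := by ring
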